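/- Let $T>0$ and let a deep Neyman–Scott process on $[0,T]$ have layers $0,\dots,L$ (layer $0$ is the evidence $\mathbf x$, layers $1,\dots,L$ are hidden), with processes $Z_{\ell,k}$, $1\le k\le K_\ell$, on layer $\ell$, where $Z_{0,k}=\mathbf x_k$. The top-layer processes are independent homogeneous Poisson processes on $[0,T]$ with constant intensities $\lambda_{L,k}(t)=\mu_k>0$. For $\ell<L$, conditionally on the layers above, the $Z_{\ell,k}$, $1\le k\le K_\ell$, are independent Poisson processes on $[0,T]$ with intensities $$\lambda_{\ell,k}(t)=\sum_{i=1}^{K_{\ell+1}}\sum_{s\in Z_{\ell+1,i}}\phi_{(\ell+1,i)\to(\ell,k)}(t-s),$$ where each $\phi_{(\ell+1,i)\to(\ell,k)}$ is a gamma kernel, $\phi(x)=p\,\frac{\beta^{\alpha}}{\Gamma(\alpha)}x^{\alpha-1}e^{-\beta x}$ for $x>0$ and $\phi(x)=0$ for $x\le 0$, with parameters $p,\alpha,\beta>0$ that may depend on the connection; let $\Phi_{(\ell+1,i)\to(\ell,k)}(x)=\int_0^x\phi_{(\ell+1,i)\to(\ell,k)}(\tau)\,d\tau$. Fix $1\le\ell\le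 L$, $1\le k\le K_\ell$ and $t\in[0,T)$, and let $B_\Delta=[t,t+\Delta]$. Let $S$ be any set of nodes with $(\ell,k)\in S$, and let $\mathcal G_\Delta$ be the information consisting of the events outside $B_\Delta$ of the processes with index in $S$ and of all events of the other processes (for $S$ the set of all nodes this is the information of all the processes outside $B_\Delta$; for $S$ the set of hidden nodes the evidence is fully known; for $S=\{(\ell,k)\}$ only the events of $Z_{\ell,k}$ in $B_\Delta$ are unknown). Then the Papangelou conditional intensity of the posterior point process of $Z_{\ell,k}$ at $t$ exists and is given by $$\lim_{\Delta\downarrow0}\frac{\Pr\big(Z_{\ell,k}\text{ has exactly one event in }B_\Delta\,\big|\,\mathcal G_\Delta\big)}{\Delta}=\lambda_{\ell,k}(t)\prod_{i=1}^{K_{\ell-1}}\Bigg(\exp\!\big(-\Phi_{(\ell,k)\to(\ell-1,i)}(T-t)\big)\prod_{\substack{u\in Z_{\ell-1,i}\\u>t}}\frac{\lambda_{\ell-1,i}(u)+\phi_{(\ell,k)\to(\ell-1,i)}(u-t)}{\lambda_{\ell-1,i}(u)}\Bigg)$$ almost surely, for suitable versions of the conditional probabilities. -/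

import Mathlib

open MeasureTheory ProbabilityTheory Filter Topology
open scoped ENNReal

noncomputable section

/-- A realization of a temporal point process: a finite set of event times. (A wrapper around
`Finset ℝ`, so that it can carry the σ-algebra of point-process theory.) -/
@[ext] structure Config where
  /-- the event times -/
  events : Finset ℝ

namespace Config

open Classical in
/-- The part of the configuration that lies in `B`. -/
def inside (z : Config) (B : Set ℝ) : Config := ⟨z.events.filter (· ∈ B)⟩

open Classical in
/-- The part of the configuration that lies outside `B`. -/
def outside (z : Config) (B : Set ℝ) : Config := ⟨z.events.filter (· ∉ B)⟩

/-- The number of events in `B`. -/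
def count (z : Config) (B : Set ℝ) : ℕ := (z.inside B).events.card

/-- The usual σ-algebra on configurations: the one generated by the numbers of events in the
Borel sets. -/
instance : MeasurableSpace Config :=
  ⨆ B : {B : Set ℝ // MeasurableSet B}, MeasurableSpace.comap (fun z => z.count B) ⊤

/-- The configuration whose events are the coordinates of a vector. -/
def ofVec {n : ℕ} (x : Fin n → ℝ) : Config := ⟨Finset.univ.image x⟩

theorem measurable_ofVec (n : ℕ) : Measurable (ofVec : (Fin n → ℝ) → Config) := by
  classical
  refine Measurable.of_le_map (iSup_le ?_)
  rintro ⟨B, hB⟩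
  rw [← MeasurableSpace.comap_le_iff_le_map, MeasurableSpace.comap_comp]
  refine Measurable.comap_le (?_ : Measurable fun x : Fin n → ℝ => (ofVec x).count B)
  have key : (fun x : Fin n → ℝ => (ofVec x).count B) =
      fun x => ∑ i : Fin n, if x i ∈ B ∧ ∀ j, j < i → x j ≠ x i then 1 else 0 := by
    funext x
    rw [← Finset.card_filter]
    have hinj : Set.InjOn x
        (Finset.univ.filter fun i => x i ∈ B ∧ ∀ j, j < i → x j ≠ x i : Finset (Fin n)) := by
      intro i hi j hj hij
      simp only [Finset.coe_filter, Finset.mem_univ, true_and, Set.mem_ofPred_eq] at hi hj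
      rcases lt_trichotomy i j with h | h | h
      · exact absurd hij (hj.2 i h)
      · exact h
      · exact absurd hij.symm (hi.2 j h)
    rw [← Finset.card_image_of_injOn hinj]
    unfold count inside ofVec
    congr 1
    ext a
    simp only [Finset.mem_filter, Finset.mem_image, Finset.mem_univ, true_and]
    constructor
    · rintro ⟨⟨i, rfl⟩, hi⟩
      have hne : (Finset.univ.filter fun j => x j = x i).Nonempty := ⟨i, by simp⟩
      refine ⟨(Finset.univ.filter fun j => x j = x i).min' hne, ?_, ?_⟩
      · have hm := Finset.min'_mem _ hne
        simp only [Finset.mem_filter, Finset.mem_univ, true_and] at hm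
        refine ⟨by rw [hm]; exact hi, fun j hj hjx => ?_⟩
        exact absurd (Finset.min'_le _ j (by simp [hjx, hm])) (not_le.2 hj)
      · have hm := Finset.min'_mem _ hne
        simpa using hm
    · rintro ⟨i, ⟨hi, -⟩, rfl⟩
      exact ⟨⟨i, rfl⟩, hi⟩
  rw [key]
  refine Finset.measurable_sum _ fun i _ => Measurable.ite ?_ measurable_const measurable_const
  have h1 : MeasurableSet {x : Fin n → ℝ | x i ∈ B} := measurable_pi_apply i hB
  have h2 : MeasurableSet {x : Fin n → ℝ | ∀ j, j < i → x j ≠ x i} := by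
    have : {x : Fin n → ℝ | ∀ j, j < i → x j ≠ x i} =
        ⋂ j, ⋂ _ : j < i, {x | x j = x i}ᶜ := by
      ext x; simp
    rw [this]
    exact MeasurableSet.iInter fun j => MeasurableSet.iInter fun _ =>
      (measurableSet_eq_fun (measurable_pi_apply j) (measurable_pi_apply i)).compl
  exact h1.inter h2

end Config

/-- The law of the Poisson process whose intensity measure is the finite atomless measure `ν`:
the number of events is Poisson distributed with mean `ν ℝ`, and given that there are `n` events
they are `n` independent points with law `ν / ν ℝ`. Hence the weight of the `n`-point
configurations is `exp (-ν ℝ) / n! * ν ^ n`. -/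
def poissonLaw (ν : Measure ℝ) : Measure Config :=
  Measure.sum fun n : ℕ =>
    (ENNReal.ofReal (Real.exp (-(ν Set.univ).toReal)) / (n.factorial : ℝ≥0∞)) •
      (Measure.pi fun _ : Fin n => ν).map Config.ofVec

/-- The gamma kernel. -/
def gammaKernel (p α β x : ℝ) : ℝ :=
  if 0 < x then p * (β ^ α / Real.Gamma α) * x ^ (α - 1) * Real.exp (-(β * x)) else 0

/-- The parameters of a deep Neyman-Scott process observed on the time interval `[0, T]`.
The layers are `0, …, depth`; layer `0` is the evidence, layers `1, …, depth` are hidden, and layer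
`ℓ` has `width ℓ` processes. Whatever is indexed by a layer above `depth` is not used. -/
structure DNSP where
  /-- the number of hidden layers -/
  depth : ℕ
  /-- the number of processes of a layer -/
  width : ℕ → ℕ
  /-- the end of the observation interval -/
  T : ℝ
  T_pos : 0 < T
  /-- the constant intensities of the homogeneous Poisson processes of the top layer -/
  rate : Fin (width depth) → ℝ
  rate_pos : ∀ k, 0 < rate k
  /-- the kernel parameters for the connection from node `i` of layer `ℓ + 1` to node `k` of
  layer `ℓ` are `p ℓ i k`, `α ℓ i k`, `β ℓ i k` -/
  p : (ℓ : ℕ) → Fin (width (ℓ + 1)) → Fin (width ℓ) → ℝ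
  α : (ℓ : ℕ) → Fin (width (ℓ + 1)) → Fin (width ℓ) → ℝ
  β : (ℓ : ℕ) → Fin (width (ℓ + 1)) → Fin (width ℓ) → ℝ
  p_pos : ∀ ℓ i k, 0 < p ℓ i k
  α_pos : ∀ ℓ i k, 0 < α ℓ i k
  β_pos : ∀ ℓ i k, 0 < β ℓ i k

namespace DNSP

variable (M : DNSP)

/-- A joint realization of all the processes. -/
abbrev State : Type := (ℓ : ℕ) → Fin (M.width ℓ) → Config

/-- The nodes `(ℓ, k)`. -/
abbrev Node : Type := (ℓ : ℕ) × Fin (M.width ℓ)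

/-- The kernel `φ` of the connection from node `i` of layer `ℓ + 1` to node `k` of layer `ℓ`. -/
def φ (ℓ : ℕ) (i : Fin (M.width (ℓ + 1))) (k : Fin (M.width ℓ)) (x : ℝ) : ℝ :=
  gammaKernel (M.p ℓ i k) (M.α ℓ i k) (M.β ℓ i k) x

/-- The integrated kernel `Φ x = ∫₀ˣ φ`. -/
def Φ (ℓ : ℕ) (i : Fin (M.width (ℓ + 1))) (k : Fin (M.width ℓ)) (x : ℝ) : ℝ :=
  ∫ τ in (0 : ℝ)..x, M.φ ℓ i k τ

/-- The intensity of node `k` of layer `ℓ` at time `t`, given the realization `z`: constant on the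
top layer, and on the other layers the sum of the kernels centred at the events of the layer
immediately above. -/
def intensity (z : M.State) (ℓ : ℕ) (k : Fin (M.width ℓ)) (t : ℝ) : ℝ :=
  if h : ℓ = M.depth then M.rate (Fin.cast (congrArg M.width h) k)
  else ∑ i : Fin (M.width (ℓ + 1)), ∑ s ∈ (z (ℓ + 1) i).events, M.φ ℓ i k (t - s)

/-- The measure on `[0, T]` whose density is that intensity. -/
def intensityMeasure (z : M.State) (ℓ : ℕ) (k : Fin (M.width ℓ)) : Measure ℝ :=
  (volume.restrict (Set.Icc 0 M.T)).withDensity fun t => ENNReal.ofReal (M.intensity z ℓ k t)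

variable {Ω : Type*} [MeasurableSpace Ω]

/-- The information in the processes of the layers above `ℓ`. -/
@[reducible] def above (N : Ω → M.State) (ℓ : ℕ) : MeasurableSpace Ω :=
  ⨆ (j : ℕ) (_ : ℓ < j ∧ j ≤ M.depth) (k : Fin (M.width j)),
    MeasurableSpace.comap (fun ω => N ω j k) inferInstance

/-- The random state `N` is a deep Neyman-Scott process with parameters `M`: for every layer `ℓ`,
conditionally on the layers above, the processes of layer `ℓ` are independent Poisson processes
with the intensities `intensity`. (The top layer has no layer above it, so that its processes are
independent homogeneous Poisson processes.) -/
structure IsDeepNeymanScott (P : Measure Ω) (N : Ω → M.State) : Prop where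
  measurable : ∀ ℓ ≤ M.depth, ∀ k : Fin (M.width ℓ), Measurable fun ω => N ω ℓ k
  layer_law : ∀ ℓ ≤ M.depth, ∀ H : Set Ω, MeasurableSet[M.above N ℓ] H →
    ∀ A : Fin (M.width ℓ) → Set Config, (∀ k, MeasurableSet (A k)) →
      P (H ∩ ⋂ k, {ω | N ω ℓ k ∈ A k}) =
        ∫⁻ ω in H, ∏ k, poissonLaw (M.intensityMeasure (N ω) ℓ k) (A k) ∂P

open Classical in
/-- The information that is left when the events in `B` of the processes in `S` are hidden: the
events outside `B` of the processes in `S`, and all events of the other processes. For `S` the set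
of all nodes this is the information of all the processes outside `B`. -/
@[reducible] def informationOutside (N : Ω → M.State) (S : Set M.Node) (B : Set ℝ) : MeasurableSpace Ω :=
  ⨆ (j : ℕ) (_ : j ≤ M.depth) (i : Fin (M.width j)),
    MeasurableSpace.comap
      (fun ω => if (⟨j, i⟩ : M.Node) ∈ S then (N ω j i).outside B else N ω j i) inferInstance

end DNSP

/-- `c` is the Papangelou conditional intensity at time `t` of the point process `X`, where `𝒢 B`
is the information that remains when what happens in `B` is hidden: writing
`B Δ = [t, t + Δ]`,
`c = lim_{Δ → 0+} P (exactly one event of X in B Δ | 𝒢 (B Δ)) / Δ` almost surely.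
Each conditional probability is only determined up to a null set, so the limit is taken along
suitable versions `q Δ` of them; evaluating it along `Δ = 1 / n` shows that the limit is
almost surely the same for any two families of versions. -/
def IsPapangelouIntensity {Ω : Type*} [MeasurableSpace Ω] (P : Measure Ω) (X : Ω → Config)
    (𝒢 : Set ℝ → MeasurableSpace Ω) (t : ℝ) (c : Ω → ℝ) : Prop :=
  ∃ q : ℝ → Ω → ℝ,
    (∀ Δ > 0, q Δ =ᵐ[P]
      P⟦{ω | (X ω).count (Set.Icc t (t + Δ)) = 1} | 𝒢 (Set.Icc t (t + Δ))⟧) ∧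
    ∀ᵐ ω ∂P, Tendsto (fun Δ => q Δ ω / Δ) (𝓝[>] 0) (𝓝 (c ω))

end

/-!
Let `R` be the law under which all processes are independent Poisson processes with unit rate on
`[0, T]`. The joint law of a deep Neyman-Scott process has the density `D z = ∏ exp (T - ∫ λ) * ∏
λ u` with respect to `R`, with the outer product over all nodes and the inner one over the events
`u` of a node; this follows layer by layer from the likelihood ratio of two Poisson processes
(`poissonLaw.apply_withDensity`, `Cascade.map_eq_withDensity`). The proof works with a `Cascade`,
in which the layers are only remembered through the rank of a node.

Under `R` the events inside and outside of a set are independent (`poissonLaw.map_mix`). So Bayes'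
formula gives an explicit version of the conditional probability of an event `E` given what
happens outside of the windows `[t, t + Δ]` of the nodes in `S`: average `D * 1_E` and `D` over
configurations `w` that are drawn in the windows from `R`, with the realization `z` kept outside,
and divide (`Cascade.condProb_ae_eq`). It remains to find the limits of these averages for a fixed
`z` with `D z ≠ 0` and without an event at `t`, which is almost every `z`.

No event in the windows contributes `D z` to the denominator. Exactly one event at the node in
question and none at the other nodes contributes to the numerator, after division by `Δ`, the
density of `z` with an event added at `t`. The ratio of these two densities is the asserted
formula (`Cascade.addDensity_div_density`): an additional event `t` multiplies the density by its
own intensity, by `exp (-Φ (T - t))` for each node below, and by `(λ u + φ (u - t)) / λ u` for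
each event `u` of those nodes after `t`.

The other configurations are negligible (`Cascade.tendsto_setLIntegral_density`): those with at
least one event in the windows contribute `o(1)`, and those with at least two contribute `o(Δ)`.
This is not immediate, since the hidden windows may contain events of several layers that excite
each other, and gamma kernels with shape parameter below `1` are unbounded near `0`. The density
at `z` with events `w` added is at most a geometric factor in the number of added events times the
product of the intensities of a small cascade that lives in the windows
(`Cascade.density_mixAll_le`). Weight every event of that cascade by `a`. Integrating out one node
after the other, in the order of the ranks, the generating functional of a Poisson process shows
that its total mass is at most `exp (c * a * Δ)`, as long as `a` times the mass of the kernels on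
`[0, Δ]` stays bounded (`Cascade.lintegral_clusterWeight_le`). Since the kernels are integrable,
this allows a weight `a → ∞`, and a Chernoff type estimate gives the claim
(`Cascade.setLIntegral_density_le`).
-/

/-! ### Configurations: measurability, and mixing inside and outside of a set -/

namespace Config

theorem measurable_count {B : Set ℝ} (hB : MeasurableSet B) :
    Measurable fun z : Config => z.count B :=
  Measurable.of_comap_le (le_iSup (fun B : {B : Set ℝ // MeasurableSet B} =>
    MeasurableSpace.comap (fun z : Config => z.count B) ⊤) ⟨B, hB⟩)

/-- A map into configurations is measurable as soon as all its Borel counts are. -/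
theorem measurable_of_count {Y : Type*} [MeasurableSpace Y] {f : Y → Config}
    (h : ∀ B : Set ℝ, MeasurableSet B → Measurable fun y => (f y).count B) : Measurable f := by
  refine Measurable.of_le_map (iSup_le ?_)
  rintro ⟨B, hB⟩
  rw [← MeasurableSpace.comap_le_iff_le_map, MeasurableSpace.comap_comp]
  exact (h B hB).comap_le

theorem count_inside (z : Config) (A B : Set ℝ) : (z.inside A).count B = z.count (A ∩ B) := by
  classical
  simp only [count, inside, Finset.filter_filter, Set.mem_inter_iff]

theorem count_outside (z : Config) (A B : Set ℝ) : (z.outside A).count B = z.count (B \ A) := by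
  classical
  simp only [count, inside, outside, Finset.filter_filter, Set.mem_sdiff, and_comm]

theorem measurable_outside {B : Set ℝ} (hB : MeasurableSet B) :
    Measurable fun z : Config => z.outside B :=
  measurable_of_count fun A hA => by
    simpa only [count_outside] using measurable_count (hA.diff hB)

@[simp] theorem mem_inside {z : Config} {B : Set ℝ} {s : ℝ} :
    s ∈ (z.inside B).events ↔ s ∈ z.events ∧ s ∈ B := by
  classical simp [inside]

@[simp] theorem mem_outside {z : Config} {B : Set ℝ} {s : ℝ} :
    s ∈ (z.outside B).events ↔ s ∈ z.events ∧ s ∉ B := by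
  classical simp [outside]

/-- The configuration that agrees with `w` in `B` and with `z` outside `B`. -/
noncomputable def mix (B : Set ℝ) (z w : Config) : Config :=
  ⟨(z.outside B).events ∪ (w.inside B).events⟩

@[simp] theorem mem_mix {z w : Config} {B : Set ℝ} {s : ℝ} :
    s ∈ (mix B z w).events ↔ (s ∈ z.events ∧ s ∉ B) ∨ (s ∈ w.events ∧ s ∈ B) := by
  simp [mix]

theorem mix_events_of_mem {B : Set ℝ} {z w : Config} (hz : ∀ s ∈ z.events, s ∉ B)
    (hw : ∀ s ∈ w.events, s ∈ B) :
    (mix B z w).events = z.events ∪ w.events ∧ Disjoint z.events w.events := by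
  constructor
  · ext s
    rw [mem_mix, Finset.mem_union]
    exact or_congr (and_iff_left_of_imp (hz s)) (and_iff_left_of_imp (hw s))
  · exact Finset.disjoint_left.2 fun s hs hs' => hz s hs (hw s hs')

theorem count_mix (B A : Set ℝ) (z w : Config) :
    (mix B z w).count A = z.count (A \ B) + w.count (B ∩ A) := by
  classical
  rw [← count_outside, ← count_inside]
  unfold count
  rw [← Finset.card_union_of_disjoint]
  · congr 1
    ext s
    simp
    tauto
  · rw [Finset.disjoint_left]
    intro s hs hs'
    simp at hs hs'
    tauto

theorem measurable_mix {B : Set ℝ} (hB : MeasurableSet B) :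
    Measurable fun p : Config × Config => mix B p.1 p.2 :=
  measurable_of_count fun A hA => by
    simp only [count_mix]
    exact ((measurable_count (hA.diff hB)).comp measurable_fst).add
      ((measurable_count (hB.inter hA)).comp measurable_snd)

theorem outside_mix (B : Set ℝ) (z w : Config) : (mix B z w).outside B = z.outside B := by
  ext s; simp; tauto

theorem mix_outside (B : Set ℝ) (z w : Config) : mix B (z.outside B) w = mix B z w := by
  ext s; simp

@[simp] theorem outside_empty (z : Config) : z.outside ∅ = z := by ext s; simp

open Classical in
theorem count_univ (z : Config) : z.count Set.univ = z.events.card := by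
  simp [count, inside]

theorem measurable_card : Measurable fun z : Config => z.events.card := by
  simpa only [count_univ] using measurable_count MeasurableSet.univ

/-- The counting measure of a configuration, as a kernel from configurations to the line. Sums over
events are integrals against it. -/
noncomputable def countingKernel : Kernel Config ℝ where
  toFun z := ∑ s ∈ z.events, Measure.dirac s
  measurable' := by
    classical
    refine Measure.measurable_of_measurable_coe _ fun B hB => ?_
    have : (fun z : Config => (∑ s ∈ z.events, Measure.dirac s) B) =
        fun z => ((z.count B : ℕ) : ℝ≥0∞) := by
      funext z
      simp only [Measure.coe_finsetSum, Finset.sum_apply, Measure.dirac_apply' _ hB, count, inside,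
        Set.indicator_apply, Pi.one_apply, Finset.sum_boole]
    rw [this]
    exact measurable_from_top.comp (measurable_count hB)

theorem countingKernel_apply (z : Config) : countingKernel z = ∑ s ∈ z.events, Measure.dirac s :=
  rfl

instance : IsSFiniteKernel countingKernel := by
  classical
  -- the number of events is not bounded, but it is on each set of the partition by that number
  have hms : ∀ n : ℕ, MeasurableSet {z : Config | z.events.card = n} := fun n =>
    measurable_card (measurableSet_singleton n)
  have hz : ∀ n, IsFiniteKernel (Kernel.piecewise (hms n) countingKernel 0) := fun n => by
    refine ⟨⟨n, by simp, fun z => ?_⟩⟩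
    rw [Kernel.piecewise_apply]
    split_ifs with h
    · simp only [Set.mem_ofPred_eq] at h
      simp [countingKernel_apply, h]
    · simp
  have : countingKernel =
      Kernel.sum fun n : ℕ => Kernel.piecewise (hms n) countingKernel 0 := by
    ext z B hB
    rw [Kernel.sum_apply' _ _ hB, tsum_eq_single z.events.card]
    · rw [Kernel.piecewise_apply]; simp
    · intro n hn
      rw [Kernel.piecewise_apply, if_neg (by simpa using hn.symm)]; simp
  rw [this]
  infer_instance

section Events

variable {Y : Type*} [MeasurableSpace Y] {z : Y → Config}

theorem measurable_sum_events_ennreal (hz : Measurable z) {f : Y → ℝ → ℝ≥0∞}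
    (hf : Measurable (Function.uncurry f)) : Measurable fun y => ∑ s ∈ (z y).events, f y s := by
  have h : Measurable fun p : Y × Config => ∫⁻ s, f p.1 s ∂(countingKernel.comap
      (Prod.snd : Y × Config → Config) measurable_snd) p :=
    Measurable.lintegral_kernel_prod_right'
      (f := fun q : (Y × Config) × ℝ => f q.1.1 q.2)
      (hf.comp ((measurable_fst.comp measurable_fst).prodMk measurable_snd))
  have h2 := h.comp (measurable_id.prodMk hz)
  convert h2 using 1
  funext y
  simp [Kernel.comap_apply, countingKernel_apply, lintegral_finsetSum_measure]

theorem measurable_sum_events (hz : Measurable z) {f : Y → ℝ → ℝ}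
    (hf : Measurable (Function.uncurry f)) : Measurable fun y => ∑ s ∈ (z y).events, f y s := by
  -- positive and negative parts
  have h1 := measurable_sum_events_ennreal hz (f := fun y s => ENNReal.ofReal (f y s))
    hf.ennreal_ofReal
  have h2 := measurable_sum_events_ennreal hz (f := fun y s => ENNReal.ofReal (-f y s))
    hf.neg.ennreal_ofReal
  convert h1.ennreal_toReal.sub h2.ennreal_toReal using 1
  funext y
  rw [Pi.sub_apply, ENNReal.toReal_sum (by simp), ENNReal.toReal_sum (by simp),
    ← Finset.sum_sub_distrib]
  refine Finset.sum_congr rfl fun s _ => ?_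
  rw [ENNReal.toReal_ofReal', ENNReal.toReal_ofReal', max_zero_sub_max_neg_zero_eq_self]

/-- The product is turned into a sum by taking logarithms; events where the factor vanishes are
counted separately. -/
theorem measurable_prod_events (hz : Measurable z) {f : Y → ℝ → ℝ} (h0 : ∀ y s, 0 ≤ f y s)
    (hf : Measurable (Function.uncurry f)) : Measurable fun y => ∏ s ∈ (z y).events, f y s := by
  classical
  have h1 := measurable_sum_events hz (f := fun y s => if f y s = 0 then (1 : ℝ) else 0)
    (Measurable.ite (hf (measurableSet_singleton 0)) measurable_const measurable_const)
  have h2 := measurable_sum_events hz (f := fun y s => Real.log (f y s)) hf.log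
  have h3 : (fun y => ∏ s ∈ (z y).events, f y s) = fun y =>
      if ∑ s ∈ (z y).events, (if f y s = 0 then (1 : ℝ) else 0) = 0 then
        Real.exp (∑ s ∈ (z y).events, Real.log (f y s)) else 0 := by
    funext y
    have h4 := Finset.sum_eq_zero_iff_of_nonneg (s := (z y).events)
      (f := fun s => if f y s = 0 then (1 : ℝ) else 0) (fun s _ => by split_ifs <;> norm_num)
    split_ifs with h <;> rw [h4] at h
    · rw [Real.exp_sum]
      refine Finset.prod_congr rfl fun s hs => ?_
      have hs0 : f y s ≠ 0 := fun h' => by simpa [h'] using h s hs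
      rw [Real.exp_log (lt_of_le_of_ne (h0 y s) hs0.symm)]
    · push Not at h
      obtain ⟨s, hs, hs'⟩ := h
      exact Finset.prod_eq_zero hs (by simpa using hs')
  rw [h3]
  exact Measurable.ite (h1 (measurableSet_singleton 0)) h2.exp measurable_const

end Events

theorem measurableSet_exists_mem {A : Set ℝ} (hA : MeasurableSet A) :
    MeasurableSet {z : Config | ∃ s ∈ z.events, s ∈ A} := by
  classical
  have : {z : Config | ∃ s ∈ z.events, s ∈ A} = {z | z.count A = 0}ᶜ := by
    ext z
    simp [count, inside, Finset.card_eq_zero, Finset.filter_eq_empty_iff]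
  rw [this]
  exact (measurable_count hA (measurableSet_singleton 0)).compl

/-- The configuration whose events are the members of a finite family. -/
noncomputable def ofFamily {κ : Type*} [Fintype κ] (x : κ → ℝ) : Config :=
  ⟨by classical exact Finset.univ.image x⟩

@[simp] theorem mem_ofFamily {κ : Type*} [Fintype κ] {x : κ → ℝ} {s : ℝ} :
    s ∈ (ofFamily x).events ↔ ∃ i, x i = s := by
  simp [ofFamily]

@[simp] theorem mem_ofVec {n : ℕ} {x : Fin n → ℝ} {s : ℝ} :
    s ∈ (ofVec x).events ↔ ∃ i, x i = s := by
  simp [ofVec]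

theorem ofFamily_eq_ofVec {κ : Type*} [Fintype κ] {n : ℕ} (e : Fin n ≃ κ) (x : κ → ℝ) :
    ofFamily x = ofVec (fun i => x (e i)) := by
  ext s
  simp [e.exists_congr_left]

theorem measurable_ofFamily {κ : Type*} [Fintype κ] :
    Measurable (ofFamily : (κ → ℝ) → Config) := by
  have : (ofFamily : (κ → ℝ) → Config) =
      fun x => ofVec (fun i => x ((Fintype.equivFin κ).symm i)) :=
    funext fun x => ofFamily_eq_ofVec _ x
  rw [this]
  exact (measurable_ofVec _).comp (measurable_pi_lambda _ fun i => measurable_pi_apply _)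

end Config

/-! ### Poisson processes: generating functional and likelihood ratios -/

theorem ENNReal.tsum_pow_div_factorial {r : ℝ≥0∞} (hr : r ≠ ∞) :
    ∑' n : ℕ, r ^ n / (n.factorial : ℝ≥0∞) = ENNReal.ofReal (Real.exp r.toReal) := by
  have h := NormedSpace.expSeries_div_hasSum_exp (𝔸 := ℝ) r.toReal
  rw [← Real.exp_eq_exp_ℝ] at h
  rw [← h.tsum_eq, ENNReal.ofReal_tsum_of_nonneg (fun n => by positivity) h.summable]
  refine tsum_congr fun n => ?_
  rw [ENNReal.ofReal_div_of_pos (by positivity), ENNReal.ofReal_pow ENNReal.toReal_nonneg,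
    ENNReal.ofReal_toReal hr, ENNReal.ofReal_natCast]

theorem lintegral_pi_prod {n : ℕ} (ν : Measure ℝ) [SigmaFinite ν] (f : Fin n → ℝ → ℝ≥0∞)
    (hf : ∀ i, Measurable (f i)) :
    ∫⁻ x, ∏ i, f i (x i) ∂(Measure.pi fun _ : Fin n => ν) = ∏ i, ∫⁻ u, f i u ∂ν := by
  induction n with
  | zero => simp
  | succ n ih =>
    rw [← (measurePreserving_piFinSuccAbove (fun _ : Fin (n + 1) => ν) 0).symm.lintegral_comp_emb
      (MeasurableEquiv.measurableEmbedding _)]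
    simp only [Fin.prod_univ_succ, MeasurableEquiv.piFinSuccAbove_symm_apply,
      Fin.insertNthEquiv_zero, Fin.consEquiv_apply, Fin.cons_zero, Fin.cons_succ]
    rw [lintegral_prod_mul (f := f 0) (g := fun x : Fin n → ℝ => ∏ i, f i.succ (x i))
      (hf 0).aemeasurable
      (Finset.measurable_prod _ fun i _ => (hf i.succ).comp (measurable_pi_apply i)).aemeasurable,
      ih _ fun i => hf i.succ]

/-- Independent points with an atomless law are distinct, so that `Config.ofVec` does not merge
them. -/
theorem ae_pi_injective {n : ℕ} (ν : Measure ℝ) [SigmaFinite ν] [NullSingletonClass ν] :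
    ∀ᵐ x ∂(Measure.pi fun _ : Fin n => ν), Function.Injective x := by
  have h : ∀ i j : Fin n, i ≠ j → ∀ᵐ x ∂(Measure.pi fun _ : Fin n => ν), x i ≠ x j := by
    intro i j hij
    cases n with
    | zero => exact i.elim0
    | succ n =>
      obtain ⟨j', rfl⟩ := Fin.exists_succAbove_eq hij.symm
      have h1 := measurePreserving_piFinSuccAbove (fun _ : Fin (n + 1) => ν) i
      have h2 : ∀ᵐ p ∂(ν.prod (Measure.pi fun _ : Fin n => ν)), p.1 ≠ p.2 j' := by
        have hm : MeasurableSet {p : ℝ × (Fin n → ℝ) | p.1 = p.2 j'} :=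
          measurableSet_eq_fun measurable_fst ((measurable_pi_apply j').comp measurable_snd)
        rw [ae_iff]
        simp only [not_not]
        rw [Measure.measure_prod_null hm]
        refine Eventually.of_forall fun a => ?_
        have := Measure.pi_hyperplane (fun _ : Fin n => ν) j' a
        simpa [Set.preimage, eq_comm] using this
      exact h1.quasiMeasurePreserving.ae h2
  have h' := ae_all_iff.2 fun i => ae_all_iff.2 fun j =>
    (by by_cases hij : i = j
        · exact Eventually.of_forall fun x h => absurd hij h
        · filter_upwards [h i j hij] with x hx _ using hx :
      ∀ᵐ x ∂(Measure.pi fun _ : Fin n => ν), i ≠ j → x i ≠ x j)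
  filter_upwards [h'] with x hx i j hij
  by_contra hne
  exact hx i j hne hij

namespace poissonLaw

/-- The weight of the `n`-point configurations. -/
noncomputable def weight (ν : Measure ℝ) (n : ℕ) : ℝ≥0∞ :=
  ENNReal.ofReal (Real.exp (-(ν Set.univ).toReal)) / (n.factorial : ℝ≥0∞)

theorem lintegral_eq (ν : Measure ℝ) {G : Config → ℝ≥0∞} (hG : Measurable G) :
    ∫⁻ z, G z ∂(poissonLaw ν) =
      ∑' n, weight ν n * ∫⁻ x, G (Config.ofVec x) ∂(Measure.pi fun _ : Fin n => ν) := by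
  rw [poissonLaw, lintegral_sum_measure]
  refine tsum_congr fun n => ?_
  rw [lintegral_smul_measure, lintegral_map hG (Config.measurable_ofVec n)]
  rfl

theorem apply_eq (ν : Measure ℝ) {A : Set Config} (hA : MeasurableSet A) :
    poissonLaw ν A =
      ∑' n, weight ν n * (Measure.pi fun _ : Fin n => ν) (Config.ofVec ⁻¹' A) := by
  rw [poissonLaw, Measure.sum_apply _ hA]
  refine tsum_congr fun n => ?_
  rw [Measure.smul_apply, Measure.map_apply (Config.measurable_ofVec n) hA]
  rfl

theorem tsum_weight_mul_pow (ν : Measure ℝ) {r : ℝ≥0∞} (hr : r ≠ ∞) :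
    ∑' n, weight ν n * r ^ n =
      ENNReal.ofReal (Real.exp (-(ν Set.univ).toReal)) * ENNReal.ofReal (Real.exp r.toReal) := by
  rw [← ENNReal.tsum_pow_div_factorial hr, ← ENNReal.tsum_mul_left]
  refine tsum_congr fun n => ?_
  rw [weight, div_eq_mul_inv, div_eq_mul_inv, mul_assoc, mul_comm _ (r ^ n)]

theorem isProbabilityMeasure (ν : Measure ℝ) [IsFiniteMeasure ν] :
    IsProbabilityMeasure (poissonLaw ν) := by
  constructor
  rw [apply_eq ν MeasurableSet.univ]
  simp only [Set.preimage_univ, Measure.pi_univ, Finset.prod_const, Finset.card_univ,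
    Fintype.card_fin]
  rw [tsum_weight_mul_pow ν (measure_ne_top ν _), ← ENNReal.ofReal_mul (Real.exp_nonneg _),
    ← Real.exp_add]
  simp

instance (ν : Measure ℝ) [IsFiniteMeasure ν] : IsProbabilityMeasure (poissonLaw ν) :=
  isProbabilityMeasure ν

theorem prod_ofVec {n : ℕ} {x : Fin n → ℝ} (hx : Function.Injective x) (f : ℝ → ℝ≥0∞) :
    ∏ s ∈ (Config.ofVec x).events, f s = ∏ i, f (x i) := by
  simp only [Config.ofVec]
  rw [Finset.prod_image fun i _ j _ h => hx h]

theorem measurable_prod_ofReal {f : ℝ → ℝ} (hf : Measurable f) (h0 : ∀ u, 0 ≤ f u) :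
    Measurable fun z : Config => ∏ s ∈ z.events, ENNReal.ofReal (f s) := by
  have h := (Config.measurable_prod_events (z := fun z : Config => z) measurable_id
    (f := fun _ s => f s) (fun _ s => h0 s) (hf.comp measurable_snd)).ennreal_ofReal
  simpa only [ENNReal.ofReal_prod_of_nonneg fun i _ => h0 i] using h

/-- The probability generating functional of a Poisson process. -/
theorem lintegral_prod_events (ν : Measure ℝ) [IsFiniteMeasure ν] [NullSingletonClass ν]
    {f : ℝ → ℝ} (hf : Measurable f) (h0 : ∀ u, 0 ≤ f u) (hfi : ∫⁻ u, ENNReal.ofReal (f u) ∂ν ≠ ∞) :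
    ∫⁻ z, ∏ s ∈ z.events, ENNReal.ofReal (f s) ∂(poissonLaw ν) =
      ENNReal.ofReal (Real.exp (-(ν Set.univ).toReal)) *
        ENNReal.ofReal (Real.exp (∫⁻ u, ENNReal.ofReal (f u) ∂ν).toReal) := by
  rw [lintegral_eq ν (measurable_prod_ofReal hf h0), ← tsum_weight_mul_pow ν hfi]
  refine tsum_congr fun n => ?_
  congr 1
  rw [lintegral_congr_ae (g := fun x => ∏ i, ENNReal.ofReal (f (x i)))
    ((ae_pi_injective ν).mono fun x hx => prod_ofVec hx _),
    lintegral_pi_prod ν (fun _ u => ENNReal.ofReal (f u)) fun _ => hf.ennreal_ofReal]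
  simp

/-- The likelihood ratio of two Poisson processes: if the intensity measure has the density `f` with
respect to `ρ`, the law has the density `exp (ρ ℝ - ∫ f dρ) * ∏ f s`, the product over the events
`s`, with respect to the law of the Poisson process with intensity measure `ρ`. -/
theorem apply_withDensity (ρ : Measure ℝ) [IsFiniteMeasure ρ] [NullSingletonClass ρ] {f : ℝ → ℝ}
    (hf : Measurable f) (h0 : ∀ u, 0 ≤ f u) (hfi : ∫⁻ u, ENNReal.ofReal (f u) ∂ρ ≠ ∞)
    {A : Set Config} (hA : MeasurableSet A) :
    poissonLaw (ρ.withDensity fun u => ENNReal.ofReal (f u)) A =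
      ∫⁻ z, A.indicator (fun z => ENNReal.ofReal (Real.exp ((ρ Set.univ).toReal -
        (∫⁻ u, ENNReal.ofReal (f u) ∂ρ).toReal)) * ∏ s ∈ z.events, ENNReal.ofReal (f s)) z
          ∂(poissonLaw ρ) := by
  have hm := measurable_prod_ofReal hf h0
  rw [lintegral_eq ρ ((hm.const_mul _).indicator hA), apply_eq _ hA]
  refine tsum_congr fun n => ?_
  have : IsFiniteMeasure (ρ.withDensity fun u => ENNReal.ofReal (f u)) :=
    isFiniteMeasure_withDensity hfi
  have hpi : (Measure.pi fun _ : Fin n => ρ.withDensity fun u => ENNReal.ofReal (f u)) =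
      (Measure.pi fun _ : Fin n => ρ).withDensity fun x => ∏ i, ENNReal.ofReal (f (x i)) := by
    refine Measure.pi_eq fun s hs => ?_
    rw [withDensity_apply _ (MeasurableSet.univ_pi hs), ← lintegral_indicator
      (MeasurableSet.univ_pi hs)]
    simp_rw [withDensity_apply _ (hs _), ← lintegral_indicator (hs _)]
    rw [← lintegral_pi_prod ρ _ fun i => hf.ennreal_ofReal.indicator (hs i)]
    refine lintegral_congr fun x => ?_
    by_cases hx : x ∈ Set.univ.pi s
    · rw [Set.indicator_of_mem hx]
      exact Finset.prod_congr rfl fun i _ => by rw [Set.indicator_of_mem (hx i trivial)]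
    · rw [Set.indicator_of_notMem hx]
      obtain ⟨i, hi⟩ : ∃ i, x i ∉ s i := by simpa [Set.mem_pi] using hx
      exact (Finset.prod_eq_zero (Finset.mem_univ i) (by rw [Set.indicator_of_notMem hi])).symm
  have hmA : MeasurableSet (Config.ofVec (n := n) ⁻¹' A) := Config.measurable_ofVec n hA
  rw [hpi, withDensity_apply _ hmA, ← lintegral_indicator hmA]
  have hw : weight (ρ.withDensity fun u => ENNReal.ofReal (f u)) n =
      weight ρ n * ENNReal.ofReal (Real.exp ((ρ Set.univ).toReal -
        (∫⁻ u, ENNReal.ofReal (f u) ∂ρ).toReal)) := by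
    rw [weight, weight, withDensity_apply _ MeasurableSet.univ,
      Measure.restrict_univ, div_eq_mul_inv, div_eq_mul_inv, mul_right_comm,
      ← ENNReal.ofReal_mul (Real.exp_nonneg _), ← Real.exp_add]
    congr 4
    ring
  rw [hw, mul_assoc]
  congr 1
  rw [← lintegral_const_mul' _ _ ENNReal.ofReal_ne_top]
  refine lintegral_congr_ae ((ae_pi_injective ρ).mono fun x hx => ?_)
  by_cases hxA : Config.ofVec x ∈ A
  · simp only [Set.indicator_of_mem hxA]
    rw [Set.indicator_of_mem (show x ∈ Config.ofVec ⁻¹' A from hxA), prod_ofVec hx]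
  · simp only [Set.indicator_of_notMem hxA]
    rw [Set.indicator_of_notMem (show x ∉ Config.ofVec ⁻¹' A from hxA), mul_zero]

/-- A Poisson process has no event in a null set of its intensity measure. -/
theorem ae_forall_notMem (ν : Measure ℝ) [IsFiniteMeasure ν] {B : Set ℝ}
    (hB : MeasurableSet B) (h : ν B = 0) : ∀ᵐ z ∂(poissonLaw ν), ∀ s ∈ z.events, s ∉ B := by
  rw [ae_iff]
  have hm := Config.measurableSet_exists_mem hB
  have : {z : Config | ¬ ∀ s ∈ z.events, s ∉ B} = {z | ∃ s ∈ z.events, s ∈ B} := by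
    ext z; simp
  rw [this, apply_eq ν hm, ENNReal.tsum_eq_zero]
  intro n
  have h0 : ∀ᵐ x ∂(Measure.pi fun _ : Fin n => ν), ∀ i, x i ∉ B :=
    ae_all_iff.2 fun i => Measure.tendsto_eval_ae_ae.eventually (measure_eq_zero_iff_ae_notMem.1 h)
  rw [ae_iff] at h0
  refine mul_eq_zero_of_right _ (measure_mono_null (fun x hx => ?_) h0)
  obtain ⟨s, hs, hsB⟩ := hx
  obtain ⟨i, rfl⟩ := Config.mem_ofVec.1 hs
  exact fun hall => hall i hsB

end poissonLaw

/-! ### Poisson processes: independence of the parts inside and outside a set -/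

namespace poissonLaw

/-- The contribution to `∫ G d(poissonLaw ν)` of the vectors with `q` coordinates in `B` and `p`
coordinates outside `B`. -/
noncomputable def splitIntegral (ν : Measure ℝ) (B : Set ℝ) (G : Config → ℝ≥0∞) (q p : ℕ) : ℝ≥0∞ :=
  ∫⁻ y, ∫⁻ x, G (Config.mix B (Config.ofVec x) (Config.ofVec y))
    ∂(Measure.pi fun _ : Fin p => ν.restrict Bᶜ) ∂(Measure.pi fun _ : Fin q => ν.restrict B)

theorem lintegral_ofFamily {κ : Type*} [Fintype κ] {n : ℕ} (hn : Fintype.card κ = n)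
    (ν : Measure ℝ) [SigmaFinite ν] (F : Config → ℝ≥0∞) :
    ∫⁻ x, F (Config.ofFamily x) ∂(Measure.pi fun _ : κ => ν) =
      ∫⁻ x, F (Config.ofVec x) ∂(Measure.pi fun _ : Fin n => ν) := by
  subst hn
  rw [← (measurePreserving_piCongrLeft (fun _ : κ => ν)
    (Fintype.equivFin κ).symm).lintegral_comp_emb (MeasurableEquiv.measurableEmbedding _)]
  refine lintegral_congr fun x => ?_
  rw [Config.ofFamily_eq_ofVec (Fintype.equivFin κ).symm]
  congr 2
  funext i
  exact Equiv.piCongrLeft_apply_apply (fun _ : κ => ℝ) _ x i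

open Classical in
/-- The law of `n` points, split according to the set `I` of the indices of the points in `B`. -/
theorem pi_eq_sum_split {n : ℕ} (ν : Measure ℝ) [IsFiniteMeasure ν] {B : Set ℝ}
    (hB : MeasurableSet B) :
    (Measure.pi fun _ : Fin n => ν) = ∑ I : Finset (Fin n),
      Measure.pi fun i => if i ∈ I then ν.restrict B else ν.restrict Bᶜ := by
  have hfin : ∀ (I : Finset (Fin n)) (i : Fin n),
      IsFiniteMeasure (if i ∈ I then ν.restrict B else ν.restrict Bᶜ) := fun I i => by
    split_ifs <;> infer_instance
  refine Measure.pi_eq fun s hs => ?_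
  have h1 : ∀ i, ν (s i) = ν.restrict B (s i) + ν.restrict Bᶜ (s i) := fun i => by
    conv_lhs => rw [← Measure.restrict_add_restrict_compl (μ := ν) hB]
    rfl
  simp only [Measure.coe_finsetSum, Finset.sum_apply, Measure.pi_pi]
  simp_rw [h1]
  rw [Finset.prod_add, Finset.powerset_univ]
  refine Finset.sum_congr rfl fun I _ => ?_
  rw [← Finset.prod_mul_prod_compl I, Finset.compl_eq_univ_sdiff]
  congr 1
  · exact Finset.prod_congr rfl fun i hi => by rw [if_pos hi]
  · exact Finset.prod_congr rfl fun i hi => by rw [if_neg (Finset.mem_sdiff.1 hi).2]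

open Classical in
/-- By symmetry, the contribution of the index set `I` only depends on its cardinality. -/
theorem lintegral_split_index {n : ℕ} (ν : Measure ℝ) [IsFiniteMeasure ν] {B : Set ℝ}
    (hB : MeasurableSet B) {G : Config → ℝ≥0∞} (hG : Measurable G) (I : Finset (Fin n)) :
    ∫⁻ x, G (Config.ofVec x)
      ∂(Measure.pi fun i => if i ∈ I then ν.restrict B else ν.restrict Bᶜ) =
      splitIntegral ν B G I.card (n - I.card) := by
  have hfin : ∀ i : Fin n, IsFiniteMeasure (if i ∈ I then ν.restrict B else ν.restrict Bᶜ) :=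
    fun i => by split_ifs <;> infer_instance
  have h1 := measurePreserving_piEquivPiSubtypeProd
    (fun i => if i ∈ I then ν.restrict B else ν.restrict Bᶜ) (· ∈ I)
  have e1 : (fun i : {i // i ∈ I} => if (i : Fin n) ∈ I then ν.restrict B else ν.restrict Bᶜ) =
      fun _ => ν.restrict B := funext fun i => if_pos i.2
  have e2 : (fun i : {i // i ∉ I} => if (i : Fin n) ∈ I then ν.restrict B else ν.restrict Bᶜ) =
      fun _ => ν.restrict Bᶜ := funext fun i => if_neg i.2
  rw [e1, e2] at h1
  have hmix : Measurable fun p : ({i // i ∈ I} → ℝ) × ({i // i ∉ I} → ℝ) =>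
      G (Config.mix B (Config.ofFamily p.2) (Config.ofFamily p.1)) :=
    hG.comp ((Config.measurable_mix hB).comp
      ((Config.measurable_ofFamily.comp measurable_snd).prodMk
        (Config.measurable_ofFamily.comp measurable_fst)))
  have hae : ∀ᵐ x ∂(Measure.pi fun i => if i ∈ I then ν.restrict B else ν.restrict Bᶜ),
      ∀ i : Fin n, (i ∈ I → x i ∈ B) ∧ (i ∉ I → x i ∉ B) := by
    refine ae_all_iff.2 fun i => ?_
    have hi : ∀ᵐ u ∂(if i ∈ I then ν.restrict B else ν.restrict Bᶜ),
        (i ∈ I → u ∈ B) ∧ (i ∉ I → u ∉ B) := by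
      split_ifs with hi
      · filter_upwards [ae_restrict_mem hB] with u hu using ⟨fun _ => hu, fun h => absurd hi h⟩
      · filter_upwards [ae_restrict_mem hB.compl] with u hu
          using ⟨fun h => absurd h hi, fun _ => hu⟩
    exact (Measure.tendsto_eval_ae_ae (μ := fun i : Fin n =>
      if i ∈ I then ν.restrict B else ν.restrict Bᶜ) (i := i)).eventually hi
  calc _ = ∫⁻ x, G (Config.mix B (Config.ofFamily fun i : {i // i ∉ I} => x i)
          (Config.ofFamily fun i : {i // i ∈ I} => x i))
          ∂(Measure.pi fun i => if i ∈ I then ν.restrict B else ν.restrict Bᶜ) := by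
        refine lintegral_congr_ae (hae.mono fun x hx => ?_)
        simp only
        congr 1
        ext s
        simp only [Config.mem_ofVec, Config.mem_mix, Config.mem_ofFamily, Subtype.exists]
        constructor
        · rintro ⟨i, rfl⟩
          by_cases hi : i ∈ I
          · exact Or.inr ⟨⟨i, hi, rfl⟩, (hx i).1 hi⟩
          · exact Or.inl ⟨⟨i, hi, rfl⟩, (hx i).2 hi⟩
        · rintro (⟨⟨i, _, rfl⟩, _⟩ | ⟨⟨i, _, rfl⟩, _⟩) <;> exact ⟨i, rfl⟩
    _ = ∫⁻ p, G (Config.mix B (Config.ofFamily p.2) (Config.ofFamily p.1))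
          ∂((Measure.pi fun _ : {i // i ∈ I} => ν.restrict B).prod
            (Measure.pi fun _ : {i // i ∉ I} => ν.restrict Bᶜ)) := by
        convert h1.lintegral_comp hmix <;> rfl
    _ = splitIntegral ν B G I.card (n - I.card) := by
        rw [lintegral_prod _ hmix.aemeasurable, splitIntegral]
        have hc : Fintype.card {i // i ∉ I} = n - I.card := by
          rw [Fintype.card_subtype_compl, Fintype.card_fin, Fintype.card_coe]
        rw [lintegral_ofFamily (κ := {i // i ∈ I}) (n := I.card) (Fintype.card_coe I)
          (ν.restrict B) fun w => ∫⁻ x, G (Config.mix B (Config.ofFamily x) w)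
            ∂(Measure.pi fun _ : {i // i ∉ I} => ν.restrict Bᶜ)]
        refine lintegral_congr fun y => ?_
        exact lintegral_ofFamily hc (ν.restrict Bᶜ) fun z => G (Config.mix B z (Config.ofVec y))

theorem lintegral_ofVec_split {n : ℕ} (ν : Measure ℝ) [IsFiniteMeasure ν] {B : Set ℝ}
    (hB : MeasurableSet B) {G : Config → ℝ≥0∞} (hG : Measurable G) :
    ∫⁻ x, G (Config.ofVec x) ∂(Measure.pi fun _ : Fin n => ν) =
      ∑ p ∈ Finset.HasAntidiagonal.antidiagonal n, n.choose p.1 • splitIntegral ν B G p.1 p.2 := by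
  classical
  rw [pi_eq_sum_split ν hB, lintegral_finsetSum_measure]
  simp_rw [lintegral_split_index ν hB hG]
  rw [← Finset.powerset_univ, Finset.sum_powerset_apply_card
    (fun q => splitIntegral ν B G q (n - q)), Finset.card_univ, Fintype.card_fin,
    Finset.Nat.sum_antidiagonal_eq_sum_range_succ_mk]

/-- The binomial identity behind the independence of the parts inside and outside `B`. -/
theorem weight_mul_choose (ν : Measure ℝ) [IsFiniteMeasure ν] {B : Set ℝ} (hB : MeasurableSet B)
    {n : ℕ} {p : ℕ × ℕ} (hp : p ∈ Finset.HasAntidiagonal.antidiagonal n) :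
    weight ν n * (n.choose p.1 : ℝ≥0∞) =
      weight (ν.restrict B) p.1 * weight (ν.restrict Bᶜ) p.2 := by
  obtain ⟨q, p⟩ := p
  obtain rfl := Finset.HasAntidiagonal.mem_antidiagonal.1 hp
  have he : ENNReal.ofReal (Real.exp (-(ν Set.univ).toReal)) =
      ENNReal.ofReal (Real.exp (-(ν.restrict B Set.univ).toReal)) *
        ENNReal.ofReal (Real.exp (-(ν.restrict Bᶜ Set.univ).toReal)) := by
    rw [← ENNReal.ofReal_mul (Real.exp_nonneg _), ← Real.exp_add, Measure.restrict_apply_univ,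
      Measure.restrict_apply_univ, ← measure_add_measure_compl hB,
      ENNReal.toReal_add (measure_ne_top ν _) (measure_ne_top ν _), neg_add]
  have hc : ((q + p).factorial : ℝ≥0∞) = (q + p).choose q * (q.factorial * p.factorial) := by
    have := Nat.choose_mul_factorial_mul_factorial (Nat.le_add_right q p)
    rw [Nat.add_sub_cancel_left] at this
    rw [← mul_assoc]
    exact_mod_cast this.symm
  have hne : ((q + p).choose q : ℝ≥0∞) ≠ 0 := by
    exact_mod_cast (Nat.choose_pos (Nat.le_add_right q p)).ne'
  simp only [weight, he, hc]
  rw [div_eq_mul_inv, div_eq_mul_inv, div_eq_mul_inv,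
    ENNReal.mul_inv (Or.inl hne) (Or.inl (ENNReal.natCast_ne_top _)),
    ENNReal.mul_inv (Or.inl (by exact_mod_cast q.factorial_ne_zero))
      (Or.inl (ENNReal.natCast_ne_top _))]
  set E := ENNReal.ofReal (Real.exp (-(ν.restrict B Set.univ).toReal))
  set E' := ENNReal.ofReal (Real.exp (-(ν.restrict Bᶜ Set.univ).toReal))
  calc E * E' * (((q + p).choose q : ℝ≥0∞)⁻¹ * ((q.factorial : ℝ≥0∞)⁻¹ * (p.factorial : ℝ≥0∞)⁻¹)) *
        ((q + p).choose q : ℝ≥0∞) =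
      (((q + p).choose q : ℝ≥0∞)⁻¹ * ((q + p).choose q : ℝ≥0∞)) *
        (E * (q.factorial : ℝ≥0∞)⁻¹ * (E' * (p.factorial : ℝ≥0∞)⁻¹)) := by ring
    _ = _ := by rw [ENNReal.inv_mul_cancel hne (ENNReal.natCast_ne_top _), one_mul]

/-- The parts of a Poisson process inside and outside `B` are independent Poisson processes. -/
theorem lintegral_split (ν : Measure ℝ) [IsFiniteMeasure ν] {B : Set ℝ} (hB : MeasurableSet B)
    {G : Config → ℝ≥0∞} (hG : Measurable G) :
    ∫⁻ z, G z ∂(poissonLaw ν) = ∫⁻ w, ∫⁻ z, G (Config.mix B z w)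
      ∂(poissonLaw (ν.restrict Bᶜ)) ∂(poissonLaw (ν.restrict B)) := by
  have hm : Measurable fun p : Config × Config => G (Config.mix B p.2 p.1) :=
    hG.comp ((Config.measurable_mix hB).comp measurable_swap)
  rw [lintegral_eq _ hm.lintegral_prod_right']
  calc ∫⁻ z, G z ∂(poissonLaw ν) = ∑' n, ∑ p ∈ Finset.HasAntidiagonal.antidiagonal n,
        weight (ν.restrict B) p.1 * weight (ν.restrict Bᶜ) p.2 * splitIntegral ν B G p.1 p.2 := by
        rw [lintegral_eq ν hG]
        refine tsum_congr fun n => ?_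
        rw [lintegral_ofVec_split ν hB hG, Finset.mul_sum]
        refine Finset.sum_congr rfl fun p hp => ?_
        rw [nsmul_eq_mul, ← mul_assoc, weight_mul_choose ν hB hp]
    _ = ∑' p : ℕ × ℕ,
        weight (ν.restrict B) p.1 * weight (ν.restrict Bᶜ) p.2 * splitIntegral ν B G p.1 p.2 := by
        rw [← Finset.HasAntidiagonal.sigmaAntidiagonalEquivProd.tsum_eq, ENNReal.tsum_sigma']
        refine tsum_congr fun n => ?_
        rw [tsum_fintype, ← Finset.sum_coe_sort]
        rfl
    _ = _ := by
        rw [ENNReal.tsum_prod']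
        refine tsum_congr fun q => ?_
        simp_rw [mul_assoc]
        rw [ENNReal.tsum_mul_left]
        congr 1
        have hx : ∀ y : Fin q → ℝ, ∫⁻ z, G (Config.mix B z (Config.ofVec y))
            ∂(poissonLaw (ν.restrict Bᶜ)) = ∑' p, weight (ν.restrict Bᶜ) p *
              ∫⁻ x, G (Config.mix B (Config.ofVec x) (Config.ofVec y))
                ∂(Measure.pi fun _ : Fin p => ν.restrict Bᶜ) := fun y =>
          lintegral_eq _ (hm.comp measurable_prodMk_left)
        simp_rw [hx]
        have hmp : ∀ p : ℕ, Measurable fun y : Fin q → ℝ =>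
            ∫⁻ x, G (Config.mix B (Config.ofVec x) (Config.ofVec y))
              ∂(Measure.pi fun _ : Fin p => ν.restrict Bᶜ) := fun p =>
          Measurable.lintegral_prod_right' (f := fun r : (Fin q → ℝ) × (Fin p → ℝ) =>
            G (Config.mix B (Config.ofVec r.2) (Config.ofVec r.1)))
            (hm.comp (((Config.measurable_ofVec q).comp measurable_fst).prodMk
              ((Config.measurable_ofVec p).comp measurable_snd)))
        rw [lintegral_tsum fun p => ((hmp p).const_mul _).aemeasurable]
        refine tsum_congr fun p => ?_
        rw [lintegral_const_mul _ (hmp p), splitIntegral]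

/-- Replacing the events of a Poisson process in `B` by those of an independent Poisson process
in `B` does not change the law. -/
theorem map_mix (ν : Measure ℝ) [IsFiniteMeasure ν] {B : Set ℝ} (hB : MeasurableSet B) :
    ((poissonLaw ν).prod (poissonLaw (ν.restrict B))).map (fun p => Config.mix B p.1 p.2) =
      poissonLaw ν := by
  refine Measure.ext_of_lintegral _ fun G hG => ?_
  have hm : Measurable fun p : Config × Config => G (Config.mix B p.1 p.2) :=
    hG.comp (Config.measurable_mix hB)
  rw [lintegral_map hG (Config.measurable_mix hB), lintegral_prod_symm' _ hm,
    lintegral_split ν hB hG]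
  refine lintegral_congr fun w => ?_
  have h1 : Measurable fun z : Config => G (Config.mix B z w) :=
    hm.comp measurable_prodMk_right
  rw [lintegral_split ν hB h1]
  -- the events in `B` that are replaced play no role
  have h2 : ∀ z w', Config.mix B (Config.mix B z w') w = Config.mix B z w := fun z w' => by
    rw [← Config.mix_outside, Config.outside_mix, Config.mix_outside]
  simp [h2]

end poissonLaw

/-! ### Cascades of point processes and the density of their joint law -/

section ProductMeasure

theorem measurable_update_pair {ι α : Type*} [DecidableEq ι] [MeasurableSpace α] (i : ι) :
    Measurable fun p : (ι → α) × α => Function.update p.1 i p.2 := by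
  refine measurable_pi_lambda _ fun j => ?_
  by_cases h : j = i
  · subst h; simpa using measurable_snd
  · simp only [Function.update_of_ne h]
    exact (measurable_pi_apply j).comp measurable_fst

theorem measure_ext_of_univ_pi {ι α : Type*} [Fintype ι] [MeasurableSpace α]
    {m m' : Measure (ι → α)} [IsFiniteMeasure m]
    (h : ∀ B : ι → Set α, (∀ j, MeasurableSet (B j)) → m (Set.univ.pi B) = m' (Set.univ.pi B)) :
    m = m' := by
  refine ext_of_generate_finite _ generateFrom_pi.symm isPiSystem_pi ?_ ?_
  · rintro _ ⟨B, hB, rfl⟩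
    exact h B fun j => hB j (Set.mem_univ j)
  · simpa only [Set.pi_univ] using h (fun _ => Set.univ) fun _ => MeasurableSet.univ

variable {ι α : Type*} [Fintype ι] [DecidableEq ι] [MeasurableSpace α]
  (μ : ι → Measure α) [∀ i, IsProbabilityMeasure (μ i)]

/-- Redrawing one coordinate does not change a product of probability measures. -/
theorem map_update_pi (i : ι) :
    ((Measure.pi μ).prod (μ i)).map (fun p => Function.update p.1 i p.2) = Measure.pi μ := by
  have hm := measurable_update_pair (α := α) i
  refine (Measure.pi_eq fun s hs => ?_).symm
  rw [Measure.map_apply hm (MeasurableSet.univ_pi hs)]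
  have : (fun p : (ι → α) × α => Function.update p.1 i p.2) ⁻¹' Set.univ.pi s =
      (Set.univ.pi (Function.update s i Set.univ)) ×ˢ s i := by
    ext p
    simp only [Set.mem_preimage, Set.mem_pi, Set.mem_univ, true_implies, Set.mem_prod]
    constructor
    · intro h
      refine ⟨fun j => ?_, by simpa using h i⟩
      by_cases hj : j = i
      · subst hj; simp
      · simpa [Function.update_of_ne hj] using h j
    · rintro ⟨h, hi⟩ j
      by_cases hj : j = i
      · subst hj; simpa using hi
      · simpa [Function.update_of_ne hj] using h j
  rw [this, Measure.prod_prod, Measure.pi_pi]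
  rw [← Finset.mul_prod_erase _ _ (Finset.mem_univ i),
    ← Finset.mul_prod_erase _ (fun j => μ j (s j)) (Finset.mem_univ i)]
  simp only [Function.update_self, measure_univ, one_mul]
  rw [mul_comm]
  congr 1
  exact Finset.prod_congr rfl fun j hj => by
    rw [Function.update_of_ne (Finset.ne_of_mem_erase hj)]

/-- Under a product measure a coordinate may be integrated out first, if the integrand depends on it
only through the second argument of `g`. -/
theorem lintegral_pi_mul_coord (i : ι) {G : (ι → α) → ℝ≥0∞} {g : (ι → α) → α → ℝ≥0∞}
    (hG : Measurable G) (hg : Measurable (Function.uncurry g))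
    (hGi : ∀ x y, G (Function.update x i y) = G x)
    (hgi : ∀ x y v, g (Function.update x i y) v = g x v) :
    ∫⁻ x, G x * g x (x i) ∂(Measure.pi μ) =
      ∫⁻ x, G x * ∫⁻ v, g x v ∂(μ i) ∂(Measure.pi μ) := by
  have hm : Measurable fun x => G x * g x (x i) :=
    hG.mul (hg.comp (measurable_id.prodMk (measurable_pi_apply i)))
  conv_lhs => rw [← map_update_pi μ i]
  rw [lintegral_map hm (measurable_update_pair i),
    lintegral_prod (fun p : (ι → α) × α => G (Function.update p.1 i p.2) *
      g (Function.update p.1 i p.2) (Function.update p.1 i p.2 i))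
      (hm.comp (measurable_update_pair i)).aemeasurable]
  refine lintegral_congr fun x => ?_
  simp only [hGi, hgi, Function.update_self]
  rw [lintegral_const_mul _ hg.of_uncurry_left]

theorem lintegral_pi_mul_prod_coord (s : Finset ι) {G : (ι → α) → ℝ≥0∞}
    {g : ι → (ι → α) → α → ℝ≥0∞}
    (hG : Measurable G) (hg : ∀ i, Measurable (Function.uncurry (g i)))
    (hGi : ∀ i ∈ s, ∀ x y, G (Function.update x i y) = G x)
    (hgi : ∀ i ∈ s, ∀ j ∈ s, ∀ x y v, g j (Function.update x i y) v = g j x v) :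
    ∫⁻ x, G x * ∏ i ∈ s, g i x (x i) ∂(Measure.pi μ) =
      ∫⁻ x, G x * ∏ i ∈ s, ∫⁻ v, g i x v ∂(μ i) ∂(Measure.pi μ) := by
  induction s using Finset.induction_on generalizing G with
  | empty => simp
  | insert a s has ih =>
    have hmem : ∀ i ∈ s, i ∈ insert a s := fun i hi => Finset.mem_insert_of_mem hi
    have ha := Finset.mem_insert_self a s
    simp only [Finset.prod_insert has]
    have hmi : ∀ i, Measurable fun x => ∫⁻ v, g i x v ∂(μ i) := fun i =>
      (hg i).lintegral_prod_right'
    calc ∫⁻ x, G x * (g a x (x a) * ∏ i ∈ s, g i x (x i)) ∂(Measure.pi μ)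
        = ∫⁻ x, (G x * ∏ i ∈ s, g i x (x i)) * g a x (x a) ∂(Measure.pi μ) := by
          refine lintegral_congr fun x => ?_
          ring
      _ = ∫⁻ x, (G x * ∏ i ∈ s, g i x (x i)) * ∫⁻ v, g a x v ∂(μ a) ∂(Measure.pi μ) := by
          refine lintegral_pi_mul_coord μ a
            (hG.mul (Finset.measurable_prod _ fun i _ =>
              (hg i).comp (measurable_id.prodMk (measurable_pi_apply i)))) (hg a) ?_ ?_
          · intro x y
            rw [hGi a ha]
            congr 1
            refine Finset.prod_congr rfl fun i hi => ?_
            rw [hgi a ha i (hmem i hi), Function.update_of_ne]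
            rintro rfl
            exact has hi
          · exact hgi a ha a ha
      _ = ∫⁻ x, (G x * ∫⁻ v, g a x v ∂(μ a)) * ∏ i ∈ s, g i x (x i) ∂(Measure.pi μ) := by
          refine lintegral_congr fun x => ?_
          ring
      _ = ∫⁻ x, (G x * ∫⁻ v, g a x v ∂(μ a)) * ∏ i ∈ s, ∫⁻ v, g i x v ∂(μ i)
            ∂(Measure.pi μ) := by
          refine ih (hG.mul (hmi a)) ?_ ?_
          · intro i hi x y
            rw [hGi i (hmem i hi)]
            simp only [hgi i (hmem i hi) a ha]
          · exact fun i hi j hj => hgi i (hmem i hi) j (hmem j hj)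
      _ = _ := by
          refine lintegral_congr fun x => ?_
          ring

end ProductMeasure

/-- A cascade of point processes on `[0, T]` with a finite set `ι` of nodes. Every event `s` of node
`i` adds `ker i j (· - s)` to the intensity of node `j`; the influence only goes from nodes of
higher rank to nodes of lower rank. Kernels need not be continuous at `0`, nor bounded: gamma
kernels with shape parameter at most `1` are not. -/
structure Cascade (ι : Type*) where
  /-- the end of the observation interval -/
  T : ℝ
  /-- the part of the intensity of a node that does not depend on the other nodes -/
  rate : ι → ℝ
  /-- the kernels of the connections -/
  ker : ι → ι → ℝ → ℝ
  /-- the number of the layer of a node -/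
  rank : ι → ℕ
  T_nonneg : 0 ≤ T
  rate_nonneg : ∀ i, 0 ≤ rate i
  ker_nonneg : ∀ i j u, 0 ≤ ker i j u
  ker_of_nonpos : ∀ i j u, u ≤ 0 → ker i j u = 0
  ker_measurable : ∀ i j, Measurable (ker i j)
  ker_continuousAt : ∀ i j u, u ≠ 0 → ContinuousAt (ker i j) u
  ker_integrable : ∀ i j, Integrable (ker i j)
  ker_eq_zero : ∀ i j, rank i ≤ rank j → ∀ u, ker i j u = 0

namespace Cascade

variable {ι : Type*} (M : Cascade ι)

/-- Lebesgue measure on the observation interval. -/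
noncomputable def base : Measure ℝ := volume.restrict (Set.Icc 0 M.T)

instance : IsFiniteMeasure M.base := by unfold base; infer_instance

instance : NullSingletonClass M.base := by unfold base; infer_instance

theorem base_univ : M.base Set.univ = ENNReal.ofReal M.T := by
  simp [base]

variable [Fintype ι]

/-- The intensity of node `j` at time `u`, given the configurations `x` of the nodes. -/
noncomputable def lam (x : ι → Config) (j : ι) (u : ℝ) : ℝ :=
  M.rate j + ∑ i, ∑ s ∈ (x i).events, M.ker i j (u - s)

/-- The reference law: all nodes are independent Poisson processes with unit intensity. -/
noncomputable def refLaw : Measure (ι → Config) := Measure.pi fun _ => poissonLaw M.base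

instance : IsProbabilityMeasure M.refLaw := by unfold refLaw; infer_instance

/-- The total intensity of node `j`. -/
noncomputable def total (x : ι → Config) (j : ι) : ℝ := ∫ u, M.lam x j u ∂M.base

/-- The density at `y` of the law of node `j` given the nodes of higher rank, with respect to the
Poisson process with unit intensity. -/
noncomputable def nodeWeight (x : ι → Config) (j : ι) (y : Config) : ℝ≥0∞ :=
  ENNReal.ofReal (Real.exp (M.T - M.total x j)) * ∏ s ∈ y.events, ENNReal.ofReal (M.lam x j s)

/-- The density of the joint law with respect to the reference law. -/
noncomputable def density (x : ι → Config) : ℝ≥0∞ := ∏ j, M.nodeWeight x j (x j)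

theorem lam_nonneg (x : ι → Config) (j : ι) (u : ℝ) : 0 ≤ M.lam x j u :=
  add_nonneg (M.rate_nonneg j) (Finset.sum_nonneg fun i _ => Finset.sum_nonneg fun _ _ =>
    M.ker_nonneg i j _)

theorem lam_congr {x x' : ι → Config} {j : ι} (h : ∀ i, M.rank j < M.rank i → x i = x' i) :
    M.lam x j = M.lam x' j := by
  funext u
  unfold lam
  congr 1
  refine Finset.sum_congr rfl fun i _ => ?_
  by_cases hi : M.rank j < M.rank i
  · rw [h i hi]
  · simp [M.ker_eq_zero i j (not_lt.1 hi)]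

theorem measurable_lam (j : ι) :
    Measurable (Function.uncurry fun (x : ι → Config) (u : ℝ) => M.lam x j u) := by
  refine Measurable.const_add (Finset.measurable_sum _ fun i _ => ?_) _
  exact Config.measurable_sum_events (z := fun p : (ι → Config) × ℝ => p.1 i)
    ((measurable_pi_apply i).comp measurable_fst) (f := fun p s => M.ker i j (p.2 - s))
    ((M.ker_measurable i j).comp ((measurable_snd.comp measurable_fst).sub measurable_snd))

theorem measurable_lam_right (x : ι → Config) (j : ι) : Measurable (M.lam x j) :=
  (M.measurable_lam j).of_uncurry_left

theorem integrable_lam (x : ι → Config) (j : ι) : Integrable (M.lam x j) M.base := by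
  unfold lam
  refine (integrable_const _).add (integrable_finsetSum _ fun i _ => integrable_finsetSum _
    fun s _ => ?_)
  exact ((M.ker_integrable i j).comp_sub_right s).restrict

theorem lintegral_lam (x : ι → Config) (j : ι) :
    ∫⁻ u, ENNReal.ofReal (M.lam x j u) ∂M.base = ENNReal.ofReal (M.total x j) :=
  (ofReal_integral_eq_lintegral_ofReal (M.integrable_lam x j)
    (Eventually.of_forall (M.lam_nonneg x j))).symm

theorem total_nonneg (x : ι → Config) (j : ι) : 0 ≤ M.total x j :=
  integral_nonneg (M.lam_nonneg x j)

theorem measurable_total (j : ι) : Measurable fun x => M.total x j := by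
  have h : Measurable fun x => ∫⁻ u, ENNReal.ofReal (M.lam x j u) ∂M.base :=
    (M.measurable_lam j).ennreal_ofReal.lintegral_prod_right'
  simp_rw [lintegral_lam] at h
  convert h.ennreal_toReal using 1
  funext x
  rw [ENNReal.toReal_ofReal (M.total_nonneg x j)]

theorem measurable_nodeWeight (j : ι) : Measurable (Function.uncurry fun x y =>
    M.nodeWeight x j y) := by
  refine Measurable.mul ?_ ?_
  · exact Measurable.comp (g := fun x => ENNReal.ofReal (Real.exp (M.T - M.total x j)))
      (measurable_const.sub (M.measurable_total j)).exp.ennreal_ofReal measurable_fst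
  · have hlam : Measurable (Function.uncurry
        fun (p : (ι → Config) × Config) (s : ℝ) => M.lam p.1 j s) :=
      Measurable.comp (g := Function.uncurry fun (x : ι → Config) (u : ℝ) => M.lam x j u)
        (f := fun q : ((ι → Config) × Config) × ℝ => (q.1.1, q.2)) (M.measurable_lam j)
        ((measurable_fst.comp measurable_fst).prodMk measurable_snd)
    have h := (Config.measurable_prod_events (z := fun p : (ι → Config) × Config => p.2)
      measurable_snd (f := fun p s => M.lam p.1 j s) (fun p s => M.lam_nonneg _ _ _)
      hlam).ennreal_ofReal
    simpa only [ENNReal.ofReal_prod_of_nonneg fun i _ => M.lam_nonneg _ _ _] using h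

theorem measurable_nodeWeight_self (j : ι) : Measurable fun x => M.nodeWeight x j (x j) :=
  Measurable.comp (g := Function.uncurry fun x y => M.nodeWeight x j y)
    (f := fun x : ι → Config => (x, x j)) (M.measurable_nodeWeight j)
    (measurable_id.prodMk (measurable_pi_apply j))

theorem measurable_density : Measurable M.density :=
  Finset.measurable_prod _ fun j _ => M.measurable_nodeWeight_self j

theorem density_ne_top (x : ι → Config) : M.density x ≠ ∞ :=
  ENNReal.prod_ne_top fun _ _ => ENNReal.mul_ne_top ENNReal.ofReal_ne_top
    (ENNReal.prod_ne_top fun _ _ => ENNReal.ofReal_ne_top)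

/-- The intensity measure of node `j`, given the configurations `x` of the nodes. -/
noncomputable def intensityMeasure (x : ι → Config) (j : ι) : Measure ℝ :=
  M.base.withDensity fun u => ENNReal.ofReal (M.lam x j u)

theorem poissonLaw_intensityMeasure (x : ι → Config) (j : ι) {A : Set Config}
    (hA : MeasurableSet A) : poissonLaw (M.intensityMeasure x j) A =
      ∫⁻ y, A.indicator (M.nodeWeight x j) y ∂(poissonLaw M.base) := by
  rw [intensityMeasure, poissonLaw.apply_withDensity M.base (M.measurable_lam_right x j)
    (M.lam_nonneg x j) (by rw [lintegral_lam]; exact ENNReal.ofReal_ne_top) hA, base_univ,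
    lintegral_lam, ENNReal.toReal_ofReal M.T_nonneg, ENNReal.toReal_ofReal (M.total_nonneg x j)]
  rfl

variable [DecidableEq ι]

theorem lam_update {x : ι → Config} {i j : ι} (h : M.rank i ≤ M.rank j) (y : Config) :
    M.lam (Function.update x i y) j = M.lam x j :=
  M.lam_congr fun i' hi' => Function.update_of_ne (by rintro rfl; omega) _ _

theorem nodeWeight_update {x : ι → Config} {i j : ι} (h : M.rank i ≤ M.rank j) (y : Config) :
    M.nodeWeight (Function.update x i y) j = M.nodeWeight x j := by
  funext v
  simp only [nodeWeight, total, M.lam_update h]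

/-- If, rank by rank and downwards, the nodes of each rank are conditionally independent Poisson
processes given the nodes of higher rank, then `density` is the density of the joint law. -/
theorem map_eq_withDensity {Ω : Type*} [MeasurableSpace Ω] (P : Measure Ω)
    [IsProbabilityMeasure P] {X : Ω → ι → Config} (hX : Measurable X)
    (h : ∀ (r : ℕ) (A : ι → Set Config), (∀ j, MeasurableSet (A j)) →
      P {ω | ∀ j, r ≤ M.rank j → X ω j ∈ A j} =
        ∫⁻ ω in {ω | ∀ j, r < M.rank j → X ω j ∈ A j},
          ∏ j with M.rank j = r, poissonLaw (M.intensityMeasure (X ω) j) (A j) ∂P) :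
    P.map X = M.refLaw.withDensity M.density := by
  have hbox : ∀ (r : ℕ) (A : ι → Set Config), (∀ j, MeasurableSet (A j)) →
      MeasurableSet {x : ι → Config | ∀ j, r ≤ M.rank j → x j ∈ A j} := fun r A hA => by
    have : {x : ι → Config | ∀ j, r ≤ M.rank j → x j ∈ A j} =
        ⋂ j, ⋂ _ : r ≤ M.rank j, {x | x j ∈ A j} := by ext; simp
    rw [this]
    exact MeasurableSet.iInter fun j => MeasurableSet.iInter fun _ => measurable_pi_apply j (hA j)
  let D : ℕ → (ι → Config) → ℝ≥0∞ := fun r x =>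
    ∏ j with r ≤ M.rank j, M.nodeWeight x j (x j)
  have hD : ∀ r, Measurable (D r) := fun r =>
    Finset.measurable_prod _ fun j _ => M.measurable_nodeWeight_self j
  -- the projection that forgets the nodes of rank less than `r`
  let pr : ℕ → (ι → Config) → ι → Config := fun r x j => if r ≤ M.rank j then x j else ⟨∅⟩
  have hpr : ∀ r, Measurable (pr r) := fun r => measurable_pi_lambda _ fun j => by
    by_cases hj : r ≤ M.rank j
    · simpa [pr, hj] using measurable_pi_apply j
    · simp [pr, hj]
  -- `D r` is the density of the law of the nodes of rank at least `r`, by downward induction on `r`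
  have claim : ∀ n r : ℕ, r + n = Finset.univ.sup M.rank + 1 →
      ∀ A : ι → Set Config, (∀ j, MeasurableSet (A j)) →
      P {ω | ∀ j, r ≤ M.rank j → X ω j ∈ A j} =
        ∫⁻ x in {x | ∀ j, r ≤ M.rank j → x j ∈ A j}, D r x ∂M.refLaw := by
    intro n
    induction n with
    | zero =>
      intro r hr A hA
      have hlt : ∀ j, ¬ r ≤ M.rank j := fun j hj => by
        have := Finset.le_sup (f := M.rank) (Finset.mem_univ j)
        omega
      simp [D, hlt]
    | succ n ih =>
      intro r hr A hA
      have ih' := ih (r + 1) (by omega)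
      -- boxes determine the law of the projection to the nodes of rank at least `r + 1`
      have hmap : (P.map X).map (pr (r + 1)) =
          (M.refLaw.withDensity (D (r + 1))).map (pr (r + 1)) := by
        have : IsProbabilityMeasure (P.map X) := Measure.isProbabilityMeasure_map hX.aemeasurable
        have : IsProbabilityMeasure ((P.map X).map (pr (r + 1))) :=
          Measure.isProbabilityMeasure_map (hpr _).aemeasurable
        refine measure_ext_of_univ_pi fun B hB => ?_
        have hBm := MeasurableSet.univ_pi hB
        rw [Measure.map_apply (hpr _) hBm, Measure.map_apply (hpr _) hBm,
          Measure.map_apply hX (hpr _ hBm), withDensity_apply _ (hpr _ hBm)]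
        by_cases he : ∀ j, ¬ r + 1 ≤ M.rank j → (⟨∅⟩ : Config) ∈ B j
        · have : pr (r + 1) ⁻¹' Set.univ.pi B = {x | ∀ j, r + 1 ≤ M.rank j → x j ∈ B j} := by
            ext x
            simp only [pr, Set.mem_preimage, Set.mem_pi, Set.mem_univ, true_implies,
              Set.mem_ofPred_eq]
            refine forall_congr' fun j => ?_
            by_cases hj : r + 1 ≤ M.rank j
            · simp [hj]
            · simp [hj, he j hj]
          rw [this]
          exact ih' B hB
        · push Not at he
          obtain ⟨j, hj, hj'⟩ := he
          have : pr (r + 1) ⁻¹' Set.univ.pi B = ∅ := by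
            ext x
            simp only [Set.mem_preimage, Set.mem_pi, Set.mem_univ, true_implies,
              Set.mem_empty_iff_false, iff_false, not_forall]
            refine ⟨j, ?_⟩
            simp only [pr, if_neg (not_le.2 hj)]
            exact hj'
          rw [this]
          simp
      set box := {x : ι → Config | ∀ j, r + 1 ≤ M.rank j → x j ∈ A j} with hboxdef
      have hboxm : MeasurableSet box := hbox (r + 1) A hA
      let F : (ι → Config) → ℝ≥0∞ := box.indicator fun x =>
        ∏ j with M.rank j = r, ∫⁻ y, (A j).indicator (M.nodeWeight x j) y ∂(poissonLaw M.base)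
      have hgm : ∀ j, Measurable (Function.uncurry fun (x : ι → Config) (y : Config) =>
          (A j).indicator (M.nodeWeight x j) y) := fun j => by
        have := (M.measurable_nodeWeight j).indicator
          (measurable_snd (α := ι → Config) (hA j))
        convert this using 1
        ext ⟨x, y⟩
        by_cases hy : y ∈ A j <;> simp [Function.uncurry, hy]
      have hF : Measurable F := (Finset.measurable_prod _ fun j _ =>
        (hgm j).lintegral_prod_right').indicator hboxm
      -- the conditional law of the nodes of rank `r` is a function of the nodes of higher rank
      have hFpr : ∀ x, F (pr (r + 1) x) = F x := fun x => by
        have h1 : pr (r + 1) x ∈ box ↔ x ∈ box := by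
          refine forall_congr' fun j => ?_
          refine imp_congr_right fun hj => ?_
          simp only [pr, if_pos hj]
        have h2 : ∀ j, M.rank j = r → M.nodeWeight (pr (r + 1) x) j = M.nodeWeight x j := by
          intro j hj
          have : M.lam (pr (r + 1) x) j = M.lam x j := M.lam_congr fun i hi => by
            have : r + 1 ≤ M.rank i := by omega
            simp only [pr, if_pos this]
          funext v
          simp only [nodeWeight, total, this]
        by_cases hx : x ∈ box
        · simp only [F, Set.indicator_of_mem hx, Set.indicator_of_mem (h1.2 hx)]
          refine Finset.prod_congr rfl fun j hj => ?_
          rw [h2 j (Finset.mem_filter.1 hj).2]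
        · simp only [F, Set.indicator_of_notMem hx, Set.indicator_of_notMem fun h => hx (h1.1 h)]
      calc P {ω | ∀ j, r ≤ M.rank j → X ω j ∈ A j}
          = ∫⁻ ω in X ⁻¹' box, ∏ j with M.rank j = r,
              poissonLaw (M.intensityMeasure (X ω) j) (A j) ∂P := h r A hA
        _ = ∫⁻ ω, F (pr (r + 1) (X ω)) ∂P := by
            rw [← lintegral_indicator (hX hboxm)]
            refine lintegral_congr fun ω => ?_
            rw [hFpr]
            by_cases hω : X ω ∈ box
            · simp only [F]
              rw [Set.indicator_of_mem (show ω ∈ X ⁻¹' box from hω), Set.indicator_of_mem hω]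
              exact Finset.prod_congr rfl fun j _ =>
                M.poissonLaw_intensityMeasure (X ω) j (hA j)
            · simp only [F]
              rw [Set.indicator_of_notMem (show ω ∉ X ⁻¹' box from hω), Set.indicator_of_notMem hω]
        _ = ∫⁻ x, F x ∂((P.map X).map (pr (r + 1))) := by
            rw [lintegral_map hF (hpr _),
              lintegral_map (f := fun x => F (pr (r + 1) x)) (hF.comp (hpr _)) hX]
        _ = ∫⁻ x, D (r + 1) x * F x ∂M.refLaw := by
            rw [hmap, lintegral_map hF (hpr _), lintegral_withDensity_eq_lintegral_mul _ (hD _)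
              (g := fun x => F (pr (r + 1) x)) (hF.comp (hpr _))]
            simp only [Pi.mul_apply, hFpr]
        _ = ∫⁻ x, box.indicator (D (r + 1)) x * ∏ j with M.rank j = r,
              ∫⁻ y, (A j).indicator (M.nodeWeight x j) y ∂(poissonLaw M.base) ∂M.refLaw := by
            refine lintegral_congr fun x => ?_
            by_cases hx : x ∈ box
            · simp only [F, Set.indicator_of_mem hx]
            · simp only [F, Set.indicator_of_notMem hx, zero_mul, mul_zero]
        _ = ∫⁻ x, box.indicator (D (r + 1)) x * ∏ j with M.rank j = r,
              (A j).indicator (M.nodeWeight x j) (x j) ∂M.refLaw := by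
            refine (lintegral_pi_mul_prod_coord (fun _ : ι => poissonLaw M.base) _
              ((hD _).indicator hboxm) hgm ?_ ?_).symm
            · intro i hi x y
              have hi' := (Finset.mem_filter.1 hi).2
              have hne : ∀ j, r + 1 ≤ M.rank j → j ≠ i := by
                rintro j hj rfl
                omega
              have h1 : Function.update x i y ∈ box ↔ x ∈ box := by
                refine forall_congr' fun j => imp_congr_right fun hj => ?_
                rw [Function.update_of_ne (hne j hj)]
              have h2 : D (r + 1) (Function.update x i y) = D (r + 1) x := by
                refine Finset.prod_congr rfl fun j hj => ?_
                have hj' := (Finset.mem_filter.1 hj).2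
                rw [Function.update_of_ne (hne j hj'), M.nodeWeight_update (by omega)]
              by_cases hx : x ∈ box
              · rw [Set.indicator_of_mem hx, Set.indicator_of_mem (h1.2 hx), h2]
              · rw [Set.indicator_of_notMem hx, Set.indicator_of_notMem fun h => hx (h1.1 h)]
            · intro i hi j hj x y v
              have hi' := (Finset.mem_filter.1 hi).2
              have hj' := (Finset.mem_filter.1 hj).2
              rw [M.nodeWeight_update (by omega)]
        _ = ∫⁻ x in {x | ∀ j, r ≤ M.rank j → x j ∈ A j}, D r x ∂M.refLaw := by
            rw [← lintegral_indicator (hbox r A hA)]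
            refine lintegral_congr fun x => ?_
            have hsplit : D r x = D (r + 1) x * ∏ j with M.rank j = r, M.nodeWeight x j (x j) := by
              simp only [D]
              rw [← Finset.prod_union]
              · refine Finset.prod_congr ?_ fun _ _ => rfl
                ext j
                simp
                omega
              · rw [Finset.disjoint_filter]
                intro j _ h1 h2
                omega
            by_cases hx : x ∈ {x : ι → Config | ∀ j, r ≤ M.rank j → x j ∈ A j}
            · have hx' : x ∈ box := fun j hj => hx j (by omega)
              rw [Set.indicator_of_mem hx, Set.indicator_of_mem hx', hsplit]
              congr 1
              refine Finset.prod_congr rfl fun j hj => ?_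
              rw [Set.indicator_of_mem (hx j (Finset.mem_filter.1 hj).2.ge)]
            · rw [Set.indicator_of_notMem hx]
              by_cases hx' : x ∈ box
              · simp only [Set.mem_ofPred_eq, not_forall] at hx
                obtain ⟨j, hj, hjA⟩ := hx
                have hjr : M.rank j = r := by
                  by_contra hne
                  exact hjA (hx' j (by omega))
                refine mul_eq_zero_of_right _ (Finset.prod_eq_zero (i := j) (by simp [hjr]) ?_)
                rw [Set.indicator_of_notMem hjA]
              · rw [Set.indicator_of_notMem hx', zero_mul]
  have hfinal := claim _ 0 (Nat.zero_add _)
  have : IsProbabilityMeasure (P.map X) := Measure.isProbabilityMeasure_map hX.aemeasurable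
  refine measure_ext_of_univ_pi fun B hB => ?_
  have hBm := MeasurableSet.univ_pi hB
  rw [Measure.map_apply hX hBm, withDensity_apply _ hBm]
  have h1 := hfinal B hB
  simp only [Nat.zero_le, true_implies, D, Finset.filter_true] at h1
  convert h1 using 1
  · congr 1; ext; simp
  · congr 2; ext; simp

end Cascade

/-! ### Conditional probabilities given what happens outside windows -/

/-- The realization that agrees with `w` in the windows `B j` and with `z` outside them. -/
noncomputable def mixAll {ι : Type*} (B : ι → Set ℝ) (z w : ι → Config) : ι → Config :=
  fun j => Config.mix (B j) (z j) (w j)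

/-- What remains of the realization `z` when the events in the windows `B j` are hidden. -/
noncomputable def outsideAll {ι : Type*} (B : ι → Set ℝ) (z : ι → Config) : ι → Config :=
  fun j => (z j).outside (B j)

theorem outsideAll_mixAll {ι : Type*} (B : ι → Set ℝ) (z w : ι → Config) :
    outsideAll B (mixAll B z w) = outsideAll B z :=
  funext fun _ => Config.outside_mix _ _ _

theorem mixAll_outsideAll {ι : Type*} (B : ι → Set ℝ) (z w : ι → Config) :
    mixAll B (outsideAll B z) w = mixAll B z w :=
  funext fun _ => Config.mix_outside _ _ _

theorem measurable_mixAll {ι : Type*} {B : ι → Set ℝ} (hB : ∀ j, MeasurableSet (B j)) :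
    Measurable fun p : (ι → Config) × (ι → Config) => mixAll B p.1 p.2 :=
  measurable_pi_lambda _ fun j =>
    Measurable.comp (g := fun p : Config × Config => Config.mix (B j) p.1 p.2)
      (f := fun p : (ι → Config) × (ι → Config) => (p.1 j, p.2 j)) (Config.measurable_mix (hB j))
      (((measurable_pi_apply j).comp measurable_fst).prodMk
        ((measurable_pi_apply j).comp measurable_snd))

theorem measurable_outsideAll {ι : Type*} {B : ι → Set ℝ} (hB : ∀ j, MeasurableSet (B j)) :
    Measurable (outsideAll B) :=
  measurable_pi_lambda _ fun j =>
    (Config.measurable_outside (hB j)).comp (measurable_pi_apply j)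

namespace Cascade

variable {ι : Type*} [Fintype ι] (M : Cascade ι)

/-- The reference law of the events in the windows `B j`. -/
noncomputable def windowLaw (B : ι → Set ℝ) : Measure (ι → Config) :=
  Measure.pi fun j => poissonLaw (M.base.restrict (B j))

instance (B : ι → Set ℝ) : IsProbabilityMeasure (M.windowLaw B) := by
  unfold windowLaw; infer_instance

theorem map_mixAll {B : ι → Set ℝ} (hB : ∀ j, MeasurableSet (B j)) :
    (M.refLaw.prod (M.windowLaw B)).map (fun p => mixAll B p.1 p.2) = M.refLaw := by
  have h := measurePreserving_arrowProdEquivProdArrow Config Config ι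
    (fun _ => poissonLaw M.base) (fun j => poissonLaw (M.base.restrict (B j)))
  rw [refLaw, windowLaw, ← h.map_eq, Measure.map_map (measurable_mixAll hB)
    (MeasurableEquiv.measurable _)]
  have hpi := Measure.pi_map_pi
    (μ := fun j => (poissonLaw M.base).prod (poissonLaw (M.base.restrict (B j))))
    (f := fun j (p : Config × Config) => Config.mix (B j) p.1 p.2)
    (hμ := fun j => by rw [poissonLaw.map_mix M.base (hB j)]; infer_instance)
    fun j => (Config.measurable_mix (hB j)).aemeasurable
  simp_rw [poissonLaw.map_mix M.base (hB _)] at hpi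
  exact hpi

/-- The average of `F` over the events in the windows `B j`, redrawn from the reference law. -/
noncomputable def resample (B : ι → Set ℝ) (F : (ι → Config) → ℝ≥0∞) (z : ι → Config) : ℝ≥0∞ :=
  ∫⁻ w, F (mixAll B z w) ∂(M.windowLaw B)

theorem measurable_resample {B : ι → Set ℝ} (hB : ∀ j, MeasurableSet (B j))
    {F : (ι → Config) → ℝ≥0∞} (hF : Measurable F) : Measurable (M.resample B F) :=
  (hF.comp (measurable_mixAll hB)).lintegral_prod_right'

theorem lintegral_resample {B : ι → Set ℝ} (hB : ∀ j, MeasurableSet (B j))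
    {F : (ι → Config) → ℝ≥0∞} (hF : Measurable F) :
    ∫⁻ z, M.resample B F z ∂M.refLaw = ∫⁻ z, F z ∂M.refLaw := by
  conv_rhs => rw [← M.map_mixAll hB, lintegral_map hF (measurable_mixAll hB)]
  rw [lintegral_prod (fun p => F (mixAll B p.1 p.2)) (hF.comp (measurable_mixAll hB)).aemeasurable]
  rfl

theorem resample_outsideAll (B : ι → Set ℝ) (F : (ι → Config) → ℝ≥0∞) (z : ι → Config) :
    M.resample B F (outsideAll B z) = M.resample B F z := by
  simp only [resample, mixAll_outsideAll]

theorem resample_mixAll (B : ι → Set ℝ) (F : (ι → Config) → ℝ≥0∞) (z w : ι → Config) :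
    M.resample B F (mixAll B z w) = M.resample B F z := by
  rw [← resample_outsideAll, outsideAll_mixAll, resample_outsideAll]

/-- A factor that does not see the windows may be taken out of a resampling average. -/
theorem lintegral_mul_resample {B : ι → Set ℝ} (hB : ∀ j, MeasurableSet (B j))
    {F G : (ι → Config) → ℝ≥0∞} (hF : Measurable F) (hG : Measurable G)
    (hGB : ∀ z w, G (mixAll B z w) = G z) :
    ∫⁻ z, G z * F z ∂M.refLaw = ∫⁻ z, G z * M.resample B F z ∂M.refLaw := by
  rw [← M.lintegral_resample (F := fun z => G z * F z) hB (hG.mul hF)]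
  refine lintegral_congr fun z => ?_
  simp only [resample, hGB]
  exact lintegral_const_mul _
    (hF.comp ((measurable_mixAll hB).comp measurable_prodMk_left))

/-- The conditional probability of the event `E` given what happens outside the windows. Where
the denominator vanishes, so does the numerator, and `0 / 0 = 0` applies. -/
noncomputable def condProb (B : ι → Set ℝ) (E : Set (ι → Config)) (z : ι → Config) : ℝ≥0∞ :=
  M.resample B (E.indicator M.density) z / M.resample B M.density z

theorem resample_indicator_le (B : ι → Set ℝ) (E : Set (ι → Config)) (z : ι → Config) :
    M.resample B (E.indicator M.density) z ≤ M.resample B M.density z :=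
  lintegral_mono fun _ => Set.indicator_le_self _ _ _

theorem condProb_le_one (B : ι → Set ℝ) (E : Set (ι → Config)) (z : ι → Config) :
    M.condProb B E z ≤ 1 :=
  ENNReal.div_le_of_le_mul (by rw [one_mul]; exact M.resample_indicator_le B E z)

/-- Bayes' formula: `condProb` is a version of the conditional probability. -/
theorem condProb_ae_eq {Ω : Type*} [MeasurableSpace Ω] (P : Measure Ω)
    [IsProbabilityMeasure P] {X : Ω → ι → Config} (hX : Measurable X)
    (hlaw : P.map X = M.refLaw.withDensity M.density)
    {B : ι → Set ℝ} (hB : ∀ j, MeasurableSet (B j)) {E : Set (ι → Config)} (hE : MeasurableSet E) :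
    (fun ω => (M.condProb B E (X ω)).toReal) =ᵐ[P]
      P⟦X ⁻¹' E | MeasurableSpace.comap (fun ω => outsideAll B (X ω)) inferInstance⟧ := by
  have hDE : Measurable (E.indicator M.density) := M.measurable_density.indicator hE
  have hq : Measurable (M.condProb B E) :=
    (M.measurable_resample hB hDE).div (M.measurable_resample hB M.measurable_density)
  have hout := measurable_outsideAll hB
  have hXout : Measurable fun ω => outsideAll B (X ω) := hout.comp hX
  -- the denominator of `condProb` is finite almost everywhere; where it vanishes, so does the
  -- numerator
  have htop : ∀ᵐ z ∂M.refLaw, M.resample B M.density z < ∞ := by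
    refine ae_lt_top (M.measurable_resample hB M.measurable_density) ?_
    rw [M.lintegral_resample hB M.measurable_density, ← setLIntegral_univ,
      ← withDensity_apply _ MeasurableSet.univ, ← hlaw, Measure.map_apply hX MeasurableSet.univ]
    exact measure_ne_top _ _
  have key : ∀ G' : Set (ι → Config), MeasurableSet G' →
      ∫⁻ ω in (fun ω => outsideAll B (X ω)) ⁻¹' G', M.condProb B E (X ω) ∂P =
        P ((fun ω => outsideAll B (X ω)) ⁻¹' G' ∩ X ⁻¹' E) := by
    intro G' hG'
    set H : Set (ι → Config) := outsideAll B ⁻¹' G' with hHdef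
    have hH : MeasurableSet H := hout hG'
    have hHB : ∀ z w, mixAll B z w ∈ H ↔ z ∈ H := fun z w => by
      simp only [hHdef, Set.mem_preimage, outsideAll_mixAll]
    calc ∫⁻ ω in (fun ω => outsideAll B (X ω)) ⁻¹' G', M.condProb B E (X ω) ∂P
        = ∫⁻ z in H, M.condProb B E z ∂(P.map X) := (setLIntegral_map hH hq hX).symm
      _ = ∫⁻ z, H.indicator (M.condProb B E) z * M.density z ∂M.refLaw := by
          rw [hlaw, ← lintegral_indicator hH, lintegral_withDensity_eq_lintegral_mul _
            M.measurable_density (hq.indicator hH)]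
          simp only [Pi.mul_apply, mul_comm]
      _ = ∫⁻ z, H.indicator (M.condProb B E) z * M.resample B M.density z ∂M.refLaw := by
          refine M.lintegral_mul_resample hB M.measurable_density (hq.indicator hH) fun z w => ?_
          by_cases hz : z ∈ H
          · rw [Set.indicator_of_mem hz, Set.indicator_of_mem ((hHB z w).2 hz)]
            simp only [condProb, resample_mixAll]
          · rw [Set.indicator_of_notMem hz, Set.indicator_of_notMem fun h => hz ((hHB z w).1 h)]
      _ = ∫⁻ z, H.indicator 1 z * M.resample B (E.indicator M.density) z ∂M.refLaw := by
          refine lintegral_congr_ae (htop.mono fun z hz => ?_)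
          by_cases hzH : z ∈ H
          · simp only [Set.indicator_of_mem hzH, Pi.one_apply, one_mul, condProb]
            rw [mul_comm]
            exact ENNReal.mul_div_cancel'
              (fun h0 => le_antisymm (h0 ▸ M.resample_indicator_le B E z) zero_le)
              (fun h => absurd h hz.ne)
          · simp [Set.indicator_of_notMem hzH]
      _ = ∫⁻ z, H.indicator 1 z * E.indicator M.density z ∂M.refLaw := by
          refine (M.lintegral_mul_resample hB hDE (measurable_one.indicator hH) fun z w => ?_).symm
          by_cases hz : z ∈ H
          · rw [Set.indicator_of_mem hz, Set.indicator_of_mem ((hHB z w).2 hz)]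
            rfl
          · rw [Set.indicator_of_notMem hz, Set.indicator_of_notMem fun h => hz ((hHB z w).1 h)]
      _ = P.map X (H ∩ E) := by
          rw [hlaw, withDensity_apply _ (hH.inter hE), ← lintegral_indicator (hH.inter hE)]
          refine lintegral_congr fun z => ?_
          by_cases hzH : z ∈ H
          · by_cases hzE : z ∈ E <;> simp [hzH, hzE]
          · simp [hzH]
      _ = _ := by
          rw [Measure.map_apply hX (hH.inter hE)]
          rfl
  refine ae_eq_condExp_of_forall_setIntegral_eq hXout.comap_le ?_ ?_ ?_ ?_
  · exact (integrable_const 1).indicator (hX hE)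
  · intro s _ _
    refine Integrable.integrableOn (Integrable.of_bound
      (hq.comp hX).ennreal_toReal.aestronglyMeasurable 1 (Eventually.of_forall fun ω => ?_))
    rw [Real.norm_of_nonneg ENNReal.toReal_nonneg]
    exact ENNReal.toReal_le_of_le_ofReal zero_le_one (by simpa using M.condProb_le_one B E _)
  · rintro _ ⟨G', hG', rfl⟩ _
    rw [integral_toReal (f := fun ω => M.condProb B E (X ω)) (hq.comp hX).aemeasurable
      (Eventually.of_forall fun ω => (M.condProb_le_one B E _).trans_lt ENNReal.one_lt_top),
      key G' hG', integral_indicator (hX hE)]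
    simp [Measure.real, Measure.restrict_apply (hX hE), Set.inter_comm]
  · refine Measurable.aestronglyMeasurable ?_
    have : (fun ω => (M.condProb B E (X ω)).toReal) =
        fun ω => (M.condProb B E (outsideAll B (X ω))).toReal := by
      funext ω
      simp only [condProb, resample_outsideAll]
    rw [this]
    exact hq.ennreal_toReal.comp (comap_measurable _)

end Cascade

/-! ### Exponential moments of the clusters in a short window -/

namespace poissonLaw

variable (ν : Measure ℝ)

theorem setLIntegral_card_eq_zero {G : Config → ℝ≥0∞} (hG : Measurable G) :
    ∫⁻ y in {y | y.events.card = 0}, G y ∂(poissonLaw ν) =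
      ENNReal.ofReal (Real.exp (-(ν Set.univ).toReal)) * G ⟨∅⟩ := by
  have hm : MeasurableSet {y : Config | y.events.card = 0} :=
    Config.measurable_card (measurableSet_singleton 0)
  rw [← lintegral_indicator hm, lintegral_eq ν (hG.indicator hm), tsum_eq_single 0]
  · have h0 : ∀ x : Fin 0 → ℝ, Config.ofVec x = ⟨∅⟩ := fun x => by ext; simp
    simp [weight, h0]
  · intro n hn
    have hne : ∀ x : Fin n → ℝ, Config.ofVec x ∉ {y : Config | y.events.card = 0} := by
      intro x hx
      have hx' : (Config.ofVec x).events = ∅ := Finset.card_eq_zero.1 hx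
      have : x ⟨0, Nat.pos_of_ne_zero hn⟩ ∈ (Config.ofVec x).events := Config.mem_ofVec.2 ⟨_, rfl⟩
      rw [hx'] at this
      exact absurd this (Finset.notMem_empty _)
    simp only [Set.indicator_of_notMem (hne _), lintegral_zero, mul_zero]

theorem setLIntegral_card_eq_one [IsFiniteMeasure ν] [NullSingletonClass ν] {G : Config → ℝ≥0∞}
    (hG : Measurable G) :
    ∫⁻ y in {y | y.events.card = 1}, G y ∂(poissonLaw ν) =
      ENNReal.ofReal (Real.exp (-(ν Set.univ).toReal)) * ∫⁻ u, G ⟨{u}⟩ ∂ν := by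
  have hm : MeasurableSet {y : Config | y.events.card = 1} :=
    Config.measurable_card (measurableSet_singleton 1)
  rw [← lintegral_indicator hm, lintegral_eq ν (hG.indicator hm), tsum_eq_single 1]
  · have h1 : ∀ x : Fin 1 → ℝ, Config.ofVec x = ⟨{x 0}⟩ := fun x => by
      ext s
      simp [eq_comm]
    have h2 := (measurePreserving_funUnique ν (Fin 1)).lintegral_comp_emb
      (MeasurableEquiv.measurableEmbedding _) fun u => G ⟨{u}⟩
    rw [← h2]
    simp only [weight, h1, Set.mem_ofPred_eq, Finset.card_singleton, Set.indicator_of_mem,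
      Nat.factorial_one, Nat.cast_one, div_one]
    rfl
  · intro n hn
    refine mul_eq_zero_of_right _ ?_
    rw [← lintegral_zero (μ := Measure.pi fun _ : Fin n => ν)]
    refine lintegral_congr_ae ((ae_pi_injective ν).mono fun x hx => ?_)
    refine Set.indicator_of_notMem (fun hc => hn ?_) _
    simpa [Config.ofVec, Finset.card_image_of_injective _ hx] using hc

end poissonLaw

namespace Cascade

variable {ι : Type*} [Fintype ι] (M : Cascade ι)

/-- The total number of events of a realization. -/
def totalCard (w : ι → Config) : ℕ := ∑ j, (w j).events.card

theorem measurable_totalCard : Measurable (totalCard : (ι → Config) → ℕ) :=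
  Finset.measurable_sum _ fun j _ => Config.measurable_card.comp (measurable_pi_apply j)

/-- The product of `a * M.lam w j u` over the events `u` of the nodes `j` in `s`: the density of the
cascade without its exponential factors, in which every event counts with the additional weight
`a`. -/
noncomputable def clusterWeight (s : Finset ι) (a : ℝ) (w : ι → Config) : ℝ≥0∞ :=
  ∏ j ∈ s, ∏ u ∈ (w j).events, ENNReal.ofReal (a * M.lam w j u)

theorem measurable_prod_mul_lam {a : ℝ} (ha : 0 ≤ a) (j : ι) :
    Measurable (Function.uncurry fun (w : ι → Config) (y : Config) =>
      ∏ u ∈ y.events, ENNReal.ofReal (a * M.lam w j u)) := by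
  have hlam : Measurable (Function.uncurry
      fun (p : (ι → Config) × Config) (s : ℝ) => a * M.lam p.1 j s) :=
    Measurable.const_mul (Measurable.comp
      (g := Function.uncurry fun (x : ι → Config) (u : ℝ) => M.lam x j u)
      (f := fun q : ((ι → Config) × Config) × ℝ => (q.1.1, q.2)) (M.measurable_lam j)
      ((measurable_fst.comp measurable_fst).prodMk measurable_snd)) a
  have h := (Config.measurable_prod_events (z := fun p : (ι → Config) × Config => p.2)
    measurable_snd (f := fun p s => a * M.lam p.1 j s)
    (fun p s => mul_nonneg ha (M.lam_nonneg _ _ _)) hlam).ennreal_ofReal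
  simp only [ENNReal.ofReal_prod_of_nonneg fun i _ => mul_nonneg ha (M.lam_nonneg _ _ _)] at h
  exact h

theorem measurable_clusterWeight (s : Finset ι) {a : ℝ} (ha : 0 ≤ a) :
    Measurable (M.clusterWeight s a) :=
  Finset.measurable_prod _ fun j _ => Measurable.comp
    (g := Function.uncurry fun (w : ι → Config) (y : Config) =>
      ∏ u ∈ y.events, ENNReal.ofReal (a * M.lam w j u))
    (f := fun w : ι → Config => (w, w j)) (M.measurable_prod_mul_lam ha j)
    (measurable_id.prodMk (measurable_pi_apply j))

theorem clusterWeight_mul (s : Finset ι) {a b : ℝ} (hb : 0 ≤ b) (w : ι → Config) :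
    M.clusterWeight s (b * a) w =
      ENNReal.ofReal b ^ (∑ j ∈ s, (w j).events.card) * M.clusterWeight s a w := by
  simp only [clusterWeight, mul_assoc, ENNReal.ofReal_mul hb, Finset.prod_mul_distrib,
    Finset.prod_const, Finset.prod_pow_eq_pow_sum]

theorem ae_mem_window {B : ι → Set ℝ} (hB : ∀ j, MeasurableSet (B j)) :
    ∀ᵐ w ∂(M.windowLaw B), ∀ j, ∀ s ∈ (w j).events, s ∈ B j := by
  refine ae_all_iff.2 fun j => ?_
  have h := poissonLaw.ae_forall_notMem (M.base.restrict (B j)) (hB j).compl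
    (by rw [Measure.restrict_apply (hB j).compl]; simp)
  have h' : ∀ᵐ y ∂(poissonLaw (M.base.restrict (B j))), ∀ s ∈ y.events, s ∈ B j :=
    h.mono fun y hy s hs => by simpa using hy s hs
  exact (Measure.tendsto_eval_ae_ae (μ := fun j => poissonLaw (M.base.restrict (B j)))
    (i := j)).eventually h'

/-- In a short window `[t, t + d]` the total intensity of a node is small: at most `C` times the
length of the window from the constant part, and at most `e` from each event of a node of higher
rank. -/
theorem setIntegral_lam_le {C t d e : ℝ} (hd : 0 ≤ d) (hC : ∀ j, M.rate j ≤ C)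
    (he : ∀ i j, ∀ v ∈ Set.Icc t (t + d), ∫ u in Set.Icc t (t + d), M.ker i j (u - v) ≤ e)
    {s : Finset ι} {j : ι} (hs : ∀ i, M.rank j < M.rank i → i ∈ s)
    {w : ι → Config} (hw : ∀ i, ∀ v ∈ (w i).events, v ∈ Set.Icc t (t + d)) :
    ∫ u in Set.Icc t (t + d), M.lam w j u ≤ C * d + e * ∑ i ∈ s, (w i).events.card := by
  classical
  have hint : ∀ i v, Integrable (fun u => M.ker i j (u - v))
      (volume.restrict (Set.Icc t (t + d))) := fun i v =>
    ((M.ker_integrable i j).comp_sub_right v).restrict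
  unfold lam
  rw [integral_add (integrable_const _) (integrable_finsetSum _ fun i _ =>
    integrable_finsetSum _ fun v _ => hint i v), integral_finsetSum _ fun i _ =>
    integrable_finsetSum _ fun v _ => hint i v]
  refine add_le_add ?_ ?_
  · simp only [integral_const, smul_eq_mul]
    rw [Measure.real, Measure.restrict_apply_univ, Real.volume_Icc, add_sub_cancel_left,
      ENNReal.toReal_ofReal hd, mul_comm]
    exact mul_le_mul_of_nonneg_right (hC j) hd
  · push_cast
    rw [Finset.mul_sum, ← Finset.sum_subset (Finset.subset_univ s)]
    · refine Finset.sum_le_sum fun i _ => ?_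
      rw [integral_finsetSum _ fun v _ => hint i v, mul_comm, ← nsmul_eq_mul]
      exact Finset.sum_le_card_nsmul _ _ _ fun v hv => he i j v (hw i v hv)
    · intro i _ hi
      have : M.rank i ≤ M.rank j := not_lt.1 fun h => hi (hs i h)
      simp [M.ker_eq_zero i j this]

/-- The generating functional of a node in a short window, given the nodes of higher rank. -/
theorem lintegral_prod_mul_lam_le {B : Set ℝ} {C t d e a : ℝ} (hd : 0 ≤ d)
    (hBI : B ⊆ Set.Icc t (t + d)) (hC0 : 0 ≤ C) (hC : ∀ j, M.rate j ≤ C) (he0 : 0 ≤ e)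
    (he : ∀ i j, ∀ v ∈ Set.Icc t (t + d), ∫ u in Set.Icc t (t + d), M.ker i j (u - v) ≤ e)
    (ha : 0 ≤ a) {s : Finset ι} {j : ι} (hsj : ∀ i, M.rank j < M.rank i → i ∈ s)
    {w : ι → Config} (hw' : ∀ i, ∀ v ∈ (w i).events, v ∈ Set.Icc t (t + d)) :
    ∫⁻ y, ∏ u ∈ y.events, ENNReal.ofReal (a * M.lam w j u)
      ∂(poissonLaw (M.base.restrict B)) ≤
    ENNReal.ofReal (Real.exp (C * d * a)) *
      ENNReal.ofReal (Real.exp (a * e)) ^ (∑ i ∈ s, (w i).events.card) := by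
  have hIint : Integrable (fun u => a * M.lam w j u)
      (volume.restrict (Set.Icc t (t + d))) := by
    refine Integrable.const_mul ?_ a
    unfold lam
    exact (integrable_const _).add (integrable_finsetSum _ fun i _ => integrable_finsetSum _
      fun v _ => ((M.ker_integrable i j).comp_sub_right v).restrict)
  have hle : ∫⁻ u, ENNReal.ofReal (a * M.lam w j u) ∂(M.base.restrict B) ≤
      ENNReal.ofReal (a * (C * d + e * ∑ i ∈ s, (w i).events.card)) := by
    calc ∫⁻ u, ENNReal.ofReal (a * M.lam w j u) ∂(M.base.restrict B)
        ≤ ∫⁻ u, ENNReal.ofReal (a * M.lam w j u) ∂(volume.restrict (Set.Icc t (t + d))) := by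
          refine lintegral_mono' ?_ le_rfl
          exact (Measure.restrict_mono hBI le_rfl).trans
            (Measure.restrict_mono_measure Measure.restrict_le_self _)
      _ = ENNReal.ofReal (∫ u in Set.Icc t (t + d), a * M.lam w j u) :=
          (ofReal_integral_eq_lintegral_ofReal hIint (Eventually.of_forall fun u =>
            mul_nonneg ha (M.lam_nonneg _ _ _))).symm
      _ ≤ _ := by
          refine ENNReal.ofReal_le_ofReal ?_
          rw [integral_const_mul]
          exact mul_le_mul_of_nonneg_left (M.setIntegral_lam_le hd hC he hsj hw') ha
  rw [poissonLaw.lintegral_prod_events _ ((M.measurable_lam_right w j).const_mul a)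
    (fun u => mul_nonneg ha (M.lam_nonneg _ _ _)) (ne_top_of_le_ne_top ENNReal.ofReal_ne_top hle),
    ← ENNReal.ofReal_pow (Real.exp_nonneg _), ← ENNReal.ofReal_mul (Real.exp_nonneg _),
    ← ENNReal.ofReal_mul (Real.exp_nonneg _), ← Real.exp_nat_mul, ← Real.exp_add,
    ← Real.exp_add]
  refine ENNReal.ofReal_le_ofReal (Real.exp_le_exp.2 ?_)
  have h2 := ENNReal.toReal_mono ENNReal.ofReal_ne_top hle
  rw [ENNReal.toReal_ofReal (by positivity)] at h2
  have h3 : 0 ≤ ((M.base.restrict B) Set.univ).toReal := ENNReal.toReal_nonneg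
  push_cast at h2 ⊢
  nlinarith

/-- The exponential moment bound for cascades in a short window. The nodes are integrated out in
the order of their ranks: the probability generating functional of a Poisson process turns the
influence of a node on the integrated one into a slightly larger weight `a * exp (a * e)` of its
events, and the smallness of `e` keeps these weights comparable with `a`. -/
theorem lintegral_clusterWeight_le [DecidableEq ι] {B : ι → Set ℝ}
    (hB : ∀ j, MeasurableSet (B j)) {C t d e : ℝ} (hd : 0 ≤ d)
    (hBI : ∀ j, B j ⊆ Set.Icc t (t + d)) (hC0 : 0 ≤ C) (hC : ∀ j, M.rate j ≤ C) (he0 : 0 ≤ e)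
    (he : ∀ i j, ∀ v ∈ Set.Icc t (t + d), ∫ u in Set.Icc t (t + d), M.ker i j (u - v) ≤ e)
    (s : Finset ι) (hs : ∀ j ∈ s, ∀ i, M.rank j < M.rank i → i ∈ s) {a : ℝ} (ha : 0 ≤ a)
    (hae : a * Real.exp s.card * e ≤ 1) :
    ∫⁻ w, M.clusterWeight s a w ∂(M.windowLaw B) ≤
      ENNReal.ofReal (Real.exp (C * d * a * (s.card * Real.exp s.card))) := by
  induction s using Finset.induction_on_min_value M.rank generalizing a with
  | empty => simp [clusterWeight]
  | insert j s hjs hmin ih =>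
    rw [Finset.card_insert_of_notMem hjs] at hae ⊢
    push_cast at hae ⊢
    have hs' : ∀ j' ∈ s, ∀ i, M.rank j' < M.rank i → i ∈ s := by
      intro j' hj' i hi
      refine Finset.mem_of_mem_insert_of_ne (hs j' (Finset.mem_insert_of_mem hj') i hi) ?_
      rintro rfl
      exact absurd (hmin j' hj') (by omega)
    have hsj : ∀ i, M.rank j < M.rank i → i ∈ s := by
      intro i hi
      refine Finset.mem_of_mem_insert_of_ne (hs j (Finset.mem_insert_self _ _) i hi) ?_
      rintro rfl
      omega
    have hexp1 : 1 ≤ Real.exp s.card := Real.one_le_exp (Nat.cast_nonneg _)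
    have hsplit : Real.exp (s.card + 1) = Real.exp s.card * Real.exp 1 := Real.exp_add _ _
    have hae1 : a * e ≤ 1 := by
      have h1 : 1 ≤ Real.exp (s.card + 1 : ℝ) := Real.one_le_exp (by positivity)
      calc a * e = a * 1 * e := by ring
        _ ≤ a * Real.exp (s.card + 1) * e := by gcongr
        _ ≤ 1 := hae
    set a' := Real.exp (a * e) * a with ha'def
    have ha' : 0 ≤ a' := by positivity
    have ha'le : a' ≤ Real.exp 1 * a := by
      rw [ha'def]; gcongr
    have hstep := ih hs' (a := a') ha' (by
      calc a' * Real.exp s.card * e ≤ (Real.exp 1 * a) * Real.exp s.card * e := by gcongr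
        _ = a * Real.exp (s.card + 1) * e := by rw [hsplit]; ring
        _ ≤ 1 := hae)
    have hnode : ∀ᵐ w ∂(M.windowLaw B),
        ∫⁻ y, ∏ u ∈ y.events, ENNReal.ofReal (a * M.lam w j u)
          ∂(poissonLaw (M.base.restrict (B j))) ≤
        ENNReal.ofReal (Real.exp (C * d * a)) *
          ENNReal.ofReal (Real.exp (a * e)) ^ (∑ i ∈ s, (w i).events.card) := by
      filter_upwards [M.ae_mem_window hB] with w hw
      exact M.lintegral_prod_mul_lam_le hd (hBI j) hC0 hC he0 he ha hsj
        fun i v hv => hBI i (hw i v hv)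
    calc ∫⁻ w, M.clusterWeight (insert j s) a w ∂(M.windowLaw B)
        = ∫⁻ w, M.clusterWeight s a w * ∏ u ∈ (w j).events, ENNReal.ofReal (a * M.lam w j u)
            ∂(M.windowLaw B) := by
          refine lintegral_congr fun w => ?_
          rw [clusterWeight, Finset.prod_insert hjs, mul_comm]
          rfl
      _ = ∫⁻ w, M.clusterWeight s a w * ∫⁻ y, ∏ u ∈ y.events, ENNReal.ofReal (a * M.lam w j u)
            ∂(poissonLaw (M.base.restrict (B j))) ∂(M.windowLaw B) := by
          refine lintegral_pi_mul_coord (fun j => poissonLaw (M.base.restrict (B j))) j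
            (G := M.clusterWeight s a)
            (g := fun w y => ∏ u ∈ y.events, ENNReal.ofReal (a * M.lam w j u))
            (M.measurable_clusterWeight s ha) (M.measurable_prod_mul_lam ha j) ?_ ?_
          · intro w y
            refine Finset.prod_congr rfl fun i hi => ?_
            rw [M.lam_update (hmin i hi), Function.update_of_ne]
            rintro rfl
            exact hjs hi
          · intro w y v
            rw [M.lam_update le_rfl]
      _ ≤ ∫⁻ w, ENNReal.ofReal (Real.exp (C * d * a)) * M.clusterWeight s a' w
            ∂(M.windowLaw B) := by
          refine lintegral_mono_ae (hnode.mono fun w hw => ?_)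
          rw [ha'def, M.clusterWeight_mul s (Real.exp_nonneg _), ← mul_assoc,
            mul_comm (M.clusterWeight s a w)]
          gcongr
      _ ≤ ENNReal.ofReal (Real.exp (C * d * a)) *
            ENNReal.ofReal (Real.exp (C * d * a' * (s.card * Real.exp s.card))) := by
          rw [lintegral_const_mul _ (M.measurable_clusterWeight s ha')]
          gcongr
      _ ≤ _ := by
          rw [← ENNReal.ofReal_mul (Real.exp_nonneg _), ← Real.exp_add]
          refine ENNReal.ofReal_le_ofReal (Real.exp_le_exp.2 ?_)
          have hp : 0 ≤ C * d * a := by positivity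
          calc C * d * a + C * d * a' * (s.card * Real.exp s.card)
              ≤ C * d * a * Real.exp (s.card + 1) +
                C * d * (Real.exp 1 * a) * (s.card * Real.exp s.card) := by
                have h1 : 1 ≤ Real.exp (s.card + 1 : ℝ) := Real.one_le_exp (by positivity)
                exact add_le_add (le_mul_of_one_le_right hp h1) (by gcongr)
            _ = C * d * a * ((s.card + 1) * Real.exp (s.card + 1)) := by rw [hsplit]; ring

/-- The probability under the reference law that there is no event in the windows. -/
noncomputable def emptyProb (B : ι → Set ℝ) : ℝ :=
  Real.exp (-∑ j, ((M.base.restrict (B j)) Set.univ).toReal)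

theorem measurableSet_totalCard (p : ℕ → Prop) :
    MeasurableSet {w : ι → Config | p (totalCard w)} :=
  measurable_totalCard (MeasurableSpace.measurableSet_top (s := {n | p n}))

theorem windowLaw_totalCard_eq_zero (B : ι → Set ℝ) :
    M.windowLaw B {w | totalCard w = 0} = ENNReal.ofReal (M.emptyProb B) := by
  have : {w : ι → Config | totalCard w = 0} =
      Set.univ.pi fun _ => {y : Config | y.events.card = 0} := by
    ext w
    simp [totalCard, Set.mem_pi]
  rw [this, windowLaw, Measure.pi_pi, emptyProb, ← Finset.sum_neg_distrib, Real.exp_sum,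
    ENNReal.ofReal_prod_of_nonneg fun _ _ => Real.exp_nonneg _]
  refine Finset.prod_congr rfl fun j _ => ?_
  have h := poissonLaw.setLIntegral_card_eq_zero (M.base.restrict (B j)) (G := fun _ => 1)
    measurable_const
  simpa using h

theorem setLIntegral_totalCard_eq_zero (B : ι → Set ℝ) (F : (ι → Config) → ℝ≥0∞) :
    ∫⁻ w in {w | totalCard w = 0}, F w ∂(M.windowLaw B) =
      ENNReal.ofReal (M.emptyProb B) * F fun _ => ⟨∅⟩ := by
  rw [← windowLaw_totalCard_eq_zero, mul_comm, ← setLIntegral_const]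
  refine setLIntegral_congr_fun (measurableSet_totalCard (· = 0)) fun w hw => ?_
  have hw' : ∀ j, (w j).events = ∅ := by
    simpa [totalCard] using hw
  congr 1
  funext j
  ext1
  exact hw' j

/-- On the event that node `k` has one event and the other nodes have none, the reference law is,
up to a constant, the intensity measure of the window of node `k`. -/
theorem setLIntegral_single [DecidableEq ι] {B : ι → Set ℝ} (k : ι)
    {F : (ι → Config) → ℝ≥0∞} (hF : Measurable F) :
    ∫⁻ w in {w | (w k).events.card = 1 ∧ ∀ j ≠ k, (w j).events.card = 0}, F w ∂(M.windowLaw B) =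
      ENNReal.ofReal (M.emptyProb B) *
        ∫⁻ u in B k, F (Function.update (fun _ => ⟨∅⟩) k ⟨{u}⟩) ∂M.base := by
  set ν : ι → Measure ℝ := fun j => M.base.restrict (B j) with hν
  set A : ι → Set Config := fun j => if j = k then {y | y.events.card = 1} else
    {y | y.events.card = 0} with hA
  have hAeq : {w : ι → Config | (w k).events.card = 1 ∧ ∀ j ≠ k, (w j).events.card = 0} =
      Set.univ.pi A := by
    ext w
    simp only [Set.mem_ofPred_eq, Set.mem_pi, Set.mem_univ, true_implies, hA]
    constructor
    · rintro ⟨h1, h2⟩ j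
      by_cases hj : j = k
      · subst hj; simpa using h1
      · simpa [hj] using h2 j hj
    · intro h
      exact ⟨by simpa using h k, fun j hj => by simpa [hj] using h j⟩
  have hsing : Measurable fun u : ℝ => (⟨{u}⟩ : Config) := by
    have h1 : (fun u : ℝ => (⟨{u}⟩ : Config)) = fun u => Config.ofVec (fun _ : Fin 1 => u) := by
      funext u; ext s; simp [eq_comm]
    rw [h1]
    exact (Config.measurable_ofVec 1).comp (measurable_pi_lambda _ fun _ => measurable_id)
  have hupd : Measurable fun u : ℝ =>
      Function.update (fun _ : ι => (⟨∅⟩ : Config)) k ⟨{u}⟩ :=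
    (measurable_update _).comp hsing
  have hmA : ∀ n : ℕ, MeasurableSet {y : Config | y.events.card = n} := fun n =>
    Config.measurable_card (measurableSet_singleton n)
  have hpi : (M.windowLaw B).restrict (Set.univ.pi A) = ENNReal.ofReal (M.emptyProb B) •
      (ν k).map fun u => Function.update (fun _ : ι => (⟨∅⟩ : Config)) k ⟨{u}⟩ := by
    rw [windowLaw, Measure.restrict_pi_pi]
    refine Measure.pi_eq fun s hs => ?_
    rw [Measure.smul_apply, Measure.map_apply hupd (MeasurableSet.univ_pi hs), smul_eq_mul,
      emptyProb, ← Finset.sum_neg_distrib, Real.exp_sum,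
      ENNReal.ofReal_prod_of_nonneg fun _ _ => Real.exp_nonneg _]
    have h0 : ∀ j, j ≠ k → (poissonLaw (ν j)).restrict (A j) (s j) =
        ENNReal.ofReal (Real.exp (-(ν j Set.univ).toReal)) * (s j).indicator 1 ⟨∅⟩ := by
      intro j hj
      rw [← lintegral_indicator_one (hs j)]
      simp only [hA, if_neg hj]
      exact poissonLaw.setLIntegral_card_eq_zero (ν j) (measurable_one.indicator (hs j))
    have h1 : (poissonLaw (ν k)).restrict (A k) (s k) =
        ENNReal.ofReal (Real.exp (-(ν k Set.univ).toReal)) * ν k {u | ⟨{u}⟩ ∈ s k} := by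
      rw [← lintegral_indicator_one (hs k)]
      simp only [hA, if_true]
      rw [poissonLaw.setLIntegral_card_eq_one (ν k) (measurable_one.indicator (hs k))]
      congr 1
      exact lintegral_indicator_one (hsing (hs k))
    rw [← Finset.mul_prod_erase _ (fun j => (poissonLaw (ν j)).restrict (A j) (s j))
      (Finset.mem_univ k), h1, Finset.prod_congr rfl fun j hj => h0 j (Finset.ne_of_mem_erase hj),
      Finset.prod_mul_distrib, ← Finset.mul_prod_erase _ (fun j =>
        ENNReal.ofReal (Real.exp (-(ν j Set.univ).toReal))) (Finset.mem_univ k)]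
    have hlast : ν k ((fun u => Function.update (fun _ : ι => (⟨∅⟩ : Config)) k ⟨{u}⟩) ⁻¹'
        Set.univ.pi s) =
        ν k {u | ⟨{u}⟩ ∈ s k} * ∏ j ∈ Finset.univ.erase k, (s j).indicator 1 (⟨∅⟩ : Config) := by
      by_cases hall : ∀ j, j ≠ k → (⟨∅⟩ : Config) ∈ s j
      · rw [Finset.prod_eq_one fun j hj => by
          rw [Set.indicator_of_mem (hall j (Finset.ne_of_mem_erase hj)), Pi.one_apply], mul_one]
        congr 1
        ext u
        simp only [Set.mem_preimage, Set.mem_pi, Set.mem_univ, true_implies, Set.mem_ofPred_eq]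
        constructor
        · intro h; simpa using h k
        · intro h j
          by_cases hj : j = k
          · subst hj; simpa using h
          · simpa [Function.update_of_ne hj] using hall j hj
      · push Not at hall
        obtain ⟨j, hj, hj'⟩ := hall
        rw [Finset.prod_eq_zero (Finset.mem_erase.2 ⟨hj, Finset.mem_univ j⟩)
          (Set.indicator_of_notMem hj' _), mul_zero]
        convert measure_empty (μ := ν k)
        ext u
        simp only [Set.mem_preimage, Set.mem_pi, Set.mem_univ, true_implies,
          Set.mem_empty_iff_false, iff_false, not_forall]
        exact ⟨j, by rwa [Function.update_of_ne hj]⟩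
    rw [hlast]
    ring
  rw [hAeq, hpi, lintegral_smul_measure, lintegral_map hF hupd, smul_eq_mul]

end Cascade

/-! ### The density after adding events -/

namespace Cascade

variable {ι : Type*} [Fintype ι] (M : Cascade ι)

section Mix

variable {B : ι → Set ℝ} {z w : ι → Config} (hz : ∀ j, ∀ s ∈ (z j).events, s ∉ B j)
  (hw : ∀ j, ∀ s ∈ (w j).events, s ∈ B j)

include hz hw

theorem lam_mixAll (j : ι) (u : ℝ) : M.lam (mixAll B z w) j u =
    M.lam z j u + ∑ i, ∑ v ∈ (w i).events, M.ker i j (u - v) := by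
  rw [lam, lam, add_assoc, ← Finset.sum_add_distrib]
  congr 1
  refine Finset.sum_congr rfl fun i _ => ?_
  obtain ⟨h1, h2⟩ := Config.mix_events_of_mem (hz i) (hw i)
  rw [mixAll, h1, Finset.sum_union h2]

/-- If the intensities and kernels are bounded near the window, the density of the realization `z`
with the events `w` added in the windows is bounded by a geometric factor in the number of the added
events times their cluster weight. -/
theorem density_mixAll_le {C : ℝ} (hC1 : 1 ≤ C) (L : Cascade ι) (hLr : ∀ j, L.rate j = C)
    (hLk : L.ker = M.ker)
    (h1 : ∀ j, ∀ s ∈ (w j).events, M.lam z j s ≤ C)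
    (h2 : ∀ j, ∀ s ∈ (z j).events, M.lam z j s ≤ C)
    (h3 : ∀ i j, ∀ s ∈ (z j).events, ∀ v ∈ (w i).events, M.ker i j (s - v) ≤ C) :
    M.density (mixAll B z w) ≤
      ENNReal.ofReal (Real.exp M.T ^ Fintype.card ι * C ^ totalCard z) *
        ENNReal.ofReal (2 ^ totalCard z) ^ totalCard w * L.clusterWeight Finset.univ 1 w := by
  have hC0 : 0 ≤ C := zero_le_one.trans hC1
  have hold : ∀ j, ∀ s ∈ (z j).events, M.lam (mixAll B z w) j s ≤ C * 2 ^ totalCard w := by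
    intro j s hs
    rw [M.lam_mixAll hz hw]
    have hsum : ∑ i, ∑ v ∈ (w i).events, M.ker i j (s - v) ≤ C * totalCard w := by
      rw [totalCard, Nat.cast_sum, Finset.mul_sum]
      refine Finset.sum_le_sum fun i _ => ?_
      rw [mul_comm, ← nsmul_eq_mul]
      exact Finset.sum_le_card_nsmul _ _ _ fun v hv => h3 i j s hs v hv
    have h2n : ((totalCard w + 1 : ℕ) : ℝ) ≤ ((2 ^ totalCard w : ℕ) : ℝ) :=
      Nat.cast_le.2 Nat.lt_two_pow_self
    push_cast at h2n
    calc M.lam z j s + ∑ i, ∑ v ∈ (w i).events, M.ker i j (s - v)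
        ≤ C + C * totalCard w := add_le_add (h2 j s hs) hsum
      _ = C * (totalCard w + 1) := by ring
      _ ≤ C * 2 ^ totalCard w := by gcongr
  have hnew : ∀ j, ∀ s ∈ (w j).events, M.lam (mixAll B z w) j s ≤ 1 * L.lam w j s := by
    intro j s hs
    have hL : L.lam w j s = C + ∑ i, ∑ v ∈ (w i).events, M.ker i j (s - v) := by
      rw [lam, hLr, hLk]
    rw [M.lam_mixAll hz hw, one_mul, hL]
    gcongr
    exact h1 j s hs
  have hnode : ∀ j, M.nodeWeight (mixAll B z w) j (mixAll B z w j) ≤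
      ENNReal.ofReal (Real.exp M.T) *
        (ENNReal.ofReal (C * 2 ^ totalCard w) ^ (z j).events.card *
          ∏ u ∈ (w j).events, ENNReal.ofReal (1 * L.lam w j u)) := by
    intro j
    obtain ⟨e1, e2⟩ := Config.mix_events_of_mem (hz j) (hw j)
    have hmixj : (mixAll B z w j).events = (z j).events ∪ (w j).events := e1
    rw [nodeWeight, hmixj, Finset.prod_union e2]
    refine mul_le_mul' (ENNReal.ofReal_le_ofReal (Real.exp_le_exp.2 ?_)) (mul_le_mul' ?_ ?_)
    · linarith [M.total_nonneg (mixAll B z w) j]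
    · exact Finset.prod_le_pow_card _ _ _ fun s hs => ENNReal.ofReal_le_ofReal (hold j s hs)
    · exact Finset.prod_le_prod' fun s hs => ENNReal.ofReal_le_ofReal (hnew j s hs)
  calc M.density (mixAll B z w)
      ≤ ∏ j, (ENNReal.ofReal (Real.exp M.T) *
        (ENNReal.ofReal (C * 2 ^ totalCard w) ^ (z j).events.card *
          ∏ u ∈ (w j).events, ENNReal.ofReal (1 * L.lam w j u))) :=
        Finset.prod_le_prod' fun j _ => hnode j
    _ = _ := by
        rw [Finset.prod_mul_distrib, Finset.prod_mul_distrib, Finset.prod_const,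
          Finset.prod_pow_eq_pow_sum, Finset.card_univ, ← clusterWeight, ← totalCard,
          ENNReal.ofReal_mul hC0, ENNReal.ofReal_mul (by positivity),
          ENNReal.ofReal_pow (Real.exp_nonneg _), ENNReal.ofReal_pow hC0, mul_pow,
          ← ENNReal.ofReal_pow (by positivity : (0:ℝ) ≤ 2 ^ totalCard z),
          ← ENNReal.ofReal_pow (by positivity : (0:ℝ) ≤ 2 ^ totalCard w), ← pow_mul, ← pow_mul,
          mul_comm (totalCard w)]
        ring

end Mix

section AddEvent

variable [DecidableEq ι]

open Classical in
/-- The realization `z` with the event `u` added to node `k`. -/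
noncomputable def addEvent (z : ι → Config) (k : ι) (u : ℝ) : ι → Config :=
  Function.update z k ⟨insert u (z k).events⟩

omit [Fintype ι] in
theorem mixAll_single {B : ι → Set ℝ} {z : ι → Config}
    (hz : ∀ j, ∀ s ∈ (z j).events, s ∉ B j) {k : ι} {u : ℝ} (hu : u ∈ B k) :
    mixAll B z (Function.update (fun _ => ⟨∅⟩) k ⟨{u}⟩) = addEvent z k u := by
  funext j
  by_cases hj : j = k
  · subst hj
    ext s
    simp only [mixAll, addEvent, Function.update_self, Config.mem_mix, Finset.mem_singleton,
      Finset.mem_insert]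
    constructor
    · rintro (h | h)
      · exact Or.inr h.1
      · exact Or.inl h.1
    · rintro (rfl | h)
      · exact Or.inr ⟨rfl, hu⟩
      · exact Or.inl ⟨h, hz _ _ h⟩
  · ext s
    simp only [mixAll, addEvent, Function.update_of_ne hj, Config.mem_mix, Finset.notMem_empty,
      false_and, or_false]
    exact and_iff_left_of_imp (hz j s)

theorem lam_addEvent {z : ι → Config} {k : ι} {u : ℝ} (hu : u ∉ (z k).events) (j : ι) (s : ℝ) :
    M.lam (addEvent z k u) j s = M.lam z j s + M.ker k j (s - u) := by
  classical
  rw [lam, lam, add_assoc]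
  congr 1
  rw [← Finset.add_sum_erase _ _ (Finset.mem_univ k), ← Finset.add_sum_erase _
    (fun i => ∑ v ∈ (z i).events, M.ker i j (s - v)) (Finset.mem_univ k)]
  have h1 : ∑ i ∈ Finset.univ.erase k, ∑ v ∈ (addEvent z k u i).events, M.ker i j (s - v) =
      ∑ i ∈ Finset.univ.erase k, ∑ v ∈ (z i).events, M.ker i j (s - v) :=
    Finset.sum_congr rfl fun i hi => by
      rw [addEvent, Function.update_of_ne (Finset.ne_of_mem_erase hi)]
  rw [h1, addEvent, Function.update_self, Finset.sum_insert hu]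
  ring

/-- The density of the realization `z` with the event `u` added to node `k`, as a function that is
continuous at every time `u` at which `z` has no event. -/
noncomputable def addDensity (z : ι → Config) (k : ι) (u : ℝ) : ℝ :=
  M.lam z k u * ∏ j, (Real.exp (M.T - (M.total z j + ∫ x, M.ker k j (x - u) ∂M.base)) *
    ∏ s ∈ (z j).events, (M.lam z j s + M.ker k j (s - u)))

theorem density_addEvent {z : ι → Config} {k : ι} {u : ℝ} (hu : u ∉ (z k).events) :
    M.density (addEvent z k u) = ENNReal.ofReal (M.addDensity z k u) := by
  classical
  have htot : ∀ j, M.total (addEvent z k u) j =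
      M.total z j + ∫ x, M.ker k j (x - u) ∂M.base := fun j => by
    simp only [total, M.lam_addEvent hu]
    exact integral_add (M.integrable_lam z j) ((M.ker_integrable k j).comp_sub_right u).restrict
  have hnn : ∀ j s, 0 ≤ M.lam z j s + M.ker k j (s - u) := fun j s =>
    add_nonneg (M.lam_nonneg _ _ _) (M.ker_nonneg _ _ _)
  have hnode : ∀ j, M.nodeWeight (addEvent z k u) j (addEvent z k u j) =
      (if j = k then ENNReal.ofReal (M.lam z k u) else 1) *
        ENNReal.ofReal (Real.exp (M.T - (M.total z j + ∫ x, M.ker k j (x - u) ∂M.base)) *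
          ∏ s ∈ (z j).events, (M.lam z j s + M.ker k j (s - u))) := by
    intro j
    rw [nodeWeight, htot, ENNReal.ofReal_mul (Real.exp_nonneg _),
      ENNReal.ofReal_prod_of_nonneg fun s _ => hnn j s]
    simp only [M.lam_addEvent hu]
    by_cases hj : j = k
    · subst hj
      rw [if_pos rfl, addEvent, Function.update_self, Finset.prod_insert hu, sub_self,
        M.ker_of_nonpos _ _ 0 le_rfl, add_zero]
      ring
    · rw [if_neg hj, addEvent, Function.update_of_ne hj, one_mul]
  rw [density, Finset.prod_congr rfl fun j _ => hnode j, Finset.prod_mul_distrib,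
    Finset.prod_ite_eq' , if_pos (Finset.mem_univ k), addDensity,
    ENNReal.ofReal_mul (M.lam_nonneg _ _ _), ENNReal.ofReal_prod_of_nonneg fun j _ =>
      mul_nonneg (Real.exp_nonneg _) (Finset.prod_nonneg fun s _ => hnn j s)]

omit [DecidableEq ι] in
theorem continuousAt_lam {z : ι → Config} {t : ℝ} (ht : ∀ j, t ∉ (z j).events) (j : ι) :
    ContinuousAt (M.lam z j) t := by
  unfold lam
  refine continuousAt_const.add (tendsto_finsetSum _ fun i _ => tendsto_finsetSum _ fun s hs => ?_)
  have hne : t - s ≠ 0 := sub_ne_zero.2 fun h => ht i (h ▸ hs)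
  exact ContinuousAt.comp (f := fun u => u - s) (g := M.ker i j)
    (M.ker_continuousAt i j _ hne) (by fun_prop)

omit [Fintype ι] [DecidableEq ι] in
theorem continuousAt_ker_sub {s t : ℝ} (h : s ≠ t) (i j : ι) :
    ContinuousAt (fun u => M.ker i j (s - u)) t :=
  ContinuousAt.comp (f := fun u => s - u) (g := M.ker i j)
    (M.ker_continuousAt i j _ (sub_ne_zero.2 h)) (by fun_prop)

omit [Fintype ι] [DecidableEq ι] in
theorem continuous_integral_ker (i j : ι) :
    Continuous fun u => ∫ x, M.ker i j (x - u) ∂M.base := by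
  have hint : ∀ a b, IntervalIntegrable (M.ker i j) volume a b := fun a b =>
    (M.ker_integrable i j).intervalIntegrable
  have h1 : (fun u => ∫ x, M.ker i j (x - u) ∂M.base) =
      fun u => (∫ x in (0 : ℝ)..(M.T - u), M.ker i j x) - ∫ x in (0 : ℝ)..(0 - u), M.ker i j x := by
    funext u
    rw [intervalIntegral.integral_interval_sub_left (hint _ _) (hint _ _),
      ← intervalIntegral.integral_comp_sub_right (fun x => M.ker i j x),
      intervalIntegral.integral_of_le M.T_nonneg, ← integral_Icc_eq_integral_Ioc]
    rfl
  rw [h1]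
  have h2 := intervalIntegral.continuous_primitive hint 0
  exact (h2.comp (continuous_const.sub continuous_id)).sub
    (h2.comp (continuous_const.sub continuous_id))

omit [DecidableEq ι] in
theorem continuousAt_addDensity {z : ι → Config} {t : ℝ} (ht : ∀ j, t ∉ (z j).events) (k : ι) :
    ContinuousAt (M.addDensity z k) t := by
  unfold addDensity
  refine (M.continuousAt_lam ht k).mul (tendsto_finsetProd _ fun j _ => ContinuousAt.mul ?_
    (tendsto_finsetProd _ fun s hs => continuousAt_const.add
      (M.continuousAt_ker_sub (fun h : s = t => ht j (h ▸ hs)) k j)))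
  exact (continuousAt_const.sub (continuousAt_const.add
    (M.continuous_integral_ker k j).continuousAt)).rexp

omit [DecidableEq ι] in
/-- The ratio of the densities with and without the additional event `u`. -/
theorem addDensity_div_density {z : ι → Config} (hz : M.density z ≠ 0) (k : ι) (u : ℝ) :
    M.addDensity z k u / (M.density z).toReal =
      M.lam z k u * ∏ j, (Real.exp (-∫ x, M.ker k j (x - u) ∂M.base) *
        ∏ s ∈ (z j).events, (M.lam z j s + M.ker k j (s - u)) / M.lam z j s) := by
  have hnode : ∀ j, M.nodeWeight z j (z j) ≠ 0 := fun j =>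
    Finset.prod_ne_zero_iff.1 hz j (Finset.mem_univ j)
  have hlam : ∀ j, ∀ s ∈ (z j).events, M.lam z j s ≠ 0 := fun j s hs h0 => by
    have := Finset.prod_ne_zero_iff.1 (right_ne_zero_of_mul (hnode j)) s hs
    simp [h0] at this
  have hD : (M.density z).toReal =
      ∏ j, (Real.exp (M.T - M.total z j) * ∏ s ∈ (z j).events, M.lam z j s) := by
    rw [density, ENNReal.toReal_prod]
    refine Finset.prod_congr rfl fun j _ => ?_
    rw [nodeWeight, ENNReal.toReal_mul, ENNReal.toReal_prod,
      ENNReal.toReal_ofReal (Real.exp_nonneg _)]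
    simp only [ENNReal.toReal_ofReal (M.lam_nonneg _ _ _)]
  rw [hD, addDensity, mul_div_assoc, ← Finset.prod_div_distrib]
  congr 1
  refine Finset.prod_congr rfl fun j _ => ?_
  have hp : ∏ s ∈ (z j).events, M.lam z j s ≠ 0 := Finset.prod_ne_zero_iff.2 (hlam j)
  rw [Finset.prod_div_distrib, ← sub_sub, Real.exp_sub (M.T - M.total z j), Real.exp_neg]
  field_simp

end AddEvent

end Cascade

/-! ### Short windows -/

section Windows

/-- A property that holds near `t` holds throughout all short windows `[t, t + d]`. -/
theorem Filter.Eventually.forall_mem_window {p : ℝ → Prop} {t : ℝ} (h : ∀ᶠ u in 𝓝 t, p u) :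
    ∀ᶠ d in 𝓝[>] (0 : ℝ), ∀ u ∈ Set.Icc t (t + d), p u := by
  obtain ⟨r, hr, hp⟩ := Metric.eventually_nhds_iff.1 h
  filter_upwards [Ioo_mem_nhdsGT hr] with d hd u hu
  refine hp ?_
  rw [Real.dist_eq, abs_of_nonneg (by linarith [hu.1])]
  linarith [hu.2, hd.2]

/-- The averages of `f` over the windows `[t, t + d]` converge to `f t` if `f` is continuous
at `t`. -/
theorem tendsto_lintegral_window_div {f : ℝ → ℝ≥0∞} {t : ℝ} (hf : ContinuousAt f t)
    (hft : f t ≠ ∞) :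
    Tendsto (fun d => (∫⁻ u in Set.Icc t (t + d), f u) / ENNReal.ofReal d) (𝓝[>] 0)
      (𝓝 (f t)) := by
  rw [ENNReal.tendsto_nhds hft]
  intro e he
  have h1 := (ENNReal.tendsto_nhds hft).1 hf.tendsto e he
  filter_upwards [h1.forall_mem_window, self_mem_nhdsWithin] with d hd hd0
  have hd0' : 0 < d := hd0
  have hvol : volume (Set.Icc t (t + d)) = ENNReal.ofReal d := by
    rw [Real.volume_Icc, add_sub_cancel_left]
  have hne : ENNReal.ofReal d ≠ 0 := by simpa using hd0'
  constructor
  · rw [ENNReal.le_div_iff_mul_le (Or.inl hne) (Or.inl ENNReal.ofReal_ne_top), ← hvol,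
      ← setLIntegral_const]
    exact setLIntegral_mono' measurableSet_Icc fun u hu => (hd u hu).1
  · rw [ENNReal.div_le_iff_le_mul (Or.inl hne) (Or.inl ENNReal.ofReal_ne_top), ← hvol,
      ← setLIntegral_const]
    exact setLIntegral_mono' measurableSet_Icc fun u hu => (hd u hu).2

end Windows

namespace Cascade

variable {ι : Type*} [Fintype ι] (M : Cascade ι)

open Classical in
/-- The windows hidden from view: `B` for the nodes in `S`, nothing for the other nodes. -/
noncomputable def windows (S : Set ι) (B : Set ℝ) (j : ι) : Set ℝ := if j ∈ S then B else ∅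

omit [Fintype ι] in
theorem measurableSet_windows (S : Set ι) {B : Set ℝ} (hB : MeasurableSet B) (j : ι) :
    MeasurableSet (windows S B j) := by
  unfold windows; split_ifs; exacts [hB, MeasurableSet.empty]

omit [Fintype ι] in
theorem windows_subset (S : Set ι) (B : Set ℝ) (j : ι) : windows S B j ⊆ B := by
  unfold windows; split_ifs; exacts [subset_rfl, Set.empty_subset _]

/-- A bound for the mass that all kernels together put on an initial interval of length `d`. -/
noncomputable def shortMass (d : ℝ) : ℝ := ∑ i, ∑ j, ∫ u in (0 : ℝ)..d, M.ker i j u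

theorem shortMass_nonneg {d : ℝ} (hd : 0 ≤ d) : 0 ≤ M.shortMass d :=
  Finset.sum_nonneg fun i _ => Finset.sum_nonneg fun j _ =>
    intervalIntegral.integral_nonneg hd fun u _ => M.ker_nonneg i j u

theorem tendsto_shortMass : Tendsto M.shortMass (𝓝 0) (𝓝 0) := by
  have h : Continuous M.shortMass := by
    refine continuous_finsetSum _ fun i _ => continuous_finsetSum _ fun j _ => ?_
    exact intervalIntegral.continuous_primitive
      (fun a b => (M.ker_integrable i j).intervalIntegrable) 0
  have h0 : M.shortMass 0 = 0 := by simp [shortMass]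
  simpa [h0] using h.tendsto 0

theorem setIntegral_ker_le_shortMass {t d : ℝ} (hd : 0 ≤ d) (i j : ι) {v : ℝ}
    (hv : v ∈ Set.Icc t (t + d)) :
    ∫ u in Set.Icc t (t + d), M.ker i j (u - v) ≤ M.shortMass d := by
  have hint : Integrable (fun u => M.ker i j (u - v)) := (M.ker_integrable i j).comp_sub_right v
  have h1 : ∫ u in Set.Icc t (t + d), M.ker i j (u - v) ≤ ∫ u in (0 : ℝ)..d, M.ker i j u := by
    rw [intervalIntegral.integral_of_le hd, ← integral_Icc_eq_integral_Ioc,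
      ← integral_indicator measurableSet_Icc, ← integral_indicator measurableSet_Icc,
      ← integral_sub_right_eq_self (fun u => (Set.Icc 0 d).indicator (M.ker i j) u) v]
    refine integral_mono (hint.indicator measurableSet_Icc)
      (((M.ker_integrable i j).indicator measurableSet_Icc).comp_sub_right v) fun u => ?_
    simp only
    by_cases hu : u ∈ Set.Icc t (t + d)
    · rw [Set.indicator_of_mem hu]
      by_cases huv : u - v ∈ Set.Icc 0 d
      · rw [Set.indicator_of_mem huv]
      · rw [Set.indicator_of_notMem huv]
        refine (M.ker_of_nonpos i j _ ?_).le
        by_contra hpos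
        push Not at hpos
        exact huv ⟨hpos.le, by linarith [hu.2, hv.1]⟩
    · rw [Set.indicator_of_notMem hu]
      exact Set.indicator_nonneg (fun u _ => M.ker_nonneg i j u) _
  refine h1.trans ?_
  have hnn : ∀ i j, 0 ≤ ∫ u in (0 : ℝ)..d, M.ker i j u := fun i j =>
    intervalIntegral.integral_nonneg hd fun u _ => M.ker_nonneg i j u
  calc ∫ u in (0 : ℝ)..d, M.ker i j u ≤ ∑ j, ∫ u in (0 : ℝ)..d, M.ker i j u :=
        Finset.single_le_sum (f := fun j => ∫ u in (0 : ℝ)..d, M.ker i j u)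
          (fun j _ => hnn i j) (Finset.mem_univ j)
    _ ≤ M.shortMass d :=
        Finset.single_le_sum (f := fun i => ∑ j, ∫ u in (0 : ℝ)..d, M.ker i j u)
          (fun i _ => Finset.sum_nonneg fun j _ => hnn i j) (Finset.mem_univ i)

/-- The reciprocal of the weight given to each event of a cluster in a window of length `d`. It
tends to `0` with `d`, but so slowly that the exponential moments of the clusters stay bounded. -/
noncomputable def smallness (d : ℝ) : ℝ := Real.exp (Fintype.card ι) * (M.shortMass d + d)

theorem smallness_pos {d : ℝ} (hd : 0 < d) : 0 < M.smallness d :=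
  mul_pos (Real.exp_pos _) (add_pos_of_nonneg_of_pos (M.shortMass_nonneg hd.le) hd)

theorem le_smallness {d : ℝ} (hd : 0 ≤ d) : d ≤ M.smallness d := by
  have h1 : 1 ≤ Real.exp (Fintype.card ι) := Real.one_le_exp (Nat.cast_nonneg _)
  have h2 := M.shortMass_nonneg hd
  unfold smallness
  nlinarith

theorem tendsto_smallness : Tendsto M.smallness (𝓝[>] 0) (𝓝 0) := by
  have h := (M.tendsto_shortMass.add tendsto_id).const_mul (Real.exp (Fintype.card ι))
  simp only [add_zero, mul_zero] at h
  exact h.mono_left nhdsWithin_le_nhds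

omit [Fintype ι] in
theorem base_restrict_univ_le {B : Set ℝ} {t d : ℝ} (hB : B ⊆ Set.Icc t (t + d)) (hd : 0 ≤ d) :
    ((M.base.restrict B) Set.univ).toReal ≤ d := by
  refine ENNReal.toReal_le_of_le_ofReal hd ?_
  rw [Measure.restrict_apply_univ]
  calc M.base B ≤ volume B := Measure.restrict_apply_le _ _
    _ ≤ volume (Set.Icc t (t + d)) := measure_mono hB
    _ = ENNReal.ofReal d := by rw [Real.volume_Icc, add_sub_cancel_left]

theorem emptyProb_le_one (B : ι → Set ℝ) : M.emptyProb B ≤ 1 :=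
  Real.exp_le_one_iff.2 (neg_nonpos.2 (Finset.sum_nonneg fun _ _ => ENNReal.toReal_nonneg))

theorem one_sub_le_emptyProb {B : ι → Set ℝ} {t d : ℝ} (hB : ∀ j, B j ⊆ Set.Icc t (t + d))
    (hd : 0 ≤ d) : 1 - Fintype.card ι * d ≤ M.emptyProb B := by
  have h1 : ∑ j, ((M.base.restrict (B j)) Set.univ).toReal ≤ Fintype.card ι * d := by
    rw [← nsmul_eq_mul, ← Finset.card_univ]
    exact Finset.sum_le_card_nsmul _ _ _ fun j _ => M.base_restrict_univ_le (hB j) hd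
  have h2 := Real.add_one_le_exp (-∑ j, ((M.base.restrict (B j)) Set.univ).toReal)
  unfold emptyProb
  linarith

variable [DecidableEq ι]

/-- The weighted mass of the non-empty clusters in a short window. -/
theorem setLIntegral_clusterWeight_le {B : ι → Set ℝ} (hB : ∀ j, MeasurableSet (B j))
    {C t d : ℝ} (hd : 0 < d) (hBI : ∀ j, B j ⊆ Set.Icc t (t + d)) (hC0 : 0 ≤ C)
    (hC : ∀ j, M.rate j ≤ C) :
    ∫⁻ w in {w | 1 ≤ totalCard w}, M.clusterWeight Finset.univ (M.smallness d)⁻¹ w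
      ∂(M.windowLaw B) ≤
      ENNReal.ofReal (d * (C * (Fintype.card ι * Real.exp (Fintype.card ι)) *
        Real.exp (C * (Fintype.card ι * Real.exp (Fintype.card ι))) / M.smallness d +
          Fintype.card ι)) := by
  set h := M.smallness d with hh
  have hpos : 0 < h := M.smallness_pos hd
  set c := (Fintype.card ι * Real.exp (Fintype.card ι) : ℝ) with hc
  have hc0 : 0 ≤ c := by positivity
  have hI := M.lintegral_clusterWeight_le hB hd.le hBI hC0 hC (M.shortMass_nonneg hd.le)
    (fun i j v hv => M.setIntegral_ker_le_shortMass hd.le i j hv) Finset.univ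
    (fun _ _ _ _ => Finset.mem_univ _) (a := h⁻¹) (by positivity) (by
      rw [Finset.card_univ, mul_assoc, inv_mul_le_one₀ hpos, hh, smallness]
      gcongr
      linarith)
  rw [Finset.card_univ, ← hc] at hI
  have hmS : MeasurableSet {w : ι → Config | 1 ≤ totalCard w} := measurableSet_totalCard _
  have hcompl : {w : ι → Config | 1 ≤ totalCard w}ᶜ = {w | totalCard w = 0} := by
    ext w; simp
  rw [← lintegral_add_compl _ hmS, hcompl, setLIntegral_totalCard_eq_zero] at hI
  have h1 : M.clusterWeight Finset.univ h⁻¹ (fun _ => ⟨∅⟩) = 1 := by simp [clusterWeight]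
  rw [h1, mul_one] at hI
  refine (ENNReal.le_sub_of_add_le_right ENNReal.ofReal_ne_top hI).trans ?_
  rw [← ENNReal.ofReal_sub _ (show 0 ≤ M.emptyProb B from Real.exp_nonneg _)]
  refine ENNReal.ofReal_le_ofReal ?_
  have h2 := M.one_sub_le_emptyProb hBI hd.le
  -- `exp x ≤ 1 + x * exp x`
  set x := C * d * h⁻¹ * c with hx
  have h3 : Real.exp x ≤ 1 + x * Real.exp x := by
    have := Real.add_one_le_exp (-x)
    have h4 : Real.exp (-x) * Real.exp x = 1 := by rw [← Real.exp_add]; simp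
    nlinarith [Real.exp_pos x]
  have hdh : d * h⁻¹ ≤ 1 := by
    rw [← div_eq_mul_inv, div_le_one hpos]
    exact M.le_smallness hd.le
  have hx0 : 0 ≤ x := by positivity
  have hxle : x ≤ C * c := by
    calc x = C * c * (d * h⁻¹) := by rw [hx]; ring
      _ ≤ C * c * 1 := by gcongr
      _ = C * c := mul_one _
  have h5 : x * Real.exp x ≤ x * Real.exp (C * c) := by gcongr
  have h6 : x * Real.exp (C * c) = d * (C * c * Real.exp (C * c) / h) := by
    rw [hx]; field_simp
  linarith [mul_add d (C * c * Real.exp (C * c) / h) (Fintype.card ι : ℝ),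
    mul_comm (Fintype.card ι : ℝ) d]

end Cascade

/-! ### The limit of the conditional probabilities -/

namespace Cascade

variable {ι : Type*} [Fintype ι] (M : Cascade ι)

/-- The cascade with the same kernels in which all nodes have the constant rate `C`. -/
def withRate {ι : Type*} (M : Cascade ι) (C : ℝ) (hC : 0 ≤ C) : Cascade ι :=
  { M with
    rate := fun _ => C
    rate_nonneg := fun _ => hC }

/-- Near a time `t` that is not an event of `z`, all the intensities and kernels that enter the
density of `z` with further events in a short window are bounded. -/
theorem exists_bound_near {z : ι → Config} {t : ℝ} (ht : ∀ j, t ∉ (z j).events) :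
    ∃ C : ℝ, 1 ≤ C ∧ ∀ᶠ d in 𝓝[>] (0 : ℝ),
      (∀ j, ∀ s ∈ (z j).events, s ∉ Set.Icc t (t + d)) ∧
      (∀ j, ∀ u ∈ Set.Icc t (t + d), M.lam z j u ≤ C) ∧
      (∀ j, ∀ s ∈ (z j).events, M.lam z j s ≤ C) ∧
      ∀ i j, ∀ s ∈ (z j).events, ∀ v ∈ Set.Icc t (t + d), M.ker i j (s - v) ≤ C := by
  have key : ∀ f : ℝ → ℝ, ContinuousAt f t →
      ∀ᶠ C in atTop, ∀ᶠ d in 𝓝[>] (0 : ℝ), ∀ u ∈ Set.Icc t (t + d), f u ≤ C := by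
    intro f hf
    filter_upwards [eventually_gt_atTop (f t)] with C hC
    exact (hf.tendsto.eventually (ge_mem_nhds hC)).forall_mem_window
  have h1 : ∀ᶠ C in atTop, ∀ j, ∀ᶠ d in 𝓝[>] (0 : ℝ), ∀ u ∈ Set.Icc t (t + d),
      M.lam z j u ≤ C :=
    eventually_all.2 fun j => key _ (M.continuousAt_lam ht j)
  have h2 : ∀ᶠ C in atTop, ∀ j, ∀ s ∈ (z j).events, M.lam z j s ≤ C :=
    eventually_all.2 fun j => (Finset.eventually_all _).2 fun s _ => eventually_ge_atTop _
  have h3 : ∀ᶠ C in atTop, ∀ i j, ∀ s ∈ (z j).events, ∀ᶠ d in 𝓝[>] (0 : ℝ),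
      ∀ v ∈ Set.Icc t (t + d), M.ker i j (s - v) ≤ C :=
    eventually_all.2 fun i => eventually_all.2 fun j => (Finset.eventually_all _).2 fun s hs =>
      key _ (M.continuousAt_ker_sub (fun h : s = t => ht j (h ▸ hs)) i j)
  have h4 : ∀ᶠ d in 𝓝[>] (0 : ℝ), ∀ j, ∀ s ∈ (z j).events, s ∉ Set.Icc t (t + d) := by
    refine eventually_all.2 fun j => (Finset.eventually_all _).2 fun s hs => ?_
    have hne : t ≠ s := fun h : t = s => ht j (h ▸ hs)
    have h5 := (eventually_ne_nhds hne).forall_mem_window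
    filter_upwards [h5] with d hd hmem
    exact hd s hmem rfl
  obtain ⟨C, hC1, hC2, hC3, hC4⟩ := (h1.and (h2.and (h3.and (eventually_ge_atTop 1)))).exists
  refine ⟨C, hC4, ?_⟩
  have h3' := eventually_all.2 fun i => eventually_all.2 fun j =>
    (Finset.eventually_all _).2 fun s hs => hC3 i j s hs
  filter_upwards [h4, eventually_all.2 hC1, h3'] with d hd1 hd2 hd3
  exact ⟨hd1, hd2, hC2, hd3⟩

variable [DecidableEq ι]

/-- The part of a resampling average of the density that comes from at least `p` events in a window
of length `d` is of the order of `d * smallness d ^ (p - 1)`. Every event of a cluster brings a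
factor `b * smallness d ≤ 1`, at the price of the weight `(smallness d)⁻¹` in the cluster weight. -/
theorem setLIntegral_density_le {B : ι → Set ℝ} (hB : ∀ j, MeasurableSet (B j))
    {C t d : ℝ} (hd : 0 < d) (hBI : ∀ j, B j ⊆ Set.Icc t (t + d)) (hC0 : 0 ≤ C)
    {z : ι → Config} {K b : ℝ} (hK : 0 ≤ K) (hb : 0 ≤ b)
    (hD : ∀ᵐ w ∂(M.windowLaw B), M.density (mixAll B z w) ≤
      ENNReal.ofReal K * ENNReal.ofReal b ^ totalCard w *
        (M.withRate C hC0).clusterWeight Finset.univ 1 w)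
    {p : ℕ} (hp : 1 ≤ p) (hbh : b * M.smallness d ≤ 1) :
    ∫⁻ w in {w | p ≤ totalCard w}, M.density (mixAll B z w) ∂(M.windowLaw B) ≤
      ENNReal.ofReal (K * (b * M.smallness d) ^ p *
        (d * (C * (Fintype.card ι * Real.exp (Fintype.card ι)) *
          Real.exp (C * (Fintype.card ι * Real.exp (Fintype.card ι))) / M.smallness d +
            Fintype.card ι))) := by
  set h := M.smallness d with hh
  have hpos : 0 < h := M.smallness_pos hd
  set L := M.withRate C hC0 with hL
  have hbound : ∀ᵐ w ∂(M.windowLaw B), p ≤ totalCard w → M.density (mixAll B z w) ≤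
      ENNReal.ofReal (K * (b * h) ^ p) * L.clusterWeight Finset.univ h⁻¹ w := by
    filter_upwards [hD] with w hw hpw
    refine hw.trans ?_
    have h1 : L.clusterWeight Finset.univ h⁻¹ w =
        ENNReal.ofReal h⁻¹ ^ totalCard w * L.clusterWeight Finset.univ 1 w := by
      have := L.clusterWeight_mul Finset.univ (a := 1) (b := h⁻¹) (by positivity) w
      rwa [mul_one] at this
    rw [h1, ← mul_assoc]
    refine mul_le_mul' ?_ le_rfl
    rw [← ENNReal.ofReal_pow hb, ← ENNReal.ofReal_pow (by positivity), ← ENNReal.ofReal_mul hK,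
      ← ENNReal.ofReal_mul (by positivity)]
    refine ENNReal.ofReal_le_ofReal ?_
    calc K * b ^ totalCard w = K * (b * h) ^ totalCard w * h⁻¹ ^ totalCard w := by
          rw [mul_assoc, ← mul_pow, mul_assoc, mul_inv_cancel₀ hpos.ne', mul_one]
      _ ≤ K * (b * h) ^ p * h⁻¹ ^ totalCard w := by
          have := pow_le_pow_of_le_one (by positivity) hbh hpw
          gcongr
  calc ∫⁻ w in {w | p ≤ totalCard w}, M.density (mixAll B z w) ∂(M.windowLaw B)
      ≤ ∫⁻ w in {w | p ≤ totalCard w},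
          ENNReal.ofReal (K * (b * h) ^ p) * L.clusterWeight Finset.univ h⁻¹ w
            ∂(M.windowLaw B) :=
        setLIntegral_mono_ae' (measurableSet_totalCard (p ≤ ·)) hbound
    _ ≤ ∫⁻ w in {w | 1 ≤ totalCard w},
          ENNReal.ofReal (K * (b * h) ^ p) * L.clusterWeight Finset.univ h⁻¹ w
            ∂(M.windowLaw B) :=
        lintegral_mono_set fun w hw => hp.trans hw
    _ ≤ ENNReal.ofReal (K * (b * h) ^ p) * ENNReal.ofReal (d *
          (C * (Fintype.card ι * Real.exp (Fintype.card ι)) *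
            Real.exp (C * (Fintype.card ι * Real.exp (Fintype.card ι))) / h + Fintype.card ι)) := by
        rw [lintegral_const_mul _ (L.measurable_clusterWeight _ (by positivity))]
        exact mul_le_mul_right (L.setLIntegral_clusterWeight_le hB hd hBI hC0 fun _ => le_rfl) _
    _ = _ := by
        rw [← ENNReal.ofReal_mul (by positivity)]

/-- As the windows shrink, at least one event in them becomes negligible, and at least two events
become negligible even after division by the length of the window. -/
theorem tendsto_setLIntegral_density {z : ι → Config} {t : ℝ} (ht : ∀ j, t ∉ (z j).events)
    (S : Set ι) :
    Tendsto (fun d => ∫⁻ w in {w | 1 ≤ totalCard w},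
      M.density (mixAll (windows S (Set.Icc t (t + d))) z w)
        ∂(M.windowLaw (windows S (Set.Icc t (t + d))))) (𝓝[>] 0) (𝓝 0) ∧
    Tendsto (fun d => (∫⁻ w in {w | 2 ≤ totalCard w},
      M.density (mixAll (windows S (Set.Icc t (t + d))) z w)
        ∂(M.windowLaw (windows S (Set.Icc t (t + d))))) / ENNReal.ofReal d) (𝓝[>] 0) (𝓝 0) := by
  obtain ⟨C, hC1, hC⟩ := M.exists_bound_near ht
  have hC0 : 0 ≤ C := zero_le_one.trans hC1
  set K := Real.exp M.T ^ Fintype.card ι * C ^ totalCard z with hK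
  set b : ℝ := 2 ^ totalCard z with hb
  set c := C * (Fintype.card ι * Real.exp (Fintype.card ι)) *
    Real.exp (C * (Fintype.card ι * Real.exp (Fintype.card ι))) with hc
  set N : ℝ := (Fintype.card ι : ℝ) with hN
  have hsm := M.tendsto_smallness
  have hbh : ∀ᶠ d in 𝓝[>] (0 : ℝ), b * M.smallness d ≤ 1 := by
    have := hsm.const_mul b
    rw [mul_zero] at this
    exact this.eventually (ge_mem_nhds zero_lt_one)
  have hbound : ∀ᶠ d in 𝓝[>] (0 : ℝ), 0 < d ∧ ∀ p : ℕ, 1 ≤ p →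
      ∫⁻ w in {w | p ≤ totalCard w},
        M.density (mixAll (windows S (Set.Icc t (t + d))) z w)
          ∂(M.windowLaw (windows S (Set.Icc t (t + d)))) ≤
        ENNReal.ofReal (K * (b * M.smallness d) ^ p * (d * (c / M.smallness d + N))) := by
    filter_upwards [hC, hbh, self_mem_nhdsWithin] with d hd hbd hd0
    have hd0' : 0 < d := hd0
    refine ⟨hd0', fun p hp => ?_⟩
    have hBm := measurableSet_windows S (measurableSet_Icc (a := t) (b := t + d))
    have hBI := windows_subset S (Set.Icc t (t + d))
    refine M.setLIntegral_density_le hBm hd0' hBI hC0 (by positivity) (by positivity) ?_ hp hbd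
    filter_upwards [M.ae_mem_window hBm] with w hw
    obtain ⟨h0, h1, h2, h3⟩ := hd
    exact M.density_mixAll_le (fun j s hs hsB => h0 j s hs (hBI j hsB)) hw hC1
      (M.withRate C hC0) (fun _ => rfl) rfl (fun j s hs => h1 j s (hBI j (hw j s hs))) h2
      (fun i j s hs v hv => h3 i j s hs v (hBI i (hw i v hv)))
  have hid : Tendsto (fun d : ℝ => d) (𝓝[>] 0) (𝓝 0) := tendsto_id.mono_left nhdsWithin_le_nhds
  constructor
  · have hlim : Tendsto (fun d => ENNReal.ofReal (K * b * d * (c + N * M.smallness d)))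
        (𝓝[>] 0) (𝓝 0) := by
      have := ENNReal.tendsto_ofReal ((hid.const_mul (K * b)).mul
        ((hsm.const_mul N).const_add c))
      simpa using this
    refine tendsto_of_tendsto_of_tendsto_of_le_of_le' tendsto_const_nhds hlim
      (Eventually.of_forall fun _ => zero_le) (hbound.mono fun d hd => ?_)
    refine (hd.2 1 le_rfl).trans (ENNReal.ofReal_le_ofReal (le_of_eq ?_))
    have := (M.smallness_pos hd.1).ne'
    field_simp
  · have hlim : Tendsto (fun d => ENNReal.ofReal (K * b ^ 2 * M.smallness d *
        (c + N * M.smallness d))) (𝓝[>] 0) (𝓝 0) := by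
      have := ENNReal.tendsto_ofReal ((hsm.const_mul (K * b ^ 2)).mul
        ((hsm.const_mul N).const_add c))
      simpa using this
    refine tendsto_of_tendsto_of_tendsto_of_le_of_le' tendsto_const_nhds hlim
      (Eventually.of_forall fun _ => zero_le) (hbound.mono fun d hd => ?_)
    refine (ENNReal.div_le_div_right (hd.2 2 one_le_two) _).trans ?_
    rw [← ENNReal.ofReal_div_of_pos hd.1]
    refine ENNReal.ofReal_le_ofReal (le_of_eq ?_)
    have := (M.smallness_pos hd.1).ne'
    have := hd.1.ne'
    field_simp

omit [DecidableEq ι] in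
theorem tendsto_emptyProb (S : Set ι) (t : ℝ) :
    Tendsto (fun d => ENNReal.ofReal (M.emptyProb (windows S (Set.Icc t (t + d))))) (𝓝[>] 0)
      (𝓝 1) := by
  have hid : Tendsto (fun d : ℝ => d) (𝓝[>] 0) (𝓝 0) := tendsto_id.mono_left nhdsWithin_le_nhds
  have h1 : Tendsto (fun d : ℝ => 1 - Fintype.card ι * d) (𝓝[>] 0) (𝓝 1) := by
    simpa using (hid.const_mul (Fintype.card ι : ℝ)).const_sub 1
  have h2 : Tendsto (fun d => M.emptyProb (windows S (Set.Icc t (t + d)))) (𝓝[>] 0) (𝓝 1) := by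
    refine tendsto_of_tendsto_of_tendsto_of_le_of_le' h1 tendsto_const_nhds ?_
      (Eventually.of_forall fun _ => M.emptyProb_le_one _)
    filter_upwards [self_mem_nhdsWithin] with d hd
    exact M.one_sub_le_emptyProb (windows_subset S _) (le_of_lt hd)
  simpa using ENNReal.tendsto_ofReal h2

omit [Fintype ι] [DecidableEq ι] in
theorem mixAll_empty {B : ι → Set ℝ} {z : ι → Config}
    (hz : ∀ j, ∀ s ∈ (z j).events, s ∉ B j) : mixAll B z (fun _ => ⟨∅⟩) = z := by
  funext j
  ext s
  simp only [mixAll, Config.mem_mix, Finset.notMem_empty, false_and, or_false]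
  exact and_iff_left_of_imp (hz j s)

/-- The denominator of the conditional probability: in the limit there is no event in the
windows. -/
theorem tendsto_resample_density {z : ι → Config} {t : ℝ} (ht : ∀ j, t ∉ (z j).events)
    (S : Set ι) :
    Tendsto (fun d => M.resample (windows S (Set.Icc t (t + d))) M.density z) (𝓝[>] 0)
      (𝓝 (M.density z)) := by
  obtain ⟨C, -, hC⟩ := M.exists_bound_near ht
  have h1 := (ENNReal.Tendsto.mul_const (M.tendsto_emptyProb S t)
    (Or.inr (M.density_ne_top z))).add (M.tendsto_setLIntegral_density ht S).1
  rw [one_mul, add_zero] at h1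
  refine h1.congr' (hC.mono fun d hd => ?_)
  have hz : ∀ j, ∀ s ∈ (z j).events, s ∉ windows S (Set.Icc t (t + d)) j :=
    fun j s hs hsB => hd.1 j s hs (windows_subset S _ j hsB)
  have hm : MeasurableSet {w : ι → Config | totalCard w = 0} := measurableSet_totalCard (· = 0)
  have hcompl : {w : ι → Config | totalCard w = 0}ᶜ = {w | 1 ≤ totalCard w} := by
    ext w; simp [Nat.one_le_iff_ne_zero]
  have h2 := lintegral_add_compl (μ := M.windowLaw (windows S (Set.Icc t (t + d))))
    (fun w => M.density (mixAll (windows S (Set.Icc t (t + d))) z w)) hm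
  rw [hcompl, setLIntegral_totalCard_eq_zero, mixAll_empty hz] at h2
  exact h2

/-- The event that node `k` has exactly one event in `B`. -/
def oneEvent (k : ι) (B : Set ℝ) : Set (ι → Config) := {x | (x k).count B = 1}

omit [Fintype ι] [DecidableEq ι] in
theorem measurableSet_oneEvent (k : ι) {B : Set ℝ} (hB : MeasurableSet B) :
    MeasurableSet (oneEvent k B) :=
  ((Config.measurable_count hB).comp (measurable_pi_apply k)) (measurableSet_singleton 1)

/-- The numerator of the conditional probability: exactly one event at node `k` and none at the
other nodes gives the average of `addDensity` over the window, and what remains has at least two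
events. -/
theorem tendsto_resample_oneEvent {z : ι → Config} {t : ℝ} (ht : ∀ j, t ∉ (z j).events)
    (S : Set ι) {k : ι} (hk : k ∈ S) (ht0 : 0 ≤ t) (htT : t < M.T) :
    Tendsto (fun d => M.resample (windows S (Set.Icc t (t + d)))
      ((oneEvent k (Set.Icc t (t + d))).indicator M.density) z / ENNReal.ofReal d) (𝓝[>] 0)
      (𝓝 (ENNReal.ofReal (M.addDensity z k t))) := by
  classical
  obtain ⟨C, -, hC⟩ := M.exists_bound_near ht
  have havg := tendsto_lintegral_window_div
    (f := fun u => ENNReal.ofReal (M.addDensity z k u)) (t := t)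
    (ENNReal.continuous_ofReal.continuousAt.comp (M.continuousAt_addDensity ht k))
    ENNReal.ofReal_ne_top
  have hlow := ENNReal.Tendsto.mul (M.tendsto_emptyProb S t) (Or.inl one_ne_zero) havg
    (Or.inr ENNReal.one_ne_top)
  have hup := hlow.add (M.tendsto_setLIntegral_density ht S).2
  rw [one_mul] at hlow
  rw [one_mul, add_zero] at hup
  have hev : ∀ᶠ d in 𝓝[>] (0 : ℝ),
      ENNReal.ofReal (M.emptyProb (windows S (Set.Icc t (t + d)))) *
        ∫⁻ u in Set.Icc t (t + d), ENNReal.ofReal (M.addDensity z k u) ≤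
      M.resample (windows S (Set.Icc t (t + d)))
        ((oneEvent k (Set.Icc t (t + d))).indicator M.density) z ∧
      M.resample (windows S (Set.Icc t (t + d)))
        ((oneEvent k (Set.Icc t (t + d))).indicator M.density) z ≤
      ENNReal.ofReal (M.emptyProb (windows S (Set.Icc t (t + d)))) *
        (∫⁻ u in Set.Icc t (t + d), ENNReal.ofReal (M.addDensity z k u)) +
      ∫⁻ w in {w | 2 ≤ totalCard w},
        M.density (mixAll (windows S (Set.Icc t (t + d))) z w)
          ∂(M.windowLaw (windows S (Set.Icc t (t + d)))) := by
    have hshort : ∀ᶠ d in 𝓝[>] (0 : ℝ), t + d ≤ M.T := by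
      filter_upwards [Ioo_mem_nhdsGT (sub_pos.2 htT)] with d hd
      linarith [hd.2]
    filter_upwards [hC, hshort] with d hd hdT
    set I := Set.Icc t (t + d) with hI
    set B := windows S I with hBdef
    have hBm : ∀ j, MeasurableSet (B j) := measurableSet_windows S measurableSet_Icc
    have hBI : ∀ j, B j ⊆ I := windows_subset S I
    have hBk : B k = I := if_pos hk
    have hz : ∀ j, ∀ s ∈ (z j).events, s ∉ B j := fun j s hs hsB => hd.1 j s hs (hBI j hsB)
    set F : (ι → Config) → ℝ≥0∞ := fun w => (oneEvent k I).indicator M.density (mixAll B z w)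
      with hF
    have hFm : Measurable F :=
      (M.measurable_density.indicator (measurableSet_oneEvent k measurableSet_Icc)).comp
        ((measurable_mixAll hBm).comp measurable_prodMk_left)
    -- exactly one event at node `k` and none elsewhere
    set A : Set (ι → Config) := {w | (w k).events.card = 1 ∧ ∀ j ≠ k, (w j).events.card = 0}
      with hA
    have hAm : MeasurableSet A := by
      have : A = {w | (w k).events.card = 1} ∩ ⋂ j, ⋂ _ : j ≠ k, {w | (w j).events.card = 0} := by
        ext w; simp [hA]
      rw [this]
      have hmc : ∀ (j : ι) (n : ℕ), MeasurableSet {w : ι → Config | (w j).events.card = n} :=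
        fun j n => (Config.measurable_card.comp (measurable_pi_apply j)) (measurableSet_singleton n)
      exact (hmc k 1).inter (MeasurableSet.iInter fun j => MeasurableSet.iInter fun _ => hmc j 0)
    have hcount : ∀ w : ι → Config, (∀ j, ∀ s ∈ (w j).events, s ∈ B j) →
        (mixAll B z w k).count I = (w k).events.card := by
      intro w hw
      have h1 : (z k).count (I \ B k) = 0 := by
        rw [hBk, Set.sdiff_self]
        simp [Config.count, Config.inside]
      have h2 : (w k).count (B k ∩ I) = (w k).events.card := by
        have : (w k).inside (B k ∩ I) = w k := by
          ext s
          rw [Config.mem_inside]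
          exact and_iff_left_of_imp fun hs => ⟨hw k s hs, hBI k (hw k s hs)⟩
        rw [Config.count, this]
      rw [mixAll, Config.count_mix, h1, h2, zero_add]
    have hAint : ∫⁻ w in A, F w ∂(M.windowLaw B) = ENNReal.ofReal (M.emptyProb B) *
        ∫⁻ u in I, ENNReal.ofReal (M.addDensity z k u) := by
      rw [hA, M.setLIntegral_single k hFm, hBk]
      congr 1
      have hbase : M.base.restrict I = volume.restrict I := by
        rw [base, Measure.restrict_restrict measurableSet_Icc, Set.inter_eq_left.2]
        exact Set.Icc_subset_Icc ht0 hdT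
      rw [hbase]
      refine setLIntegral_congr_fun measurableSet_Icc fun u hu => ?_
      have huB : u ∈ B k := hBk ▸ hu
      have hmem : ∀ j, ∀ s ∈ (Function.update (fun _ : ι => (⟨∅⟩ : Config)) k ⟨{u}⟩ j).events,
          s ∈ B j := by
        intro j s hs
        by_cases hj : j = k
        · subst hj
          rw [Function.update_self, Finset.mem_singleton] at hs
          exact hs ▸ huB
        · rw [Function.update_of_ne hj] at hs
          exact absurd hs (Finset.notMem_empty _)
      have hone : mixAll B z (Function.update (fun _ => ⟨∅⟩) k ⟨{u}⟩) ∈ oneEvent k I := by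
        rw [oneEvent, Set.mem_ofPred_eq, hcount _ hmem, Function.update_self]
        exact Finset.card_singleton u
      simp only [hF]
      rw [Set.indicator_of_mem hone, mixAll_single hz huB, M.density_addEvent]
      exact fun hu' => hz k u hu' huB
    have hcompl : ∫⁻ w in Aᶜ, F w ∂(M.windowLaw B) ≤
        ∫⁻ w in {w | 2 ≤ totalCard w}, M.density (mixAll B z w) ∂(M.windowLaw B) := by
      rw [← lintegral_indicator hAm.compl, ← lintegral_indicator (measurableSet_totalCard (2 ≤ ·))]
      refine lintegral_mono_ae ((M.ae_mem_window hBm).mono fun w hw => ?_)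
      by_cases hwE : w ∈ Aᶜ ∧ mixAll B z w ∈ oneEvent k I
      · have h1 : (w k).events.card = 1 := by
          have := hwE.2
          rwa [oneEvent, Set.mem_ofPred_eq, hcount w hw] at this
        have h2 : 2 ≤ totalCard w := by
          have hne : ∃ j, j ≠ k ∧ (w j).events.card ≠ 0 := by
            by_contra hno
            push Not at hno
            exact hwE.1 ⟨h1, hno⟩
          obtain ⟨j, hjk, hj⟩ := hne
          have := Finset.add_le_sum (f := fun j => (w j).events.card) (s := Finset.univ)
            (fun _ _ => Nat.zero_le _) (Finset.mem_univ j) (Finset.mem_univ k) hjk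
          rw [totalCard]
          omega
        rw [Set.indicator_of_mem hwE.1,
          Set.indicator_of_mem (show w ∈ {w | 2 ≤ totalCard w} from h2)]
        exact Set.indicator_le_self _ _ _
      · have h0 : Aᶜ.indicator F w = 0 := by
          by_cases hwA : w ∈ Aᶜ
          · rw [Set.indicator_of_mem hwA, hF]
            exact Set.indicator_of_notMem (fun h => hwE ⟨hwA, h⟩) _
          · exact Set.indicator_of_notMem hwA _
        rw [h0]
        exact zero_le
    have hsplit : M.resample B ((oneEvent k I).indicator M.density) z =
        ENNReal.ofReal (M.emptyProb B) * (∫⁻ u in I, ENNReal.ofReal (M.addDensity z k u)) +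
          ∫⁻ w in Aᶜ, F w ∂(M.windowLaw B) := by
      exact (lintegral_add_compl F hAm).symm.trans (congrArg (· + _) hAint)
    rw [hsplit]
    exact ⟨le_self_add, by gcongr⟩
  refine tendsto_of_tendsto_of_tendsto_of_le_of_le' hlow hup (hev.mono fun d hd => ?_)
    (hev.mono fun d hd => ?_)
  · rw [← mul_div_assoc]
    exact ENNReal.div_le_div_right hd.1 _
  · rw [← mul_div_assoc, ← ENNReal.add_div]
    exact ENNReal.div_le_div_right hd.2 _

/-- The Papangelou conditional intensity as a limit for a fixed realization `z`, in product form
over all nodes and all their events. -/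
theorem tendsto_condProb_div {z : ι → Config} {t : ℝ} (hz : M.density z ≠ 0)
    (ht : ∀ j, t ∉ (z j).events) (S : Set ι) {k : ι} (hk : k ∈ S) (ht0 : 0 ≤ t) (htT : t < M.T) :
    Tendsto (fun d => (M.condProb (windows S (Set.Icc t (t + d)))
      (oneEvent k (Set.Icc t (t + d))) z).toReal / d) (𝓝[>] 0)
      (𝓝 (M.lam z k t * ∏ j, (Real.exp (-∫ x, M.ker k j (x - t) ∂M.base) *
        ∏ s ∈ (z j).events, (M.lam z j s + M.ker k j (s - t)) / M.lam z j s))) := by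
  have h1 := ENNReal.Tendsto.div (M.tendsto_resample_oneEvent ht S hk ht0 htT)
    (Or.inr hz) (M.tendsto_resample_density ht S) (Or.inl (M.density_ne_top z))
  have hnn : 0 ≤ M.addDensity z k t :=
    mul_nonneg (M.lam_nonneg _ _ _) (Finset.prod_nonneg fun j _ => mul_nonneg (Real.exp_nonneg _)
      (Finset.prod_nonneg fun s _ => add_nonneg (M.lam_nonneg _ _ _) (M.ker_nonneg _ _ _)))
  have h2 := (ENNReal.tendsto_toReal (ENNReal.div_ne_top ENNReal.ofReal_ne_top hz)).comp h1
  rw [ENNReal.toReal_div, ENNReal.toReal_ofReal hnn, M.addDensity_div_density hz] at h2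
  refine h2.congr' ?_
  filter_upwards [self_mem_nhdsWithin] with d hd
  have hd' : 0 < d := hd
  simp only [Function.comp, condProb, ENNReal.toReal_div, ENNReal.toReal_ofReal hd'.le]
  exact div_right_comm _ _ _

end Cascade

/-! ### Deep Neyman-Scott processes as cascades -/

section GammaKernel

variable {p α β : ℝ}

theorem gammaKernel_of_nonpos {x : ℝ} (hx : x ≤ 0) : gammaKernel p α β x = 0 :=
  if_neg (not_lt.2 hx)

theorem gammaKernel_eq_indicator (p α β : ℝ) : gammaKernel p α β = (Set.Ioi 0).indicator
    fun x => p * (β ^ α / Real.Gamma α) * (x ^ (α - 1) * Real.exp (-(β * x))) := by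
  funext x
  by_cases hx : 0 < x
  · rw [Set.indicator_of_mem (Set.mem_Ioi.2 hx), gammaKernel, if_pos hx, ← mul_assoc]
  · rw [Set.indicator_of_notMem (show x ∉ Set.Ioi 0 from hx), gammaKernel, if_neg hx]

theorem gammaKernel_nonneg (hp : 0 < p) (hα : 0 < α) (hβ : 0 < β) (x : ℝ) :
    0 ≤ gammaKernel p α β x := by
  rw [gammaKernel]
  split_ifs with hx
  · have := Real.Gamma_pos_of_pos hα
    positivity
  · exact le_rfl

theorem measurable_gammaKernel (p α β : ℝ) : Measurable (gammaKernel p α β) := by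
  rw [gammaKernel_eq_indicator]
  exact (((measurable_id.pow_const _).mul (measurable_id.const_mul β).neg.exp).const_mul
    _).indicator measurableSet_Ioi

theorem continuousAt_gammaKernel (p α β : ℝ) {x : ℝ} (hx : x ≠ 0) :
    ContinuousAt (gammaKernel p α β) x := by
  rcases lt_or_gt_of_ne hx with h | h
  · have : gammaKernel p α β =ᶠ[𝓝 x] fun _ => 0 := by
      filter_upwards [Iio_mem_nhds h] with y hy
      exact gammaKernel_of_nonpos (le_of_lt hy)
    exact continuousAt_const.congr this.symm
  · have : gammaKernel p α β =ᶠ[𝓝 x] fun x =>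
        p * (β ^ α / Real.Gamma α) * x ^ (α - 1) * Real.exp (-(β * x)) := by
      filter_upwards [Ioi_mem_nhds h] with y hy
      exact if_pos hy
    refine ContinuousAt.congr ?_ this.symm
    exact (continuousAt_const.mul (Real.continuousAt_rpow_const _ _ (Or.inl hx))).mul
      (by fun_prop)

theorem integrable_gammaKernel (p : ℝ) (hα : 0 < α) (hβ : 0 < β) :
    Integrable (gammaKernel p α β) := by
  rw [gammaKernel_eq_indicator, integrable_indicator_iff measurableSet_Ioi]
  have h := integrableOn_rpow_mul_exp_neg_mul_rpow (p := 1) (s := α - 1) (b := β) (by linarith)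
    one_pos hβ
  simp only [Real.rpow_one, neg_mul] at h
  exact h.const_mul _

end GammaKernel

namespace DNSP

variable (M : DNSP)

theorem φ_nonneg (ℓ : ℕ) (i : Fin (M.width (ℓ + 1))) (k : Fin (M.width ℓ)) (x : ℝ) :
    0 ≤ M.φ ℓ i k x :=
  gammaKernel_nonneg (M.p_pos ℓ i k) (M.α_pos ℓ i k) (M.β_pos ℓ i k) x

theorem φ_of_nonpos (ℓ : ℕ) (i : Fin (M.width (ℓ + 1))) (k : Fin (M.width ℓ)) {x : ℝ}
    (hx : x ≤ 0) : M.φ ℓ i k x = 0 :=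
  gammaKernel_of_nonpos hx

/-- The nodes of the layers `0, …, depth`. They form a finite type, unlike `DNSP.Node`. -/
abbrev UsedNode : Type := (j : Fin (M.depth + 1)) × Fin (M.width j)

/-- The kernel between two arbitrary nodes, which vanishes unless the first node is in the layer
immediately above that of the second. -/
noncomputable def nodeKernel (a b : M.UsedNode) (u : ℝ) : ℝ :=
  if h : (a.1 : ℕ) = b.1 + 1 then M.φ b.1 (Fin.cast (congrArg M.width h) a.2) b.2 u else 0

/-- A deep Neyman-Scott process as a cascade: the rank of a node is the number of its layer, and
only the nodes of the top layer have a rate of their own. -/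
noncomputable def toCascade : Cascade M.UsedNode where
  T := M.T
  rate a := if h : (a.1 : ℕ) = M.depth then M.rate (Fin.cast (congrArg M.width h) a.2) else 0
  ker := M.nodeKernel
  rank a := a.1
  T_nonneg := M.T_pos.le
  rate_nonneg a := by
    split_ifs with h
    · exact (M.rate_pos _).le
    · exact le_rfl
  ker_nonneg a b u := by
    unfold nodeKernel
    split_ifs
    · exact M.φ_nonneg _ _ _ _
    · exact le_rfl
  ker_of_nonpos a b u hu := by
    unfold nodeKernel
    split_ifs
    · exact M.φ_of_nonpos _ _ _ hu
    · rfl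
  ker_measurable a b := by
    unfold nodeKernel
    split_ifs
    · exact measurable_gammaKernel _ _ _
    · exact measurable_const
  ker_continuousAt a b u hu := by
    unfold nodeKernel
    split_ifs
    · exact continuousAt_gammaKernel _ _ _ hu
    · exact continuousAt_const
  ker_integrable a b := by
    unfold nodeKernel
    split_ifs
    · exact integrable_gammaKernel _ (M.α_pos _ _ _) (M.β_pos _ _ _)
    · exact integrable_zero _ _ _
  ker_eq_zero a b hab u := dif_neg (by omega)

/-- The restriction of a state to the layers `0, …, depth`. -/
def used (z : M.State) : M.UsedNode → Config := fun a => z a.1 a.2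

theorem nodeKernel_succ {ℓ : ℕ} (h1 : ℓ + 1 < M.depth + 1) (i : Fin (M.width (ℓ + 1)))
    (h0 : ℓ < M.depth + 1) (k : Fin (M.width ℓ)) :
    M.nodeKernel ⟨⟨ℓ + 1, h1⟩, i⟩ ⟨⟨ℓ, h0⟩, k⟩ = M.φ ℓ i k :=
  funext fun _ => dif_pos rfl

theorem nodeKernel_of_ne {a b : M.UsedNode} (h : (a.1 : ℕ) ≠ b.1 + 1) (u : ℝ) :
    M.nodeKernel a b u = 0 :=
  dif_neg h

theorem lam_toCascade (z : M.State) {ℓ : ℕ} (hℓ : ℓ < M.depth + 1) (k : Fin (M.width ℓ)) :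
    M.toCascade.lam (M.used z) ⟨⟨ℓ, hℓ⟩, k⟩ = M.intensity z ℓ k := by
  funext u
  simp only [Cascade.lam, toCascade, intensity, used]
  rw [Fintype.sum_sigma]
  by_cases h : ℓ = M.depth
  · rw [dif_pos h, dif_pos h]
    refine add_eq_left.2 (Finset.sum_eq_zero fun j _ => Finset.sum_eq_zero fun i _ =>
      Finset.sum_eq_zero fun s _ => M.nodeKernel_of_ne ?_ _)
    have := j.2
    simp only
    omega
  · rw [dif_neg h, dif_neg h, zero_add]
    have h1 : ℓ + 1 < M.depth + 1 := by omega
    rw [Fintype.sum_eq_single ⟨ℓ + 1, h1⟩]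
    · simp only [M.nodeKernel_succ h1]
    · intro j hj
      refine Finset.sum_eq_zero fun i _ => Finset.sum_eq_zero fun s _ => M.nodeKernel_of_ne ?_ _
      exact fun h => hj (Fin.ext h)

theorem intensityMeasure_toCascade (z : M.State) {ℓ : ℕ} (hℓ : ℓ < M.depth + 1)
    (k : Fin (M.width ℓ)) :
    M.toCascade.intensityMeasure (M.used z) ⟨⟨ℓ, hℓ⟩, k⟩ = M.intensityMeasure z ℓ k := by
  simp only [Cascade.intensityMeasure, M.lam_toCascade]
  rfl

/-- A product over the nodes reduces to one layer if the other layers contribute `1`. -/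
theorem prod_used_layer {R : Type*} [CommMonoid R] {ℓ : ℕ} (hℓ : ℓ < M.depth + 1)
    {f : M.UsedNode → R} (hf : ∀ a : M.UsedNode, (a.1 : ℕ) ≠ ℓ → f a = 1) :
    ∏ a, f a = ∏ k : Fin (M.width ℓ), f ⟨⟨ℓ, hℓ⟩, k⟩ := by
  rw [Fintype.prod_sigma, Fintype.prod_eq_single ⟨ℓ, hℓ⟩]
  exact fun j hj => Finset.prod_eq_one fun i _ => hf _ fun h => hj (Fin.ext h)

section Law

variable {Ω : Type*} [MeasurableSpace Ω] {P : Measure Ω} {N : Ω → M.State}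

variable {M}

theorem IsDeepNeymanScott.measurable_used (hN : M.IsDeepNeymanScott P N) :
    Measurable fun ω => M.used (N ω) :=
  measurable_pi_lambda _ fun a => hN.measurable a.1 (Nat.lt_succ_iff.1 a.1.2) a.2

/-- The joint law of a deep Neyman-Scott process has a density with respect to independent unit rate
Poisson processes. -/
theorem IsDeepNeymanScott.map_used [IsProbabilityMeasure P] (hN : M.IsDeepNeymanScott P N) :
    P.map (fun ω => M.used (N ω)) = M.toCascade.refLaw.withDensity M.toCascade.density := by
  refine M.toCascade.map_eq_withDensity P hN.measurable_used fun r A hA => ?_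
  have hrank : ∀ a : M.UsedNode, M.toCascade.rank a = a.1 := fun _ => rfl
  simp only [hrank]
  by_cases hr : r ≤ M.depth
  · have hr' : r < M.depth + 1 := Nat.lt_succ_iff.2 hr
    set H : Set Ω := {ω | ∀ a : M.UsedNode, r < (a.1 : ℕ) → M.used (N ω) a ∈ A a} with hH
    have hHm : MeasurableSet[M.above N r] H := by
      have hHi : H = ⋂ a : M.UsedNode, ⋂ _ : r < (a.1 : ℕ), {ω | M.used (N ω) a ∈ A a} := by
        ext ω; simp [hH]
      rw [hHi]
      refine MeasurableSet.iInter fun a => MeasurableSet.iInter fun ha => ?_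
      have hle : MeasurableSpace.comap (fun ω => N ω a.1 a.2) inferInstance ≤ M.above N r :=
        le_iSup_of_le (a.1 : ℕ) (le_iSup_of_le ⟨ha, Nat.lt_succ_iff.1 a.1.2⟩
          (le_iSup_of_le a.2 le_rfl))
      exact hle _ ⟨A a, hA a, rfl⟩
    have hsplit : {ω | ∀ a : M.UsedNode, r ≤ (a.1 : ℕ) → M.used (N ω) a ∈ A a} =
        H ∩ ⋂ k, {ω | N ω r k ∈ A ⟨⟨r, hr'⟩, k⟩} := by
      ext ω
      simp only [hH, Set.mem_inter_iff, Set.mem_iInter, Set.mem_ofPred_eq]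
      constructor
      · exact fun h => ⟨fun a ha => h a ha.le, fun k => h ⟨⟨r, hr'⟩, k⟩ le_rfl⟩
      · rintro ⟨h1, h2⟩ ⟨⟨j, hj⟩, i⟩ ha
        rcases Nat.eq_or_lt_of_le ha with h | h
        · obtain rfl : r = j := h
          exact h2 i
        · exact h1 _ h
    rw [hsplit, hN.layer_law r hr H hHm _ fun k => hA _]
    refine lintegral_congr fun ω => ?_
    rw [Finset.prod_filter, M.prod_used_layer hr' fun a ha => if_neg ha]
    simp [M.intensityMeasure_toCascade]
  · have h1 : ∀ a : M.UsedNode, ¬ r ≤ (a.1 : ℕ) := fun a => by have := a.1.2; omega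
    have h2 : ∀ a : M.UsedNode, ¬ r < (a.1 : ℕ) := fun a h => h1 a h.le
    have h3 : ∀ a : M.UsedNode, ¬ (a.1 : ℕ) = r := fun a h => h1 a h.ge
    simp [h1, h2, h3]

theorem IsDeepNeymanScott.ae_density_ne_zero [IsProbabilityMeasure P]
    (hN : M.IsDeepNeymanScott P N) : ∀ᵐ ω ∂P, M.toCascade.density (M.used (N ω)) ≠ 0 := by
  refine ae_of_ae_map (p := fun x => M.toCascade.density x ≠ 0)
    hN.measurable_used.aemeasurable ?_
  rw [hN.map_used, ae_withDensity_iff M.toCascade.measurable_density]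
  exact Eventually.of_forall fun _ h => h

theorem IsDeepNeymanScott.ae_notMem [IsProbabilityMeasure P] (hN : M.IsDeepNeymanScott P N)
    (t : ℝ) : ∀ᵐ ω ∂P, ∀ a, t ∉ (M.used (N ω) a).events := by
  refine ae_of_ae_map (p := fun x => ∀ a, t ∉ (x a).events) hN.measurable_used.aemeasurable ?_
  rw [hN.map_used]
  refine (withDensity_absolutelyContinuous _ _).ae_le ?_
  refine ae_all_iff.2 fun a => ?_
  have h := (measurePreserving_eval (fun _ : M.UsedNode => poissonLaw M.toCascade.base)
    a).quasiMeasurePreserving.ae (poissonLaw.ae_forall_notMem (ν := M.toCascade.base) (B := {t})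
      (measurableSet_singleton t) (measure_singleton t))
  exact h.mono fun x hx hmem => hx t hmem rfl

variable (M) in
omit [MeasurableSpace Ω] in
/-- In terms of the finitely many used nodes, the information outside `B` is that of one random
variable. -/
theorem informationOutside_eq (N : Ω → M.State) (S : Set M.Node) (B : Set ℝ) :
    M.informationOutside N S B = MeasurableSpace.comap
      (fun ω => outsideAll (Cascade.windows {a : M.UsedNode | (⟨a.1, a.2⟩ : M.Node) ∈ S} B)
        (M.used (N ω))) inferInstance := by
  classical
  have hcoord : ∀ (j : ℕ) (hj : j < M.depth + 1) (i : Fin (M.width j)),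
      (fun ω => if (⟨j, i⟩ : M.Node) ∈ S then (N ω j i).outside B else N ω j i) =
        fun ω => outsideAll (Cascade.windows {a : M.UsedNode | (⟨a.1, a.2⟩ : M.Node) ∈ S} B)
          (M.used (N ω)) ⟨⟨j, hj⟩, i⟩ := by
    intro j hj i
    funext ω
    by_cases h : (⟨j, i⟩ : M.Node) ∈ S
    · rw [if_pos h, outsideAll, Cascade.windows, if_pos]
      · rfl
      · exact h
    · rw [if_neg h, outsideAll, Cascade.windows, if_neg, Config.outside_empty]
      · rfl
      · exact h
  apply le_antisymm
  · refine iSup_le fun j => iSup_le fun hj => iSup_le fun i => ?_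
    have hj' := Nat.lt_succ_iff.2 hj
    refine (le_of_eq (congrArg (fun f => MeasurableSpace.comap f inferInstance)
      (hcoord j hj' i))).trans ?_
    rw [MeasurableSpace.pi, MeasurableSpace.comap_iSup]
    refine le_iSup_of_le (⟨⟨j, hj'⟩, i⟩ : M.UsedNode) ?_
    rw [MeasurableSpace.comap_comp]
    rfl
  · rw [MeasurableSpace.pi, MeasurableSpace.comap_iSup]
    refine iSup_le fun a => ?_
    obtain ⟨⟨j, hj⟩, i⟩ := a
    rw [MeasurableSpace.comap_comp]
    refine le_iSup_of_le j (le_iSup_of_le (Nat.lt_succ_iff.1 hj) (le_iSup_of_le i ?_))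
    refine le_of_eq ?_
    congr 1
    exact (hcoord j hj i).symm

end Law

theorem integral_φ_base {t : ℝ} (ht0 : 0 ≤ t) {ℓ : ℕ} (i : Fin (M.width (ℓ + 1)))
    (k : Fin (M.width ℓ)) :
    ∫ x, M.φ ℓ i k (x - t) ∂M.toCascade.base = M.Φ ℓ i k (M.T - t) := by
  have hint : ∀ a b, IntervalIntegrable (M.φ ℓ i k) volume a b := fun a b =>
    (integrable_gammaKernel _ (M.α_pos ℓ i k) (M.β_pos ℓ i k)).intervalIntegrable
  have h0 : ∫ x in (-t)..0, M.φ ℓ i k x = 0 := by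
    refine (intervalIntegral.integral_congr (g := fun _ => 0) fun x hx =>
      M.φ_of_nonpos _ _ _ ?_).trans intervalIntegral.integral_zero
    rw [Set.uIcc_of_le (by linarith)] at hx
    exact hx.2
  change ∫ x in Set.Icc 0 M.T, M.φ ℓ i k (x - t) = _
  rw [integral_Icc_eq_integral_Ioc, ← intervalIntegral.integral_of_le M.T_pos.le,
    intervalIntegral.integral_comp_sub_right (M.φ ℓ i k), zero_sub,
    ← intervalIntegral.integral_add_adjacent_intervals (hint _ 0) (hint 0 _), h0, zero_add]
  rfl

/-- A realization of positive density has positive intensity at each of its events. So the divisions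
in the conditional intensity are genuine. -/
theorem lam_ne_zero_of_density {z : M.State} (hz : M.toCascade.density (M.used z) ≠ 0)
    (a : M.UsedNode) {s : ℝ} (hs : s ∈ (M.used z a).events) :
    M.toCascade.lam (M.used z) a s ≠ 0 := by
  intro h
  refine hz (Finset.prod_eq_zero (Finset.mem_univ a) ?_)
  rw [Cascade.nodeWeight, Finset.prod_eq_zero hs (by rw [h, ENNReal.ofReal_zero]), mul_zero]

/-- Only the nodes of the layer immediately below, and only their events after `t`, contribute to
the conditional intensity. -/
theorem prod_papangelou {z : M.State} (hz : M.toCascade.density (M.used z) ≠ 0) {t : ℝ}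
    (ht0 : 0 ≤ t) {m : ℕ} (hm : m + 1 < M.depth + 1)
    (k : Fin (M.width (m + 1))) :
    ∏ a, (Real.exp (-∫ x, M.toCascade.ker ⟨⟨m + 1, hm⟩, k⟩ a (x - t) ∂M.toCascade.base) *
        ∏ s ∈ (M.used z a).events, (M.toCascade.lam (M.used z) a s +
          M.toCascade.ker ⟨⟨m + 1, hm⟩, k⟩ a (s - t)) / M.toCascade.lam (M.used z) a s) =
      ∏ i : Fin (M.width m), (Real.exp (-(M.Φ m k i (M.T - t))) *
        ∏ u ∈ (z m i).events with t < u,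
          (M.intensity z m i u + M.φ m k i (u - t)) / M.intensity z m i u) := by
  have hm0 : m < M.depth + 1 := by omega
  have hker : M.toCascade.ker = M.nodeKernel := rfl
  simp only [hker]
  rw [M.prod_used_layer hm0]
  · refine Finset.prod_congr rfl fun i _ => ?_
    rw [M.nodeKernel_succ, M.integral_φ_base ht0, M.lam_toCascade, Finset.prod_filter]
    congr 1
    refine Finset.prod_congr rfl fun s hs => ?_
    split_ifs with h
    · rfl
    · -- an event at or before `t` contributes the factor `1`
      rw [M.φ_of_nonpos _ _ _ (by linarith), add_zero, div_self]
      have := M.lam_ne_zero_of_density hz ⟨⟨m, hm0⟩, i⟩ hs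
      rwa [M.lam_toCascade] at this
  · intro a ha
    have h0 : ∀ u, M.nodeKernel ⟨⟨m + 1, hm⟩, k⟩ a u = 0 :=
      M.nodeKernel_of_ne fun h => ha (by simp only at h; omega)
    simp only [h0, integral_zero, neg_zero, Real.exp_zero, one_mul, add_zero]
    exact Finset.prod_eq_one fun s hs => div_self (M.lam_ne_zero_of_density hz a hs)

end DNSP

/-! ### The Papangelou conditional intensity -/

theorem proposition1 {Ω : Type*} [MeasurableSpace Ω] (P : Measure Ω) [IsProbabilityMeasure P]
    (M : DNSP) (N : Ω → M.State) (hN : M.IsDeepNeymanScott P N)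
    (m : ℕ) (hm : m + 1 ≤ M.depth) (k : Fin (M.width (m + 1)))
    (S : Set M.Node) (hS : (⟨m + 1, k⟩ : M.Node) ∈ S)
    (t : ℝ) (ht0 : 0 ≤ t) (htT : t < M.T) :
    IsPapangelouIntensity P (fun ω => N ω (m + 1) k) (M.informationOutside N S) t
      (fun ω => M.intensity (N ω) (m + 1) k t *
        ∏ i : Fin (M.width m),
          (Real.exp (-(M.Φ m k i (M.T - t))) *
            ∏ u ∈ (N ω m i).events with t < u,
              (M.intensity (N ω) m i u + M.φ m k i (u - t)) / M.intensity (N ω) m i u)) := by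
  have hm' : m + 1 < M.depth + 1 := Nat.lt_succ_iff.2 hm
  refine ⟨fun d ω => (M.toCascade.condProb
    (Cascade.windows {a : M.UsedNode | (⟨a.1, a.2⟩ : M.Node) ∈ S} (Set.Icc t (t + d)))
    (Cascade.oneEvent (⟨⟨m + 1, hm'⟩, k⟩ : M.UsedNode) (Set.Icc t (t + d))) (M.used (N ω))).toReal,
    fun d _ => ?_, ?_⟩
  · rw [M.informationOutside_eq]
    exact M.toCascade.condProb_ae_eq P hN.measurable_used hN.map_used
      (Cascade.measurableSet_windows _ measurableSet_Icc)
      (Cascade.measurableSet_oneEvent _ measurableSet_Icc)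
  · filter_upwards [hN.ae_density_ne_zero, hN.ae_notMem t] with ω hz ht
    have h := M.toCascade.tendsto_condProb_div hz ht
      {a : M.UsedNode | (⟨a.1, a.2⟩ : M.Node) ∈ S} (k := ⟨⟨m + 1, hm'⟩, k⟩) hS ht0 htT
    rwa [M.lam_toCascade, M.prod_papangelou hz ht0 hm'] at h
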